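/- Let $v_0\in L^2(\mathbb R^3;\mathbb R^3)$ have angular component $v_{0,\theta}$ with $r\,v_{0,\theta}\in L^\infty(\mathbb R^3)$, where $r=|x'|=\sqrt{x_1^2+x_2^2}$ is the distance to the $z$-axis. Then there is a constant $C>0$, depending only on $v_0$, with the following property. Let $T>0$ and let $v$ be a smooth, axially symmetric Leray--Hopf solution, with some smooth pressure $p$, of the three-dimensional Navier--Stokes equations $$\Delta v-(v\cdot\nabla)v-\nabla p-\partial_t v=0,\qquad \operatorname{div}v=0\qquad\text{in }\mathbb R^3\times(-T,0)$$ with initial data $v_0=v(\cdot,-T)$; that is, $v(\cdot,t)\to v_0$ in $L^2(\mathbb R^3)$ as $t\downarrow -T$ and, for all $t\in(-T,0)$, $$\|v(\cdot,t)\|_{L^2(\mathbb R^3)}^2+2\int_{-T}^t\|\nabla v(\cdot,s)\|_{L^2(\mathbb R^3)}^2\,ds\le\|v_0\|_{L^2(\mathbb R^3)}^2 .$$ Write $v=v_re_r+v_\theta e_\theta+v_ze_z$ in cylindrical coordinates and let $\omega_\theta=(\operatorname{curl}v)\cdot e_\theta=\partial_zv_r-\partial_rv_z$ be the angular vorticity.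 Let $R=\min\{1,\sqrt{T/2}\}$. Then for all $(x,t)\in\mathbb R^3\times(-R^2,0)$ with $r=|x'|\in(0,\min\{R,\tfrac12\})$, $$\begin{aligned}|\omega_\theta(x,t)|\le{}&\frac{C\ln(1/r)}{r^{7/2}}\left[\sup_{s\in[t-r^2,t]}\left(\int_{B(x,4r)}(v_r^2+v_z^2)(y,s)\,dy\right)^{1/2}+r^{1/2}\big(\|r\,v_{0,\theta}\|_{L^\infty(\mathbb R^3)}+1\big)\right]^2\\&\times\left[\left(\int_{t-r^2}^t\int_{B(x,4r)}\omega_\theta^2(y,s)\,dy\,ds\right)^{1/2}+r^{1/2}\big(\|r\,v_{0,\theta}\|_{L^\infty(\mathbb R^3)}+1\big)\right].\end{aligned}$$ -/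

import Mathlib

open MeasureTheory Set Filter Topology
open scoped ContDiff

noncomputable section

namespace AxisymNS

/-- Euclidean three-space. -/
abbrev E3 : Type := EuclideanSpace ℝ (Fin 3)

/-- The distance `r = |x'|` from `x` to the `z`-axis. -/
def rad (x : E3) : ℝ := Real.sqrt (x 0 ^ 2 + x 1 ^ 2)

/-- The radial unit vector (the zero vector on the axis). -/
def eR (x : E3) : E3 := !₂[x 0 / rad x, x 1 / rad x, 0]

/-- The angular unit vector (the zero vector on the axis). -/
def eTheta (x : E3) : E3 := !₂[-(x 1) / rad x, x 0 / rad x, 0]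

/-- Radial component of a vector field. -/
def compR (u : E3 → E3) (x : E3) : ℝ := inner ℝ (u x) (eR x)

/-- Angular component of a vector field. -/
def compTheta (u : E3 → E3) (x : E3) : ℝ := inner ℝ (u x) (eTheta x)

/-- Vertical component of a vector field. -/
def compZ (u : E3 → E3) (x : E3) : ℝ := u x 2

/-- A vector field is axially symmetric if its cylindrical components depend on `(r, z)` only. -/
def IsAxisymmetric (u : E3 → E3) : Prop :=
  ∀ x y : E3, rad x = rad y → x 2 = y 2 →
    compR u x = compR u y ∧ compTheta u x = compTheta u y ∧ compZ u x = compZ u y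

/-- The partial derivative `∂ⱼ u` of a vector field. -/
def pd (j : Fin 3) (u : E3 → E3) (x : E3) : E3 :=
  fderiv ℝ u x (EuclideanSpace.single j 1)

/-- Divergence of a vector field. -/
def div3 (u : E3 → E3) (x : E3) : ℝ := ∑ i : Fin 3, pd i u x i

/-- Curl of a vector field. -/
def curl3 (u : E3 → E3) (x : E3) : E3 :=
  !₂[pd 1 u x 2 - pd 2 u x 1, pd 2 u x 0 - pd 0 u x 2, pd 0 u x 1 - pd 1 u x 0]

/-- Squared Hilbert-Schmidt norm `|∇u|²` of the gradient of a vector field. -/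
def gradSq (u : E3 → E3) (x : E3) : ℝ := ∑ j : Fin 3, ‖pd j u x‖ ^ 2

/-- `(v, p)` is a smooth (classical) solution of the incompressible Navier-Stokes equations with
unit viscosity in `ℝ³ × (-T, 0)`. -/
structure IsSmoothNSSolution (T : ℝ) (v : E3 → ℝ → E3) (p : E3 → ℝ → ℝ) : Prop where
  smooth_velocity : ContDiffOn ℝ ∞ (fun q : E3 × ℝ => v q.1 q.2) (univ ×ˢ Ioo (-T) 0)
  smooth_pressure : ContDiffOn ℝ ∞ (fun q : E3 × ℝ => p q.1 q.2) (univ ×ˢ Ioo (-T) 0)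
  momentum : ∀ x : E3, ∀ t ∈ Ioo (-T) 0,
    Laplacian.laplacian (fun y => v y t) x - fderiv ℝ (fun y => v y t) x (v x t)
      - gradient (fun y => p y t) x - deriv (fun s => v x s) t = 0
  incompressible : ∀ x : E3, ∀ t ∈ Ioo (-T) 0, div3 (fun y => v y t) x = 0

/-- The Leray-Hopf conditions for a velocity field on `ℝ³ × (-T, 0)` with initial data `v₀` at
time `-T`: the data is attained in `L²`, and the energy inequality holds. (Lower integrals are
used, so that for `v₀ ∈ L²` the inequality includes finiteness of the left-hand side.) -/
structure IsLerayHopf (T : ℝ) (v₀ : E3 → E3) (v : E3 → ℝ → E3) : Prop where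
  initial : Tendsto (fun t : ℝ => eLpNorm (fun x => v x t - v₀ x) 2 volume) (𝓝[>] (-T)) (𝓝 0)
  energy : ∀ t ∈ Ioo (-T) 0,
    (∫⁻ x, ENNReal.ofReal (‖v x t‖ ^ 2))
        + 2 * ∫⁻ s in Ioo (-T) t, ∫⁻ x, ENNReal.ofReal (gradSq (fun y => v y s) x)
      ≤ ∫⁻ x, ENNReal.ofReal (‖v₀ x‖ ^ 2)

/-- The angular vorticity `ω_θ = (curl v) · e_θ` at time `t`. -/
def vortTheta (v : E3 → ℝ → E3) (x : E3) (t : ℝ) : ℝ :=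
  compTheta (curl3 (fun y => v y t)) x

/-- `‖r v_{0,θ}‖_{L^∞(ℝ³)}`. -/
def swirlNorm (v₀ : E3 → E3) : ℝ :=
  (eLpNorm (fun x => rad x * compTheta v₀ x) ⊤ volume).toReal

/-- `sup_{s ∈ [t - r², t]} (∫_{B(x, 4r)} (v_r² + v_z²)(y, s) dy)^{1/2}` with `r = |x'|`. -/
def localVelocity (v : E3 → ℝ → E3) (x : E3) (t : ℝ) : ℝ :=
  ⨆ s : Icc (t - rad x ^ 2) t,
    Real.sqrt (∫ y in Metric.ball x (4 * rad x),
      (compR (fun z => v z s) y ^ 2 + compZ (fun z => v z s) y ^ 2))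

/-- `(∫_{t - r²}^t ∫_{B(x, 4r)} ω_θ²(y, s) dy ds)^{1/2}` with `r = |x'|`. -/
def localVorticity (v : E3 → ℝ → E3) (x : E3) (t : ℝ) : ℝ :=
  Real.sqrt (∫ s in (t - rad x ^ 2)..t, ∫ y in Metric.ball x (4 * rad x), vortTheta v y s ^ 2)

end AxisymNS

end

open MeasureTheory Set Filter Topology
open scoped ContDiff

noncomputable section

namespace AxisymNS

/-! ### Directional derivatives of scalar functions. -/

section Calculus

variable {E : Type*} [NormedAddCommGroup E] [NormedSpace ℝ E]

/-! The quotient `Ω = ω_θ / r` solves a scalar drift-diffusion equation whose only source is `∂_z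
(v_θ² / r²)`. Near a point at distance `r` from the axis, the dilation by `r` in space and `r²` in
time moves the point to `(r, z) = (1, 0)` at time `0`. There the problem lives on a unit box of the
meridional half-plane, away from the axis, and is genuinely two-dimensional. Three quantities
describe it: a bound `N` for the source, the `L^∞_t L²` norm `K` of the drift `(v_r, v_z)`, and the
`L²` norm `W` of `Ω` in space-time. The estimate `|Ω| ≤ C K² (W + 1)`, with `C` depending on `N`
alone (`exists_local_bound`), scales back to the theorem.

The local estimate is a Moser iteration with the weights `(1 + Ω²)^m`. An `L²` drift is
scale-critical in the plane, and the planar Gagliardo inequality `‖h‖₂ ≤ S ‖∇h‖₁` is exactly what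
handles it. The drift term is at most a multiple of `K ‖ψ^{k+1} (1 + Ω²)^m‖₂`, hence of `K` times
the `L¹` norm of a gradient, and Young's inequality absorbs the gradient of `Ω` into the dissipation
(`integral_drift_le`, `energy_le`). The same inequality, applied to `ψ^{k+2} (1 + Ω²)^m`, doubles
the exponent (`integral_moserB_sq_le`), so the space-time integrals `I_m` satisfy `I_{2m} ≤ (c K² m²
I_m)²` (`moserI_double_le`). One fixed cutoff `ψ` is raised to growing powers instead of shrinking
the domain. Unrolling the recursion bounds `1 + Ω²` at the centre by `C K⁴ (1 + W²)`.

The source is controlled by the maximum principle for the swirl `Γ = r v_θ`: it stays below its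
initial supremum (`abs_circ_le_swirlNorm`). Only the energy is available at infinity, so the
principle is proved by localization. Take a convex function of `Γ` that vanishes for `|Γ| ≤ m` and
is dominated by both `|Γ|` and `Γ²`, and cut it off at radius `ρ`. Since `|Γ| ≤ |x| |v|`, every
cutoff error is at most a constant times `|v|²` on the shell `|x| ~ ρ`, without powers of `ρ`.
Summing over `L` disjoint dyadic shells bounds `L` times the excess at a fixed radius by initial
excesses plus a multiple of the total energy over the time interval. The initial excesses tend to
zero, so `L → ∞` forces the excess to vanish.

Neither argument needs the pressure to be axially symmetric. Its restriction to a half-plane enters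
as a gradient there and is removed by the curl. In the swirl equation it enters as an angular
derivative, which integrates to zero against symmetric functions.

The local argument gives the bound without the logarithm, which is then inserted using `r < 1/2`. -/

/-- The derivative of a scalar function in the direction `e`. -/
def dd (e : E) (f : E → ℝ) (x : E) : ℝ := fderiv ℝ f x e

theorem contDiff_dd {n : WithTop ℕ∞} {f : E → ℝ} (e : E) (hf : ContDiff ℝ (n + 1) f) :
    ContDiff ℝ n (dd e f) :=
  (hf.fderiv_right le_rfl).clm_apply contDiff_const

theorem smooth_dd {f : E → ℝ} (e : E) (hf : ContDiff ℝ ∞ f) : ContDiff ℝ ∞ (dd e f) :=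
  (hf.fderiv_right (by simp)).clm_apply contDiff_const

theorem continuous_dd {f : E → ℝ} (e : E) (hf : ContDiff ℝ 1 f) : Continuous (dd e f) :=
  (contDiff_dd (n := 0) e (by simpa using hf)).continuous

theorem dd_congr {f g : E → ℝ} {x : E} (e : E) (h : f =ᶠ[𝓝 x] g) : dd e f x = dd e g x := by
  unfold dd; rw [h.fderiv_eq]

theorem dd_add_dir (e e' : E) (f : E → ℝ) (x : E) : dd (e + e') f x = dd e f x + dd e' f x := by
  simp [dd]

theorem dd_smul_dir (c : ℝ) (e : E) (f : E → ℝ) (x : E) : dd (c • e) f x = c * dd e f x := by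
  simp [dd]

theorem dd_const (e : E) (c : ℝ) (x : E) : dd e (fun _ => c) x = 0 := by
  simp [dd]

theorem dd_add {f g : E → ℝ} {x : E} (e : E) (hf : DifferentiableAt ℝ f x)
    (hg : DifferentiableAt ℝ g x) : dd e (fun y => f y + g y) x = dd e f x + dd e g x := by
  unfold dd; rw [fderiv_fun_add hf hg]; rfl

theorem dd_sub {f g : E → ℝ} {x : E} (e : E) (hf : DifferentiableAt ℝ f x)
    (hg : DifferentiableAt ℝ g x) : dd e (fun y => f y - g y) x = dd e f x - dd e g x := by
  unfold dd; rw [fderiv_fun_sub hf hg]; rfl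

theorem dd_mul {f g : E → ℝ} {x : E} (e : E) (hf : DifferentiableAt ℝ f x)
    (hg : DifferentiableAt ℝ g x) :
    dd e (fun y => f y * g y) x = dd e f x * g x + f x * dd e g x := by
  unfold dd; rw [fderiv_fun_mul hf hg]; simp; ring

theorem dd_const_mul {f : E → ℝ} {x : E} (e : E) (c : ℝ) (hf : DifferentiableAt ℝ f x) :
    dd e (fun y => c * f y) x = c * dd e f x := by
  rw [dd_mul e (by fun_prop) hf, dd_const]; ring

theorem dd_comp {F : ℝ → ℝ} {F' : ℝ} {f : E → ℝ} {x : E} (e : E) (hF : HasDerivAt F F' (f x))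
    (hf : DifferentiableAt ℝ f x) : dd e (fun y => F (f y)) x = F' * dd e f x := by
  unfold dd
  have := hF.comp_hasFDerivAt x hf.hasFDerivAt
  rw [show (fun y => F (f y)) = F ∘ f from rfl, this.fderiv]; simp

theorem dd_pow {f : E → ℝ} {x : E} (e : E) (n : ℕ) (hf : DifferentiableAt ℝ f x) :
    dd e (fun y => f y ^ n) x = n * f x ^ (n - 1) * dd e f x :=
  dd_comp (F := fun s => s ^ n) e (hasDerivAt_pow n (f x)) hf

theorem dd_clm (e : E) (l : E →L[ℝ] ℝ) (x : E) : dd e (fun y => l y) x = l e := by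
  simp [dd]

theorem dd_comm {f : E → ℝ} (hf : ContDiff ℝ 2 f) (e e' : E) (x : E) :
    dd e (dd e' f) x = dd e' (dd e f) x := by
  have h : IsSymmSndFDerivAt ℝ f x :=
    hf.contDiffAt.isSymmSndFDerivAt (by simp)
  have hd : DifferentiableAt ℝ (fderiv ℝ f) x :=
    ((hf.fderiv_right (m := 1) (by norm_num)).differentiable (by norm_num)) x
  have key : ∀ a b : E, dd a (dd b f) x = fderiv ℝ (fderiv ℝ f) x a b := by
    intro a b
    change fderiv ℝ (fun y => fderiv ℝ f y b) x a = _
    rw [fderiv_clm_apply hd (by fun_prop)]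
    simp
  rw [key, key]; exact h e e'

theorem hasDerivAt_dd {f : E → ℝ} {c : ℝ → E} {c' : E} {s : ℝ}
    (hf : DifferentiableAt ℝ f (c s)) (hc : HasDerivAt c c' s) :
    HasDerivAt (fun s => f (c s)) (dd c' f (c s)) s :=
  hf.hasFDerivAt.comp_hasDerivAt s hc

/-- The directional derivative of a composition with an affine-like map. -/
theorem dd_comp_map {E' : Type*} [NormedAddCommGroup E'] [NormedSpace ℝ E'] {f : E → ℝ}
    {A : E' → E} {L : E' →L[ℝ] E} {x : E'} (e : E') (hf : DifferentiableAt ℝ f (A x))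
    (hA : HasFDerivAt A L x) : dd e (fun y => f (A y)) x = dd (L e) f (A x) := by
  unfold dd
  rw [show (fun y => f (A y)) = f ∘ A from rfl, (hf.hasFDerivAt.comp x hA).fderiv]; simp

end Calculus

/-! ### Integrals over time slices of functions with compact spatial support. -/

section Slices

variable {E : Type*} [NormedAddCommGroup E] [NormedSpace ℝ E]

theorem dd_eq_zero_of_notMem {f : E × ℝ → ℝ} {K : Set E} (hK : IsCompact K)
    (h0 : ∀ x ∉ K, ∀ t, f (x, t) = 0) (e : E × ℝ) : ∀ x ∉ K, ∀ t, dd e f (x, t) = 0 := by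
  intro x hx t
  have : f =ᶠ[𝓝 (x, t)] fun _ => 0 := by
    have ho : IsOpen (Kᶜ ×ˢ (univ : Set ℝ)) := hK.isClosed.isOpen_compl.prod isOpen_univ
    filter_upwards [ho.mem_nhds (show (x, t) ∈ _ from ⟨hx, trivial⟩)] with y hy
    exact h0 y.1 hy.1 y.2
  rw [dd_congr e this, dd_const]

theorem integrable_slice {E : Type*} [NormedAddCommGroup E] [MeasurableSpace E] [BorelSpace E]
    {μ : Measure E} [IsFiniteMeasureOnCompacts μ] {f : E × ℝ → ℝ} (hf : Continuous f) {K : Set E}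
    (hK : IsCompact K) (h0 : ∀ x ∉ K, ∀ t, f (x, t) = 0) (t : ℝ) : Integrable (fun x => f (x, t)) μ := by
  apply Continuous.integrable_of_hasCompactSupport (by fun_prop)
  exact HasCompactSupport.intro hK (fun x hx => h0 x hx t)

variable [MeasurableSpace E] [BorelSpace E] [FiniteDimensional ℝ E]
  {μ : Measure E} [μ.IsAddHaarMeasure]

theorem continuous_integral_slice {f : E × ℝ → ℝ} (hf : Continuous f) {K : Set E}
    (hK : IsCompact K) (h0 : ∀ x ∉ K, ∀ t, f (x, t) = 0) :
    Continuous (fun t => ∫ x, f (x, t) ∂μ) := by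
  have h := continuous_parametric_integral_of_continuous (μ := μ)
    (f := fun t x => f (x, t)) (by fun_prop) hK
  convert h using 2 with t
  exact (setIntegral_eq_integral_of_forall_compl_eq_zero (fun x hx => h0 x hx t)).symm

theorem integral_slice_dd_eq_zero {f : E × ℝ → ℝ} (hf : ContDiff ℝ 1 f) {K : Set E}
    (hK : IsCompact K) (h0 : ∀ x ∉ K, ∀ t, f (x, t) = 0) (e : E) (t : ℝ) :
    ∫ x, dd (e, 0) f (x, t) ∂μ = 0 := by
  have hsl : ∀ x, dd (e, (0 : ℝ)) f (x, t) = fderiv ℝ (fun y => f (y, t)) x e := by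
    intro x
    have hA : HasFDerivAt (fun y : E => (y, t)) (ContinuousLinearMap.inl ℝ E ℝ) x :=
      hasFDerivAt_prodMk_left x t
    have := dd_comp_map (f := f) e ((hf.differentiable (by norm_num)) _) hA
    simpa [dd] using this.symm
  have i1 := integrable_slice (μ := μ) hf.continuous hK h0 t
  have i2 := integrable_slice (μ := μ) (continuous_dd (e, (0 : ℝ)) hf) hK
    (dd_eq_zero_of_notMem hK h0 _) t
  simp only [hsl] at i2 ⊢
  have := integral_mul_fderiv_eq_neg_fderiv_mul_of_integrable (μ := μ) (f := fun _ : E => (1 : ℝ))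
    (g := fun y => f (y, t)) (v := e) (by simp) (by simpa using i2) (by simpa using i1)
    (by simp) (fun x _ => by
      have := hf.differentiable (by norm_num)
      fun_prop)
  simpa using this

theorem hasDerivAt_integral_slice {f : E × ℝ → ℝ} (hf : ContDiff ℝ 1 f) {K : Set E}
    (hK : IsCompact K) (h0 : ∀ x ∉ K, ∀ t, f (x, t) = 0) (t : ℝ) :
    HasDerivAt (fun s => ∫ x, f (x, s) ∂μ) (∫ x, dd (0, 1) f (x, t) ∂μ) t := by
  have hc : Continuous (dd ((0 : E), (1 : ℝ)) f) := continuous_dd _ hf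
  have hz := dd_eq_zero_of_notMem hK h0 ((0 : E), (1 : ℝ))
  obtain ⟨B, hB⟩ := (hK.prod (isCompact_Icc (a := t - 1) (b := t + 1))).bddAbove_image
    hc.norm.continuousOn
  have hB' : ∀ x ∈ K, ∀ s ∈ Icc (t - 1) (t + 1), ‖dd ((0 : E), (1 : ℝ)) f (x, s)‖ ≤ B :=
    fun x hx s hs => hB ⟨(x, s), ⟨hx, hs⟩, rfl⟩
  refine (hasDerivAt_integral_of_dominated_loc_of_deriv_le (μ := μ)
    (F := fun s x => f (x, s)) (F' := fun s x => dd (0, 1) f (x, s)) (x₀ := t)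
    (s := Icc (t - 1) (t + 1)) (bound := K.indicator fun _ => B)
    (Icc_mem_nhds (by linarith) (by linarith)) ?_ ?_ ?_ ?_ ?_ ?_).2
  · exact Eventually.of_forall fun s => (integrable_slice hf.continuous hK h0 s).1
  · exact integrable_slice hf.continuous hK h0 t
  · exact (integrable_slice hc hK hz t).1
  · refine Eventually.of_forall fun x s hs => ?_
    by_cases hx : x ∈ K
    · simpa [hx] using hB' x hx s hs
    · simp [hx, hz x hx s]
  · exact (integrable_indicator_iff hK.measurableSet).2
      (integrableOn_const hK.measure_lt_top.ne)
  · refine Eventually.of_forall fun x s _ => ?_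
    have hcv : HasDerivAt (fun s : ℝ => (x, s)) ((0 : E), (1 : ℝ)) s :=
      (hasDerivAt_const s x).prodMk (hasDerivAt_id s)
    exact hasDerivAt_dd (f := f) ((hf.differentiable (by norm_num)) _) hcv

theorem integral_slice_sub {f : E × ℝ → ℝ} (hf : ContDiff ℝ 1 f) {K : Set E}
    (hK : IsCompact K) (h0 : ∀ x ∉ K, ∀ t, f (x, t) = 0) (a b : ℝ) :
    ∫ t in a..b, ∫ x, dd (0, 1) f (x, t) ∂μ = (∫ x, f (x, b) ∂μ) - ∫ x, f (x, a) ∂μ :=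
  intervalIntegral.integral_eq_sub_of_hasDerivAt
    (fun t _ => hasDerivAt_integral_slice hf hK h0 t)
    ((continuous_integral_slice (continuous_dd _ hf) hK
      (dd_eq_zero_of_notMem hK h0 _)).intervalIntegrable _ _)

end Slices

/-! ### Meridional coordinates: the planar Gagliardo inequality and the weighted energy identity. -/

/-- The direction of the radial variable in `(r, z, t)`-space. -/
def er : (ℝ × ℝ) × ℝ := ((1, 0), 0)

/-- The direction of the vertical variable in `(r, z, t)`-space. -/
def ez : (ℝ × ℝ) × ℝ := ((0, 1), 0)

/-- The direction of the time variable in `(r, z, t)`-space. -/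
def et : (ℝ × ℝ) × ℝ := ((0, 0), 1)

theorem dd_radius (e q : (ℝ × ℝ) × ℝ) : dd e (fun p : (ℝ × ℝ) × ℝ => p.1.1) q = e.1.1 :=
  dd_clm e ((ContinuousLinearMap.fst ℝ ℝ ℝ).comp (ContinuousLinearMap.fst ℝ (ℝ × ℝ) ℝ)) q

/-- The planar Gagliardo inequality `‖h‖₂ ≤ S ‖∇h‖₁`, on time slices. -/
theorem exists_gagliardo_slice : ∃ S : ℝ, 0 < S ∧ ∀ (h : (ℝ × ℝ) × ℝ → ℝ), ContDiff ℝ 1 h →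
    ∀ K : Set (ℝ × ℝ), IsCompact K → (∀ x ∉ K, ∀ t, h (x, t) = 0) → ∀ t : ℝ,
      ∫ x, h (x, t) ^ 2 ≤ (S * ∫ x, (|dd er h (x, t)| + |dd ez h (x, t)|)) ^ 2 := by
  have hp : Real.HolderConjugate (Module.finrank ℝ (ℝ × ℝ)) 2 := by
    have : Module.finrank ℝ (ℝ × ℝ) = 2 := by simp
    rw [this]; constructor <;> norm_num
  set c := lintegralPowLePowLIntegralFDerivConst (volume : Measure (ℝ × ℝ)) 2 with hc
  refine ⟨Real.sqrt c + 1, by positivity, ?_⟩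
  intro h hh K hK h0 t
  have hu : ContDiff ℝ 1 (fun x => h (x, t)) := by fun_prop
  have hsupp : HasCompactSupport (fun x => h (x, t)) :=
    HasCompactSupport.intro hK (fun x hx => h0 x hx t)
  have key := lintegral_pow_le_pow_lintegral_fderiv (volume : Measure (ℝ × ℝ)) hu hsupp hp
  rw [← hc] at key
  have hd : Differentiable ℝ h := hh.differentiable (by norm_num)
  set J := ∫ x, (|dd er h (x, t)| + |dd ez h (x, t)|) with hJ
  have hJ0 : 0 ≤ J := integral_nonneg fun x => by positivity
  have hcont : ∀ e, Continuous (dd e h) := fun e => continuous_dd e hh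
  have hint : Integrable (fun x => |dd er h (x, t)| + |dd ez h (x, t)|) := by
    refine integrable_slice (f := fun q => |dd er h q| + |dd ez h q|)
      ((hcont er).abs.add (hcont ez).abs) hK (fun x hx s => ?_) t
    simp [dd_eq_zero_of_notMem hK h0 _ x hx s]
  have hle : ∫⁻ x, ‖fderiv ℝ (fun x => h (x, t)) x‖ₑ ≤ ENNReal.ofReal J := by
    rw [hJ, ofReal_integral_eq_lintegral_ofReal hint (ae_of_all _ fun x => by positivity)]
    refine lintegral_mono fun x => ?_
    rw [← ofReal_norm]
    -- `ℝ × ℝ` carries the sup norm, so the operator norm of the differential is at most the sum of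
    -- the absolute partial derivatives.
    refine ENNReal.ofReal_le_ofReal (ContinuousLinearMap.opNorm_le_bound _ (by positivity) ?_)
    intro y
    have hA : HasFDerivAt (fun y : ℝ × ℝ => (y, t)) (ContinuousLinearMap.inl ℝ (ℝ × ℝ) ℝ) x :=
      hasFDerivAt_prodMk_left x t
    have e1 : fderiv ℝ (fun x => h (x, t)) x y = dd (y, 0) h (x, t) :=
      dd_comp_map (f := h) y (hd _) hA
    have e2 : ((y, 0) : (ℝ × ℝ) × ℝ) = y.1 • er + y.2 • ez := by
      ext <;> simp [er, ez]
    rw [e1, e2, dd_add_dir, dd_smul_dir, dd_smul_dir, Real.norm_eq_abs]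
    have h1 : |y.1| ≤ ‖y‖ := norm_fst_le y
    have h2 : |y.2| ≤ ‖y‖ := norm_snd_le y
    calc |y.1 * dd er h (x, t) + y.2 * dd ez h (x, t)|
        ≤ |y.1| * |dd er h (x, t)| + |y.2| * |dd ez h (x, t)| := by
          rw [← abs_mul, ← abs_mul]; exact abs_add_le _ _
      _ ≤ ‖y‖ * |dd er h (x, t)| + ‖y‖ * |dd ez h (x, t)| := by gcongr
      _ = _ := by ring
  have hi2 : Integrable (fun x => h (x, t) ^ 2) := by
    refine integrable_slice (f := fun q => h q ^ 2) (hh.continuous.pow 2) hK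
      (fun x hx s => ?_) t
    simp [h0 x hx s]
  have e1 : ∫⁻ x, ‖h (x, t)‖ₑ ^ (2 : ℝ) = ENNReal.ofReal (∫ x, h (x, t) ^ 2) := by
    rw [ofReal_integral_eq_lintegral_ofReal hi2 (ae_of_all _ fun x => by positivity)]
    refine lintegral_congr fun x => ?_
    rw [← ofReal_norm, ENNReal.ofReal_rpow_of_nonneg (norm_nonneg _) (by norm_num)]
    congr 1
    rw [Real.norm_eq_abs, show (2 : ℝ) = ((2 : ℕ) : ℝ) by norm_num, Real.rpow_natCast, sq_abs]
  rw [e1] at key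
  have key2 : ENNReal.ofReal (∫ x, h (x, t) ^ 2) ≤ ENNReal.ofReal (c * J ^ 2) := by
    refine key.trans ?_
    rw [ENNReal.ofReal_mul (by positivity), ENNReal.ofReal_coe_nnreal]
    gcongr
    calc _ ≤ (ENNReal.ofReal J) ^ (2 : ℝ) := by gcongr
      _ = _ := by
        rw [ENNReal.ofReal_rpow_of_nonneg hJ0 (by norm_num)]
        norm_num
  have key3 := (ENNReal.ofReal_le_ofReal_iff (by positivity)).1 key2
  refine key3.trans ?_
  rw [mul_pow]
  gcongr
  have := Real.sq_sqrt (show (0 : ℝ) ≤ c by positivity)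
  nlinarith [Real.sqrt_nonneg (c : ℝ)]

/-- The pointwise form of the localized energy identity. -/
theorem energy_identity_pointwise {U V Q Ω Φ : (ℝ × ℝ) × ℝ → ℝ} {g g₁ g₂ : ℝ → ℝ}
    (hU : ContDiff ℝ ∞ U) (hV : ContDiff ℝ ∞ V) (hQ : ContDiff ℝ ∞ Q) (hΩ : ContDiff ℝ ∞ Ω)
    (hΦ : ContDiff ℝ ∞ Φ) (hg : ∀ s, HasDerivAt g (g₁ s) s) (hg₁ : ∀ s, HasDerivAt g₁ (g₂ s) s)
    {q : (ℝ × ℝ) × ℝ} (hr : q.1.1 ≠ 0)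
    (hdiv : q.1.1 * dd er U q + U q + q.1.1 * dd ez V q = 0)
    (heq : dd et Ω q + U q * dd er Ω q + V q * dd ez Ω q =
      dd er (dd er Ω) q + 3 / q.1.1 * dd er Ω q + dd ez (dd ez Ω) q + dd ez Q q) :
    dd et (fun p => p.1.1 * g (Ω p) * Φ p) q =
      q.1.1 * g (Ω q) * dd et Φ q
      + g (Ω q) * (q.1.1 * dd er (dd er Φ) q + q.1.1 * dd ez (dd ez Φ) q - dd er Φ q)
      + q.1.1 * g (Ω q) * (U q * dd er Φ q + V q * dd ez Φ q)
      - q.1.1 * Φ q * g₂ (Ω q) * (dd er Ω q ^ 2 + dd ez Ω q ^ 2)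
      - q.1.1 * Q q * (g₂ (Ω q) * dd ez Ω q * Φ q + g₁ (Ω q) * dd ez Φ q)
      + dd er (fun p => p.1.1 * Φ p * (g₁ (Ω p) * dd er Ω p)
          + (2 * Φ p - p.1.1 * dd er Φ p) * g (Ω p) - p.1.1 * Φ p * (U p * g (Ω p))) q
      + dd ez (fun p => p.1.1 * Φ p * (g₁ (Ω p) * dd ez Ω p)
          - p.1.1 * dd ez Φ p * g (Ω p) - p.1.1 * Φ p * (V p * g (Ω p))
          + p.1.1 * Φ p * (g₁ (Ω p) * Q p)) q := by
  have dU := hU.differentiable (by simp)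
  have dV := hV.differentiable (by simp)
  have dQ := hQ.differentiable (by simp)
  have dΩ := hΩ.differentiable (by simp)
  have dΦ := hΦ.differentiable (by simp)
  have dΩr := (smooth_dd er hΩ).differentiable (by simp)
  have dΩz := (smooth_dd ez hΩ).differentiable (by simp)
  have dΦr := (smooth_dd er hΦ).differentiable (by simp)
  have dΦz := (smooth_dd ez hΦ).differentiable (by simp)
  have dg : Differentiable ℝ (fun p => g (Ω p)) :=
    Differentiable.comp (fun s => (hg s).differentiableAt) dΩ
  have dg₁ : Differentiable ℝ (fun p => g₁ (Ω p)) :=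
    Differentiable.comp (fun s => (hg₁ s).differentiableAt) dΩ
  have eg : ∀ e, dd e (fun p => g (Ω p)) q = g₁ (Ω q) * dd e Ω q :=
    fun e => dd_comp e (hg _) (dΩ q)
  have eg₁ : ∀ e, dd e (fun p => g₁ (Ω p)) q = g₂ (Ω q) * dd e Ω q :=
    fun e => dd_comp e (hg₁ _) (dΩ q)
  -- The composites become opaque, so that the product rules below treat them as atoms and their
  -- derivatives are supplied only by `eg` and `eg₁`.
  generalize hG : (fun p => g (Ω p)) = G at *
  generalize hG₁ : (fun p => g₁ (Ω p)) = G₁ at *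
  have aG : ∀ p, g (Ω p) = G p := fun p => by rw [← hG]
  have aG₁ : ∀ p, g₁ (Ω p) = G₁ p := fun p => by rw [← hG₁]
  simp only [aG, aG₁] at *
  simp (disch := fun_prop) only [dd_add, dd_sub, dd_mul, dd_const, eg, eg₁, dd_radius]
  simp only [er, ez, et] at *
  have h2 : dd ((0, 0), 1) Ω q = dd ((1, 0), 0) (dd ((1, 0), 0) Ω) q
      + 3 / q.1.1 * dd ((1, 0), 0) Ω q + dd ((0, 1), 0) (dd ((0, 1), 0) Ω) q
      + dd ((0, 1), 0) Q q - U q * dd ((1, 0), 0) Ω q - V q * dd ((0, 1), 0) Ω q := by linarith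
  have h3 : q.1.1 * dd ((0, 1), 0) V q = - (q.1.1 * dd ((1, 0), 0) U q) - U q := by linarith
  rw [h2]
  field_simp
  -- Once the equation for `Ω` is inserted, only the divergence of `r (U, V)` is left over, from
  -- moving the drift into flux form.
  linear_combination (Φ q * G q) * h3

/-! ### The unit box and powers of the space-time cutoff. -/

/-- The square `|r - 1| ≤ 1/2`, `|z| ≤ 1/2` in the meridional half-plane. -/
def box : Set (ℝ × ℝ) := Metric.closedBall (1, 0) (1 / 2)

theorem isCompact_box : IsCompact box := isCompact_closedBall _ _

theorem mem_box {x : ℝ × ℝ} : x ∈ box ↔ |x.1 - 1| ≤ 1 / 2 ∧ |x.2| ≤ 1 / 2 := by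
  simp [box, Prod.dist_eq, Real.dist_eq]

theorem half_le_of_mem_box {x : ℝ × ℝ} (hx : x ∈ box) : 1 / 2 ≤ x.1 := by
  have := abs_le.1 (mem_box.1 hx).1; linarith [this.1]

theorem le_of_mem_box {x : ℝ × ℝ} (hx : x ∈ box) : x.1 ≤ 3 / 2 := by
  have := abs_le.1 (mem_box.1 hx).1; linarith [this.2]

/-- The space-time cutoff function. -/
def cutoff : ContDiffBump (((1, 0), 0) : (ℝ × ℝ) × ℝ) :=
  ⟨1 / 4, 1 / 2, by norm_num, by norm_num⟩

theorem cutoff_smooth : ContDiff ℝ ∞ (cutoff : (ℝ × ℝ) × ℝ → ℝ) := cutoff.contDiff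

theorem cutoff_eq_zero {x : ℝ × ℝ} (hx : x ∉ box) (t : ℝ) : cutoff (x, t) = 0 := by
  apply cutoff.zero_of_le_dist
  have : 1 / 2 < dist x (1, 0) := by simpa [box] using hx
  exact this.le.trans (le_max_left _ _)

/-- The product metric is a maximum, so the time distance alone already puts the point outside the
support. This removes the initial term at time `-1` from the energy inequality. -/
theorem cutoff_eq_zero_of_le {t : ℝ} (ht : t ≤ -1 / 2) (x : ℝ × ℝ) : cutoff (x, t) = 0 := by
  apply cutoff.zero_of_le_dist
  have : 1 / 2 ≤ dist t 0 := by
    rw [Real.dist_eq, sub_zero, abs_of_neg (by linarith)]; linarith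
  exact this.trans (le_max_right _ _)

theorem exists_cutoff_bound : ∃ c : ℝ, 1 ≤ c ∧ ∀ e ∈ ({er, ez, et} : Set ((ℝ × ℝ) × ℝ)), ∀ q,
    |dd e cutoff q| ≤ c ∧ |dd e (dd e cutoff) q| ≤ c := by
  have hs : HasCompactSupport (cutoff : (ℝ × ℝ) × ℝ → ℝ) := cutoff.hasCompactSupport
  have key : ∀ e : (ℝ × ℝ) × ℝ, ∃ c : ℝ, ∀ q,
      |dd e cutoff q| ≤ c ∧ |dd e (dd e cutoff) q| ≤ c := by
    intro e
    have s1 : HasCompactSupport (dd e cutoff) := hs.fderiv_apply ℝ e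
    have s2 : HasCompactSupport (dd e (dd e cutoff)) := s1.fderiv_apply ℝ e
    obtain ⟨c1, h1⟩ := (smooth_dd e cutoff_smooth).continuous.bounded_above_of_compact_support s1
    obtain ⟨c2, h2⟩ := (smooth_dd e (smooth_dd e
      cutoff_smooth)).continuous.bounded_above_of_compact_support s2
    exact ⟨max c1 c2, fun q => ⟨(h1 q).trans (le_max_left _ _), (h2 q).trans (le_max_right _ _)⟩⟩
  choose c hc using key
  refine ⟨max 1 (max (c er) (max (c ez) (c et))), le_max_left _ _, ?_⟩
  rintro e (rfl | rfl | rfl) q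
  · exact ⟨(hc _ q).1.trans (by simp), (hc _ q).2.trans (by simp)⟩
  · exact ⟨(hc _ q).1.trans (by simp), (hc _ q).2.trans (by simp)⟩
  · exact ⟨(hc _ q).1.trans (by simp), (hc _ q).2.trans (by simp)⟩

/-- Each derivative of a power of the cutoff costs only one factor of it. The factors that remain
let the error terms be measured by the same Moser integrands, with constants polynomial in the
power. -/
theorem abs_dd_cutoff_pow_le {c : ℝ} {e q : (ℝ × ℝ) × ℝ} (k : ℕ) (h : |dd e cutoff q| ≤ c) :
    |dd e (fun p => cutoff p ^ (k + 1)) q| ≤ (k + 1) * c * cutoff q ^ k := by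
  rw [dd_pow e _ (cutoff_smooth.differentiable (by simp) q)]
  have h0 : 0 ≤ cutoff q := cutoff.nonneg
  simp only [abs_mul, Nat.add_sub_cancel, abs_pow, abs_of_nonneg h0, Nat.abs_cast]
  push_cast
  have : 0 ≤ ((k : ℝ) + 1) * cutoff q ^ k := by positivity
  nlinarith

theorem abs_dd_dd_cutoff_pow_le {c : ℝ} (hc : 1 ≤ c) {e q : (ℝ × ℝ) × ℝ} (k : ℕ)
    (h : |dd e cutoff q| ≤ c) (h' : |dd e (dd e cutoff) q| ≤ c) :
    |dd e (dd e (fun p => cutoff p ^ (k + 2))) q| ≤ 2 * (k + 2) ^ 2 * c ^ 2 * cutoff q ^ k := by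
  have d0 := cutoff_smooth.differentiable (by simp)
  have d1 := (smooth_dd e cutoff_smooth).differentiable (by simp)
  have e1 : dd e (fun p => cutoff p ^ (k + 2)) =
      fun p => ((k : ℝ) + 2) * cutoff p ^ (k + 1) * dd e cutoff p := by
    funext p
    rw [dd_pow e _ (d0 p)]
    simp
  rw [e1, dd_mul e (by fun_prop) (d1 q), dd_const_mul e _ (by fun_prop), dd_pow e _ (d0 q)]
  have h0 : 0 ≤ cutoff q := cutoff.nonneg
  have h1 : cutoff q ≤ 1 := cutoff.le_one
  simp only [Nat.add_sub_cancel]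
  have hk : (0 : ℝ) ≤ cutoff q ^ k := by positivity
  have a1 : dd e cutoff q ^ 2 ≤ c ^ 2 := by
    rw [← sq_abs]; gcongr
  have a2 : |cutoff q * dd e (dd e cutoff) q| ≤ c := by
    rw [abs_mul, abs_of_nonneg h0]
    calc _ ≤ 1 * c := by gcongr
      _ = c := one_mul c
  calc _ = |((k : ℝ) + 2) * cutoff q ^ k * ((k + 1) * dd e cutoff q ^ 2
        + cutoff q * dd e (dd e cutoff) q)| := by push_cast; ring_nf
    _ = ((k : ℝ) + 2) * cutoff q ^ k * |(k + 1) * dd e cutoff q ^ 2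
        + cutoff q * dd e (dd e cutoff) q| := by
        rw [abs_mul, abs_of_nonneg (by positivity)]
    _ ≤ ((k : ℝ) + 2) * cutoff q ^ k * ((k + 1) * c ^ 2 + c) := by
        gcongr
        refine (abs_add_le _ _).trans (add_le_add ?_ a2)
        rw [abs_of_nonneg (by positivity)]
        gcongr
    _ ≤ _ := by
        have : ((k : ℝ) + 1) * c ^ 2 + c ≤ 2 * (k + 2) * c ^ 2 := by nlinarith
        calc _ ≤ ((k : ℝ) + 2) * cutoff q ^ k * (2 * (k + 2) * c ^ 2) := by gcongr
          _ = _ := by ring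

/-! ### The Moser weights and their derivatives. -/

/-- The weight `(1 + s²)^m` of the Moser iteration. -/
def wt (m : ℕ) (s : ℝ) : ℝ := (1 + s ^ 2) ^ m

/-- First derivative of `wt m`. -/
def wt₁ (m : ℕ) (s : ℝ) : ℝ := 2 * m * s * (1 + s ^ 2) ^ (m - 1)

/-- Second derivative of `wt m`. -/
def wt₂ (m : ℕ) (s : ℝ) : ℝ :=
  2 * m * (1 + s ^ 2) ^ (m - 1) + 4 * m * (m - 1) * s ^ 2 * (1 + s ^ 2) ^ (m - 2)

theorem hasDerivAt_wt (m : ℕ) (s : ℝ) : HasDerivAt (wt m) (wt₁ m s) s := by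
  have h : HasDerivAt (fun s : ℝ => 1 + s ^ 2) (2 * s) s := by
    simpa using (hasDerivAt_pow 2 s).const_add 1
  have := h.pow m
  refine this.congr_deriv ?_
  unfold wt₁; ring

theorem hasDerivAt_wt₁ (m : ℕ) (s : ℝ) : HasDerivAt (wt₁ m) (wt₂ m s) s := by
  have h : HasDerivAt (fun s : ℝ => 1 + s ^ 2) (2 * s) s := by
    simpa using (hasDerivAt_pow 2 s).const_add 1
  have h2 : HasDerivAt (fun s : ℝ => 2 * (m : ℝ) * s) (2 * m) s := by
    simpa using (hasDerivAt_id s).const_mul (2 * (m : ℝ))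
  have := h2.mul (h.pow (m - 1))
  refine this.congr_deriv ?_
  unfold wt₂
  rcases m with _ | m
  · simp
  · simp only [Nat.add_sub_cancel, Nat.cast_add, Nat.cast_one, Pi.pow_apply]
    rw [show m + 1 - 2 = m - 1 by omega]
    ring

theorem contDiff_wt (m : ℕ) : ContDiff ℝ ∞ (wt m) := by unfold wt; fun_prop

theorem contDiff_wt₁ (m : ℕ) : ContDiff ℝ ∞ (wt₁ m) := by unfold wt₁; fun_prop

theorem contDiff_wt₂ (m : ℕ) : ContDiff ℝ ∞ (wt₂ m) := by unfold wt₂; fun_prop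

theorem wt_pos (m : ℕ) (s : ℝ) : 0 < wt m s := by unfold wt; positivity

/-- Multiplying by `(1 + s²)²` gives one formula for all `m ≥ 1`; the truncated exponent `m - 2`
would otherwise make `m = 1` a separate case in every estimate. -/
theorem wt₂_eq {m : ℕ} (hm : 1 ≤ m) (s : ℝ) :
    wt₂ m s * (1 + s ^ 2) ^ 2 = 2 * m * wt m s * (1 + (2 * m - 1) * s ^ 2) := by
  unfold wt₂ wt
  rcases m with _ | _ | m
  · omega
  · simp; ring
  · simp only [show m + 1 + 1 - 1 = m + 1 by omega, show m + 1 + 1 - 2 = m by omega]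
    push_cast; ring

theorem wt₁_eq {m : ℕ} (hm : 1 ≤ m) (s : ℝ) : wt₁ m s * (1 + s ^ 2) = 2 * m * s * wt m s := by
  unfold wt₁ wt
  rcases m with _ | m
  · omega
  · simp only [Nat.add_sub_cancel]; ring

theorem wt₂_nonneg {m : ℕ} (hm : 1 ≤ m) (s : ℝ) : 0 ≤ wt₂ m s := by
  have h1 : (1 : ℝ) ≤ m := by exact_mod_cast hm
  unfold wt₂
  have : (0 : ℝ) ≤ m - 1 := by linarith
  positivity

/-- This is where the `1` in the weight matters: for a pure power `s^{2m}` the second derivative is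
not dominated by the function near `s = 0`. The bound absorbs the source term, which carries the
second derivative of the weight without a gradient. -/
theorem wt₂_le {m : ℕ} (hm : 1 ≤ m) (s : ℝ) : wt₂ m s ≤ 4 * m ^ 2 * wt m s := by
  have h1 : (1 : ℝ) ≤ m := by exact_mod_cast hm
  have h := wt₂_eq hm s
  have hw := wt_pos m s
  have hp : 0 < (1 + s ^ 2) ^ 2 := by positivity
  refine le_of_mul_le_mul_right ?_ hp
  rw [h]
  have : 1 + (2 * (m : ℝ) - 1) * s ^ 2 ≤ 2 * m * (1 + s ^ 2) ^ 2 := by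
    nlinarith [sq_nonneg s, mul_nonneg (show (0 : ℝ) ≤ m by linarith) (sq_nonneg (s ^ 2)),
      mul_nonneg (show (0 : ℝ) ≤ m by linarith) (sq_nonneg s)]
  calc _ ≤ 2 * m * wt m s * (2 * m * (1 + s ^ 2) ^ 2) := by gcongr
    _ = _ := by ring

theorem abs_wt₁_le {m : ℕ} (hm : 1 ≤ m) (s : ℝ) : |wt₁ m s| ≤ 2 * m * wt m s := by
  have h := wt₁_eq hm s
  have hw := wt_pos m s
  have hp : 0 < 1 + s ^ 2 := by positivity
  refine le_of_mul_le_mul_right ?_ hp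
  rw [← abs_of_pos hp, ← abs_mul, h, abs_mul, abs_mul, abs_of_pos hw, abs_of_pos hp,
    abs_of_nonneg (show (0 : ℝ) ≤ 2 * m by positivity)]
  have : |s| ≤ 1 + s ^ 2 := by nlinarith [sq_abs s, sq_nonneg (|s| - 1)]
  calc _ ≤ 2 * m * (1 + s ^ 2) * wt m s := by gcongr
    _ = _ := by ring

/-- The constant does not depend on `m`. By Young's inequality the gradient of the weight then
splits into the weight itself and the dissipation density. -/
theorem wt₁_sq_le {m : ℕ} (hm : 1 ≤ m) (s : ℝ) : wt₁ m s ^ 2 ≤ 2 * wt m s * wt₂ m s := by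
  have h1 : (1 : ℝ) ≤ m := by exact_mod_cast hm
  have hw := wt_pos m s
  have hp : 0 < (1 + s ^ 2) ^ 2 := by positivity
  refine le_of_mul_le_mul_right ?_ hp
  rw [← mul_pow, wt₁_eq hm, mul_assoc (2 * wt m s), wt₂_eq hm]
  have : 0 ≤ 4 * m * wt m s ^ 2 * (1 + (m - 1) * s ^ 2) := by
    have : (0 : ℝ) ≤ m - 1 := by linarith
    positivity
  nlinarith

/-! ### The local problem and estimates on a single time slice. -/

/-- A smooth drift-diffusion problem in the meridional half-plane, near `(r, z) = (1, 0)`. -/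
structure LocalData (N K : ℝ) (U V Q Ω : (ℝ × ℝ) × ℝ → ℝ) : Prop where
  smooth_U : ContDiff ℝ ∞ U
  smooth_V : ContDiff ℝ ∞ V
  smooth_Q : ContDiff ℝ ∞ Q
  smooth_Ω : ContDiff ℝ ∞ Ω
  one_le : 1 ≤ K
  nonneg : 0 ≤ N
  div_eq : ∀ x ∈ box, ∀ t ∈ Icc (-1 : ℝ) 0,
    x.1 * dd er U (x, t) + U (x, t) + x.1 * dd ez V (x, t) = 0
  vort_eq : ∀ x ∈ box, ∀ t ∈ Icc (-1 : ℝ) 0,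
    dd et Ω (x, t) + U (x, t) * dd er Ω (x, t) + V (x, t) * dd ez Ω (x, t) =
      dd er (dd er Ω) (x, t) + 3 / x.1 * dd er Ω (x, t) + dd ez (dd ez Ω) (x, t)
        + dd ez Q (x, t)
  source_le : ∀ x ∈ box, ∀ t ∈ Icc (-1 : ℝ) 0, |Q (x, t)| ≤ N
  energy_le : ∀ t ∈ Icc (-1 : ℝ) 0, ∫ x in box, (U (x, t) ^ 2 + V (x, t) ^ 2) ≤ K ^ 2

/-- Optimizing over `l` turns a family of Young inequalities into a Cauchy-Schwarz inequality.
Products of integrals can thus be obtained from pointwise estimates with a free parameter; the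
minimizer is `l = X / (2a)`, and `a = 0` is excluded by a large `l`. -/
theorem sq_le_of_forall_le {X a b : ℝ} (hX : 0 ≤ X) (ha : 0 ≤ a) (hb : 0 ≤ b)
    (h : ∀ l : ℝ, 0 < l → X ≤ l * a + b / l) : X ^ 2 ≤ 4 * a * b := by
  rcases eq_or_lt_of_le hX with h0 | hX0
  · rw [← h0]; nlinarith [mul_nonneg ha hb]
  rcases eq_or_lt_of_le ha with h0 | ha0
  · exfalso
    have := h ((b + 1) / X) (by positivity)
    rw [← h0, mul_zero, zero_add, div_div_eq_mul_div, le_div_iff₀ (by positivity)] at this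
    nlinarith
  · have := h (X / (2 * a)) (by positivity)
    have e : X / (2 * a) * a = X / 2 := by field_simp
    rw [e, div_div_eq_mul_div] at this
    have h2 : X / 2 ≤ b * (2 * a) / X := by linarith
    rw [le_div_iff₀ hX0] at h2
    nlinarith

theorem abs_le_add_of_sq_le {y a b : ℝ} (ha : 0 ≤ a) (hb : 0 ≤ b) (h : y ^ 2 ≤ 4 * a * b) :
    |y| ≤ a + b := by
  refine abs_le_of_sq_le_sq ?_ (by positivity)
  nlinarith [sq_nonneg (a - b)]

/-- Integrand of the `m`-th Moser quantity. -/
def moserB (k m : ℕ) (Ω : (ℝ × ℝ) × ℝ → ℝ) (q : (ℝ × ℝ) × ℝ) : ℝ := cutoff q ^ k * wt m (Ω q)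

/-- Integrand of the localized energy. -/
def moserA (k m : ℕ) (Ω : (ℝ × ℝ) × ℝ → ℝ) (q : (ℝ × ℝ) × ℝ) : ℝ :=
  q.1.1 * wt m (Ω q) * cutoff q ^ (k + 2)

/-- Integrand of the localized dissipation. -/
def moserD (k m : ℕ) (Ω : (ℝ × ℝ) × ℝ → ℝ) (q : (ℝ × ℝ) × ℝ) : ℝ :=
  q.1.1 * cutoff q ^ (k + 2) * wt₂ m (Ω q) * (dd er Ω q ^ 2 + dd ez Ω q ^ 2)

theorem smooth_moserB {Ω : (ℝ × ℝ) × ℝ → ℝ} (hΩ : ContDiff ℝ ∞ Ω) (k m : ℕ) :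
    ContDiff ℝ ∞ (moserB k m Ω) := by
  unfold moserB
  exact (cutoff_smooth.pow k).mul ((contDiff_wt m).comp hΩ)

theorem smooth_moserA {Ω : (ℝ × ℝ) × ℝ → ℝ} (hΩ : ContDiff ℝ ∞ Ω) (k m : ℕ) :
    ContDiff ℝ ∞ (moserA k m Ω) := by
  have hr : ContDiff ℝ ∞ (fun q : (ℝ × ℝ) × ℝ => q.1.1) := by fun_prop
  exact (hr.mul ((contDiff_wt m).comp hΩ)).mul (cutoff_smooth.pow _)

theorem continuous_moserD {Ω : (ℝ × ℝ) × ℝ → ℝ} (hΩ : ContDiff ℝ ∞ Ω) (k m : ℕ) :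
    Continuous (moserD k m Ω) := by
  have h1 := (smooth_dd er hΩ).continuous
  have h2 := (smooth_dd ez hΩ).continuous
  have h3 := ((contDiff_wt₂ m).comp hΩ).continuous
  have h4 := cutoff_smooth.continuous
  have hr : Continuous (fun q : (ℝ × ℝ) × ℝ => q.1.1) := by fun_prop
  exact ((hr.mul (h4.pow _)).mul h3).mul ((h1.pow 2).add (h2.pow 2))

theorem moserB_eq_zero {k : ℕ} (hk : k ≠ 0) (m : ℕ) (Ω : (ℝ × ℝ) × ℝ → ℝ) {x : ℝ × ℝ}
    (hx : x ∉ box) (t : ℝ) : moserB k m Ω (x, t) = 0 := by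
  simp [moserB, cutoff_eq_zero hx, hk]

theorem moserA_eq_zero (k m : ℕ) (Ω : (ℝ × ℝ) × ℝ → ℝ) {x : ℝ × ℝ} (hx : x ∉ box) (t : ℝ) :
    moserA k m Ω (x, t) = 0 := by
  simp [moserA, cutoff_eq_zero hx]

theorem moserD_eq_zero (k m : ℕ) (Ω : (ℝ × ℝ) × ℝ → ℝ) {x : ℝ × ℝ} (hx : x ∉ box) (t : ℝ) :
    moserD k m Ω (x, t) = 0 := by
  simp [moserD, cutoff_eq_zero hx]

theorem moserB_nonneg (k m : ℕ) (Ω : (ℝ × ℝ) × ℝ → ℝ) (q : (ℝ × ℝ) × ℝ) : 0 ≤ moserB k m Ω q :=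
  mul_nonneg (pow_nonneg cutoff.nonneg _) (wt_pos _ _).le

theorem moserA_nonneg (k m : ℕ) (Ω : (ℝ × ℝ) × ℝ → ℝ) (x : ℝ × ℝ) (t : ℝ) :
    0 ≤ moserA k m Ω (x, t) := by
  by_cases hx : x ∈ box
  · have := half_le_of_mem_box hx
    exact mul_nonneg (mul_nonneg (by simp; linarith) (wt_pos _ _).le)
      (pow_nonneg cutoff.nonneg _)
  · rw [moserA_eq_zero _ _ _ hx]

theorem moserD_nonneg (k : ℕ) {m : ℕ} (hm : 1 ≤ m) (Ω : (ℝ × ℝ) × ℝ → ℝ) (x : ℝ × ℝ) (t : ℝ) :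
    0 ≤ moserD k m Ω (x, t) := by
  by_cases hx : x ∈ box
  · have := half_le_of_mem_box hx
    exact mul_nonneg (mul_nonneg (mul_nonneg (by simp; linarith)
      (pow_nonneg cutoff.nonneg _)) (wt₂_nonneg hm _)) (by positivity)
  · rw [moserD_eq_zero _ _ _ hx]

theorem abs_dd_moserB_le {c : ℝ} {Ω : (ℝ × ℝ) × ℝ → ℝ} (hΩ : ContDiff ℝ ∞ Ω) (k m : ℕ)
    {e q : (ℝ × ℝ) × ℝ} (h : |dd e cutoff q| ≤ c) :
    |dd e (moserB (k + 1) m Ω) q| ≤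
      (k + 1) * c * moserB k m Ω q + cutoff q ^ (k + 1) * |wt₁ m (Ω q) * dd e Ω q| := by
  have d1 : DifferentiableAt ℝ (fun p => cutoff p ^ (k + 1)) q :=
    (cutoff_smooth.pow _).differentiable (by simp) q
  have d2 : DifferentiableAt ℝ (fun p => wt m (Ω p)) q :=
    ((contDiff_wt m).comp hΩ).differentiable (by simp) q
  unfold moserB
  rw [dd_mul e d1 d2, dd_comp e (hasDerivAt_wt m _) (hΩ.differentiable (by simp) q)]
  have h0 : 0 ≤ cutoff q := cutoff.nonneg
  refine (abs_add_le _ _).trans (add_le_add ?_ ?_)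
  · rw [abs_mul, abs_of_pos (wt_pos _ _), ← mul_assoc]
    exact mul_le_mul_of_nonneg_right (abs_dd_cutoff_pow_le k h) (wt_pos _ _).le
  · rw [abs_mul, abs_of_nonneg (pow_nonneg h0 _)]

/-- Gradient bound used against the drift term. -/
theorem integral_grad_moserB_le {c : ℝ} (hc : ∀ e ∈ ({er, ez, et} : Set ((ℝ × ℝ) × ℝ)), ∀ q,
    |dd e cutoff q| ≤ c) {Ω : (ℝ × ℝ) × ℝ → ℝ} (hΩ : ContDiff ℝ ∞ Ω) {k m : ℕ} (hk : k ≠ 0)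
    (hm : 1 ≤ m) {ε : ℝ} (hε : 0 < ε) (t : ℝ) :
    ∫ x, (|dd er (moserB (k + 1) m Ω) (x, t)| + |dd ez (moserB (k + 1) m Ω) (x, t)|) ≤
      (2 * (k + 1) * c + 1 / ε) * (∫ x, moserB k m Ω (x, t))
        + 2 * ε * ∫ x, moserD k m Ω (x, t) := by
  have iB : Integrable (fun x => moserB k m Ω (x, t)) :=
    integrable_slice (smooth_moserB hΩ k m).continuous isCompact_box
      (fun x hx s => moserB_eq_zero hk m Ω hx s) t
  have iD : Integrable (fun x => moserD k m Ω (x, t)) :=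
    integrable_slice (continuous_moserD hΩ k m) isCompact_box
      (fun x hx s => moserD_eq_zero k m Ω hx s) t
  have hz : ∀ x ∉ box, ∀ t, moserB (k + 1) m Ω (x, t) = 0 :=
    fun x hx s => moserB_eq_zero (by omega) m Ω hx s
  rw [← integral_const_mul, ← integral_const_mul, ← integral_add (iB.const_mul _) (iD.const_mul _)]
  refine integral_mono_of_nonneg (ae_of_all _ fun x => by positivity)
    ((iB.const_mul _).add (iD.const_mul _)) (ae_of_all _ fun x => ?_)
  by_cases hx : x ∈ box
  swap
  · simp [dd_eq_zero_of_notMem isCompact_box hz _ x hx t, moserB_eq_zero hk m Ω hx,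
      moserD_eq_zero k m Ω hx]
  have hr := half_le_of_mem_box hx
  have h0 : 0 ≤ cutoff (x, t) := cutoff.nonneg
  have hw := wt_pos m (Ω (x, t))
  have hw2 := wt₂_nonneg hm (Ω (x, t))
  -- The power `k + 1` is the mean of `k + 2`, carried by the dissipation, and `k`, carried by the
  -- Moser integrand, so Young's inequality loses no power of the cutoff.
  have key : ∀ e : (ℝ × ℝ) × ℝ, cutoff (x, t) ^ (k + 1) * |wt₁ m (Ω (x, t)) * dd e Ω (x, t)| ≤
      ε * (cutoff (x, t) ^ (k + 2) * wt₂ m (Ω (x, t)) * dd e Ω (x, t) ^ 2)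
        + 1 / (2 * ε) * moserB k m Ω (x, t) := by
    intro e
    have := abs_le_add_of_sq_le (y := cutoff (x, t) * (wt₁ m (Ω (x, t)) * dd e Ω (x, t)))
      (a := ε * (cutoff (x, t) ^ 2 * wt₂ m (Ω (x, t)) * dd e Ω (x, t) ^ 2))
      (b := 1 / (2 * ε) * wt m (Ω (x, t))) (by positivity) (by positivity) (by
        have h3 := wt₁_sq_le hm (Ω (x, t))
        have : 4 * (ε * (cutoff (x, t) ^ 2 * wt₂ m (Ω (x, t)) * dd e Ω (x, t) ^ 2)) *
            (1 / (2 * ε) * wt m (Ω (x, t))) = (cutoff (x, t) * dd e Ω (x, t)) ^ 2 *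
              (2 * wt m (Ω (x, t)) * wt₂ m (Ω (x, t))) := by field_simp; ring
        rw [this, show (cutoff (x, t) * (wt₁ m (Ω (x, t)) * dd e Ω (x, t))) ^ 2 =
          (cutoff (x, t) * dd e Ω (x, t)) ^ 2 * wt₁ m (Ω (x, t)) ^ 2 by ring]
        gcongr)
    rw [abs_mul, abs_of_nonneg h0] at this
    have h4 := mul_le_mul_of_nonneg_left this (pow_nonneg h0 k)
    unfold moserB
    calc _ = cutoff (x, t) ^ k * (cutoff (x, t) * |wt₁ m (Ω (x, t)) * dd e Ω (x, t)|) := by ring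
      _ ≤ _ := h4
      _ = _ := by ring
  have b1 := abs_dd_moserB_le hΩ k m (hc er (by simp) (x, t))
  have b2 := abs_dd_moserB_le hΩ k m (hc ez (by simp) (x, t))
  have k1 := key er
  have k2 := key ez
  have hD : cutoff (x, t) ^ (k + 2) * wt₂ m (Ω (x, t)) * dd er Ω (x, t) ^ 2
      + cutoff (x, t) ^ (k + 2) * wt₂ m (Ω (x, t)) * dd ez Ω (x, t) ^ 2
      ≤ 2 * moserD k m Ω (x, t) := by
    unfold moserD
    have : 0 ≤ cutoff (x, t) ^ (k + 2) * wt₂ m (Ω (x, t)) *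
      (dd er Ω (x, t) ^ 2 + dd ez Ω (x, t) ^ 2) := by positivity
    nlinarith
  have hD' := mul_le_mul_of_nonneg_left hD hε.le
  have e1 : 1 / ε * moserB k m Ω (x, t) = 2 * (1 / (2 * ε) * moserB k m Ω (x, t)) := by
    field_simp
  simp only []
  nlinarith

/-- The gain of integrability on a time slice. -/
theorem integral_moserB_sq_le {S : ℝ} (hS : ∀ (h : (ℝ × ℝ) × ℝ → ℝ), ContDiff ℝ 1 h →
    ∀ K : Set (ℝ × ℝ), IsCompact K → (∀ x ∉ K, ∀ t, h (x, t) = 0) → ∀ t : ℝ,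
      ∫ x, h (x, t) ^ 2 ≤ (S * ∫ x, (|dd er h (x, t)| + |dd ez h (x, t)|)) ^ 2)
    {c : ℝ} (hc : ∀ e ∈ ({er, ez, et} : Set ((ℝ × ℝ) × ℝ)), ∀ q, |dd e cutoff q| ≤ c)
    {Ω : (ℝ × ℝ) × ℝ → ℝ} (hΩ : ContDiff ℝ ∞ Ω) {k m : ℕ} (hk : k ≠ 0) (hm : 1 ≤ m) (t : ℝ) :
    ∫ x, moserB (k + 2) m Ω (x, t) ^ 2 ≤ 32 * S ^ 2 * (∫ x, moserA k m Ω (x, t)) *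
      ((k + 2) ^ 2 * c ^ 2 * (∫ x, moserB k m Ω (x, t)) + ∫ x, moserD k m Ω (x, t)) := by
  have iB : Integrable (fun x => moserB k m Ω (x, t)) :=
    integrable_slice (smooth_moserB hΩ k m).continuous isCompact_box
      (fun x hx s => moserB_eq_zero hk m Ω hx s) t
  have iA : Integrable (fun x => moserA k m Ω (x, t)) :=
    integrable_slice (smooth_moserA hΩ k m).continuous isCompact_box
      (fun x hx s => moserA_eq_zero k m Ω hx s) t
  have iD : Integrable (fun x => moserD k m Ω (x, t)) :=
    integrable_slice (continuous_moserD hΩ k m) isCompact_box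
      (fun x hx s => moserD_eq_zero k m Ω hx s) t
  have hz : ∀ x ∉ box, ∀ t, moserB (k + 2) m Ω (x, t) = 0 :=
    fun x hx s => moserB_eq_zero (by omega) m Ω hx s
  have hA0 : 0 ≤ ∫ x, moserA k m Ω (x, t) := integral_nonneg fun x => moserA_nonneg k m Ω x t
  have hB0 : 0 ≤ ∫ x, moserB k m Ω (x, t) := integral_nonneg fun x => moserB_nonneg k m Ω _
  have hD0 : 0 ≤ ∫ x, moserD k m Ω (x, t) := integral_nonneg fun x => moserD_nonneg k hm Ω x t
  -- The energy sits on one side of the parameter, the Moser integral and the dissipation on the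
  -- other. Optimizing in `l` gives a product, in which the energy will be bounded uniformly in time
  -- and the other factor integrated in time.
  have main : ∀ l : ℝ, 0 < l →
      ∫ x, (|dd er (moserB (k + 2) m Ω) (x, t)| + |dd ez (moserB (k + 2) m Ω) (x, t)|) ≤
      l * (8 * ∫ x, moserA k m Ω (x, t)) +
      ((k + 2) ^ 2 * c ^ 2 * (∫ x, moserB k m Ω (x, t)) + ∫ x, moserD k m Ω (x, t)) / l := by
    intro l hl
    have e0 : l * (8 * ∫ x, moserA k m Ω (x, t)) +
      ((k + 2) ^ 2 * c ^ 2 * (∫ x, moserB k m Ω (x, t)) + ∫ x, moserD k m Ω (x, t)) / l =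
      8 * l * (∫ x, moserA k m Ω (x, t)) + ((k + 2) ^ 2 * c ^ 2 / l * (∫ x, moserB k m Ω (x, t))
        + 1 / l * ∫ x, moserD k m Ω (x, t)) := by field_simp
    have iBD : Integrable (fun x => ((k : ℝ) + 2) ^ 2 * c ^ 2 / l * moserB k m Ω (x, t)
        + 1 / l * moserD k m Ω (x, t)) := (iB.const_mul _).add (iD.const_mul _)
    rw [e0, ← integral_const_mul, ← integral_const_mul, ← integral_const_mul,
      ← integral_add (iB.const_mul _) (iD.const_mul _), ← integral_add (iA.const_mul _) iBD]
    refine integral_mono_of_nonneg (ae_of_all _ fun x => by positivity)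
      ((iA.const_mul _).add iBD) (ae_of_all _ fun x => ?_)
    by_cases hx : x ∈ box
    swap
    · simp [dd_eq_zero_of_notMem isCompact_box hz _ x hx t, moserB_eq_zero hk m Ω hx,
        moserD_eq_zero k m Ω hx, moserA_eq_zero k m Ω hx]
    have hr := half_le_of_mem_box hx
    have h0 : 0 ≤ cutoff (x, t) := cutoff.nonneg
    have hw := wt_pos m (Ω (x, t))
    have hw2 := wt₂_nonneg hm (Ω (x, t))
    have key : ∀ e : (ℝ × ℝ) × ℝ,
        cutoff (x, t) ^ (k + 2) * |wt₁ m (Ω (x, t)) * dd e Ω (x, t)| ≤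
        l * moserB (k + 2) m Ω (x, t)
        + 1 / (2 * l) * (cutoff (x, t) ^ (k + 2) * wt₂ m (Ω (x, t)) * dd e Ω (x, t) ^ 2) := by
      intro e
      have := abs_le_add_of_sq_le (y := wt₁ m (Ω (x, t)) * dd e Ω (x, t))
        (a := l * wt m (Ω (x, t))) (b := 1 / (2 * l) * (wt₂ m (Ω (x, t)) * dd e Ω (x, t) ^ 2))
        (by positivity) (by positivity) (by
          have h3 := wt₁_sq_le hm (Ω (x, t))
          have : 4 * (l * wt m (Ω (x, t))) *
              (1 / (2 * l) * (wt₂ m (Ω (x, t)) * dd e Ω (x, t) ^ 2)) = dd e Ω (x, t) ^ 2 *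
                (2 * wt m (Ω (x, t)) * wt₂ m (Ω (x, t))) := by field_simp; ring
          rw [this, mul_pow, mul_comm]
          gcongr)
      have h4 := mul_le_mul_of_nonneg_left this (pow_nonneg h0 (k + 2))
      unfold moserB
      linarith
    -- The term in which the cutoff is differentiated carries the power `k + 1`, again the mean of
    -- `k + 2` and `k`.
    have key2 : (k + 2) * c * moserB (k + 1) m Ω (x, t) ≤ l * moserB (k + 2) m Ω (x, t)
        + (k + 2) ^ 2 * c ^ 2 / (4 * l) * moserB k m Ω (x, t) := by
      have h5 : (k + 2) * c * cutoff (x, t) ≤ l * cutoff (x, t) ^ 2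
          + (k + 2) ^ 2 * c ^ 2 / (4 * l) := by
        refine (le_abs_self _).trans (abs_le_add_of_sq_le (by positivity) (by positivity) ?_)
        have : 4 * (l * cutoff (x, t) ^ 2) * ((k + 2) ^ 2 * c ^ 2 / (4 * l)) =
          (((k : ℝ) + 2) * c * cutoff (x, t)) ^ 2 := by field_simp
        rw [this]
      have h6 := mul_le_mul_of_nonneg_left h5
        (mul_nonneg (pow_nonneg h0 k) hw.le)
      unfold moserB
      calc _ = cutoff (x, t) ^ k * wt m (Ω (x, t)) * ((k + 2) * c * cutoff (x, t)) := by ring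
        _ ≤ _ := h6
        _ = _ := by ring
    have b1 := abs_dd_moserB_le hΩ (k + 1) m (hc er (by simp) (x, t))
    have b2 := abs_dd_moserB_le hΩ (k + 1) m (hc ez (by simp) (x, t))
    push_cast at b1 b2
    have ek : (k : ℝ) + 1 + 1 = k + 2 := by ring
    rw [ek, show k + 1 + 1 = k + 2 from rfl] at b1 b2
    have k1 := key er
    have k2 := key ez
    have hD : cutoff (x, t) ^ (k + 2) * wt₂ m (Ω (x, t)) * dd er Ω (x, t) ^ 2
        + cutoff (x, t) ^ (k + 2) * wt₂ m (Ω (x, t)) * dd ez Ω (x, t) ^ 2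
        ≤ 2 * moserD k m Ω (x, t) := by
      unfold moserD
      have : 0 ≤ cutoff (x, t) ^ (k + 2) * wt₂ m (Ω (x, t)) *
        (dd er Ω (x, t) ^ 2 + dd ez Ω (x, t) ^ 2) := by positivity
      nlinarith
    have hA : moserB (k + 2) m Ω (x, t) ≤ 2 * moserA k m Ω (x, t) := by
      unfold moserA moserB
      have : 0 ≤ cutoff (x, t) ^ (k + 2) * wt m (Ω (x, t)) := by positivity
      nlinarith
    have hA' := mul_le_mul_of_nonneg_left hA hl.le
    have hD' := mul_le_mul_of_nonneg_left hD (show 0 ≤ 1 / (2 * l) by positivity)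
    have e1 : 1 / (2 * l) * (2 * moserD k m Ω (x, t)) = 1 / l * moserD k m Ω (x, t) := by
      field_simp
    have e2 : (k + 2) ^ 2 * c ^ 2 / (4 * l) * moserB k m Ω (x, t) * 2 ≤
        (k + 2) ^ 2 * c ^ 2 / l * moserB k m Ω (x, t) := by
      have := moserB_nonneg k m Ω (x, t)
      have h7 : (k + 2) ^ 2 * c ^ 2 / (4 * l) * moserB k m Ω (x, t) * 2
        = ((k + 2) ^ 2 * c ^ 2 / l * moserB k m Ω (x, t)) / 2 := by field_simp; ring
      rw [h7]
      exact half_le_self (by positivity)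
    simp only []
    linarith
  have h1 := sq_le_of_forall_le (integral_nonneg fun x => by positivity) (by positivity)
    (by positivity) main
  have h2 := hS (moserB (k + 2) m Ω) ((smooth_moserB hΩ _ m).of_le (by simp)) box isCompact_box
    hz t
  rw [mul_pow] at h2
  have h3 := mul_le_mul_of_nonneg_left h1 (sq_nonneg S)
  refine h2.trans (h3.trans (le_of_eq (by ring)))

/-! ### The localized energy inequality. -/

/-- The radial flux in the localized energy identity. -/
def fluxR (Φ U Ω : (ℝ × ℝ) × ℝ → ℝ) (m : ℕ) (p : (ℝ × ℝ) × ℝ) : ℝ :=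
  p.1.1 * Φ p * (wt₁ m (Ω p) * dd er Ω p)
    + (2 * Φ p - p.1.1 * dd er Φ p) * wt m (Ω p) - p.1.1 * Φ p * (U p * wt m (Ω p))

/-- The vertical flux in the localized energy identity. -/
def fluxZ (Φ V Q Ω : (ℝ × ℝ) × ℝ → ℝ) (m : ℕ) (p : (ℝ × ℝ) × ℝ) : ℝ :=
  p.1.1 * Φ p * (wt₁ m (Ω p) * dd ez Ω p)
    - p.1.1 * dd ez Φ p * wt m (Ω p) - p.1.1 * Φ p * (V p * wt m (Ω p))
    + p.1.1 * Φ p * (wt₁ m (Ω p) * Q p)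

theorem smooth_fluxR {Φ U Ω : (ℝ × ℝ) × ℝ → ℝ} (hΦ : ContDiff ℝ ∞ Φ) (hU : ContDiff ℝ ∞ U)
    (hΩ : ContDiff ℝ ∞ Ω) (m : ℕ) : ContDiff ℝ ∞ (fluxR Φ U Ω m) := by
  have h1 := smooth_dd er hΩ
  have h2 := smooth_dd er hΦ
  have h3 : ContDiff ℝ ∞ (fun p => wt m (Ω p)) := (contDiff_wt m).comp hΩ
  have h4 : ContDiff ℝ ∞ (fun p => wt₁ m (Ω p)) := (contDiff_wt₁ m).comp hΩ
  unfold fluxR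
  fun_prop

theorem smooth_fluxZ {Φ V Q Ω : (ℝ × ℝ) × ℝ → ℝ} (hΦ : ContDiff ℝ ∞ Φ) (hV : ContDiff ℝ ∞ V)
    (hQ : ContDiff ℝ ∞ Q) (hΩ : ContDiff ℝ ∞ Ω) (m : ℕ) : ContDiff ℝ ∞ (fluxZ Φ V Q Ω m) := by
  have h1 := smooth_dd ez hΩ
  have h2 := smooth_dd ez hΦ
  have h3 : ContDiff ℝ ∞ (fun p => wt m (Ω p)) := (contDiff_wt m).comp hΩ
  have h4 : ContDiff ℝ ∞ (fun p => wt₁ m (Ω p)) := (contDiff_wt₁ m).comp hΩ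
  unfold fluxZ
  fun_prop

/-- The constant in front of the lower order terms of the energy inequality. -/
def lowerConst (N c : ℝ) : ℝ := 300 * c ^ 2 + 3 * N ^ 2 + 18 * N * c

/-- The letters stand for values at one point: `G`, `G1`, `G2` for the weight and its derivatives,
`ψk` for `ψ^k`, the `Φ`'s for derivatives of `ψ^{k+2}`, `a` and `b` for the gradient of `Ω`, and `n
= k + 2`. Young's inequality on `Q b` spends half of the dissipation on the source. The drift term
is only put into absolute values, since it cannot be estimated pointwise. -/
theorem energy_arith {r ψ ψk G G1 G2 Φt Φr Φz Φrr Φzz u v a b Q N c m n : ℝ}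
    (hr : 1 / 2 ≤ r) (hr' : r ≤ 3 / 2) (hψ : 0 ≤ ψ) (hψ1 : ψ ≤ 1) (hψk : 0 ≤ ψk) (hG : 0 ≤ G)
    (hG2 : 0 ≤ G2) (hm : 1 ≤ m) (hc : 1 ≤ c) (hn : 0 ≤ n) (hnm : n ≤ 6 * m)
    (hQ : |Q| ≤ N) (hG1 : |G1| ≤ 2 * m * G) (hG2' : G2 ≤ 4 * m ^ 2 * G)
    (ht : |Φt| ≤ n * c * (ψk * ψ)) (h1 : |Φr| ≤ n * c * (ψk * ψ)) (h2 : |Φz| ≤ n * c * (ψk * ψ))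
    (h11 : |Φrr| ≤ 2 * n ^ 2 * c ^ 2 * ψk) (h22 : |Φzz| ≤ 2 * n ^ 2 * c ^ 2 * ψk) :
    r * G * Φt + G * (r * Φrr + r * Φzz - Φr) + r * G * (u * Φr + v * Φz)
      - r * (ψk * ψ ^ 2) * G2 * (a ^ 2 + b ^ 2) - r * Q * (G2 * b * (ψk * ψ ^ 2) + G1 * Φz) ≤
    lowerConst N c * m ^ 2 * (ψk * G) + 9 * c * m * ((|u| + |v|) * (ψk * ψ * G))
      - 1 / 2 * (r * (ψk * ψ ^ 2) * G2 * (a ^ 2 + b ^ 2)) := by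
  have hN : 0 ≤ N := (abs_nonneg _).trans hQ
  have hB : 0 ≤ ψk * G := by positivity
  have hψψ : ψk * ψ ≤ ψk := mul_le_of_le_one_right hψk hψ1
  have hncψ : n * c * (ψk * ψ) ≤ 6 * m * c * ψk := by
    calc _ ≤ (6 * m) * c * ψk := by gcongr
      _ = _ := by ring
  have hm2 : m ≤ m ^ 2 := by nlinarith
  have hc2 : c ≤ c ^ 2 := by nlinarith
  have hmc : m * c ≤ m ^ 2 * c ^ 2 := by gcongr
  have T1 : r * G * Φt ≤ 9 * (m ^ 2 * c ^ 2) * (ψk * G) := by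
    calc r * G * Φt ≤ r * G * |Φt| := by gcongr; exact le_abs_self _
      _ ≤ 3 / 2 * G * (6 * m * c * ψk) := by gcongr; exact ht.trans hncψ
      _ = 9 * (m * c) * (ψk * G) := by ring
      _ ≤ _ := by gcongr
  have hnn : 2 * n ^ 2 * c ^ 2 * ψk ≤ 72 * (m ^ 2 * c ^ 2) * ψk := by
    calc _ ≤ 2 * (6 * m) ^ 2 * c ^ 2 * ψk := by gcongr
      _ = _ := by ring
  have T2 : G * (r * Φrr + r * Φzz - Φr) ≤ 222 * (m ^ 2 * c ^ 2) * (ψk * G) := by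
    have x1 : r * Φrr ≤ 3 / 2 * (72 * (m ^ 2 * c ^ 2) * ψk) := by
      calc _ ≤ r * |Φrr| := by gcongr; exact le_abs_self _
        _ ≤ _ := by gcongr; exact h11.trans hnn
    have x2 : r * Φzz ≤ 3 / 2 * (72 * (m ^ 2 * c ^ 2) * ψk) := by
      calc _ ≤ r * |Φzz| := by gcongr; exact le_abs_self _
        _ ≤ _ := by gcongr; exact h22.trans hnn
    have x3 : -Φr ≤ 6 * (m ^ 2 * c ^ 2) * ψk := by
      calc _ ≤ |Φr| := neg_le_abs _
        _ ≤ 6 * m * c * ψk := h1.trans hncψ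
        _ = 6 * (m * c) * ψk := by ring
        _ ≤ _ := by gcongr
    calc _ ≤ G * (222 * (m ^ 2 * c ^ 2) * ψk) := by gcongr; linarith
      _ = _ := by ring
  have T3 : r * G * (u * Φr + v * Φz) ≤ 9 * c * m * ((|u| + |v|) * (ψk * ψ * G)) := by
    have hnc' : n * c * (ψk * ψ) ≤ 6 * m * c * (ψk * ψ) := by gcongr
    have x1 : u * Φr ≤ |u| * (6 * m * c * (ψk * ψ)) := by
      calc _ ≤ |u * Φr| := le_abs_self _
        _ = |u| * |Φr| := abs_mul _ _
        _ ≤ _ := by gcongr; exact h1.trans hnc'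
    have x2 : v * Φz ≤ |v| * (6 * m * c * (ψk * ψ)) := by
      calc _ ≤ |v * Φz| := le_abs_self _
        _ = |v| * |Φz| := abs_mul _ _
        _ ≤ _ := by gcongr; exact h2.trans hnc'
    calc _ ≤ r * G * ((|u| + |v|) * (6 * m * c * (ψk * ψ))) := by gcongr; linarith
      _ ≤ 3 / 2 * G * ((|u| + |v|) * (6 * m * c * (ψk * ψ))) := by gcongr
      _ = _ := by ring
  have T4 : - r * (ψk * ψ ^ 2) * G2 * (a ^ 2 + b ^ 2) - r * Q * (G2 * b * (ψk * ψ ^ 2)) ≤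
      3 * N ^ 2 * m ^ 2 * (ψk * G) - 1 / 2 * (r * (ψk * ψ ^ 2) * G2 * (a ^ 2 + b ^ 2)) := by
    have hQ2 : Q ^ 2 ≤ N ^ 2 := by rw [← sq_abs]; gcongr
    have x0 : 0 ≤ r * (ψk * ψ ^ 2) * G2 := by positivity
    have x1 : - (a ^ 2 + b ^ 2) - Q * b ≤ - (1 / 2) * (a ^ 2 + b ^ 2) + 1 / 2 * N ^ 2 := by
      nlinarith [sq_nonneg (Q + b), sq_nonneg a]
    have x2 := mul_le_mul_of_nonneg_left x1 x0
    have x3 : r * (ψk * ψ ^ 2) * G2 * (1 / 2 * N ^ 2) ≤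
        3 / 2 * (ψk * 1) * (4 * m ^ 2 * G) * (1 / 2 * N ^ 2) := by
      have : ψ ^ 2 ≤ 1 := pow_le_one₀ hψ hψ1
      gcongr
    calc _ = r * (ψk * ψ ^ 2) * G2 * (-(a ^ 2 + b ^ 2) - Q * b) := by ring
      _ ≤ _ := x2
      _ = r * (ψk * ψ ^ 2) * G2 * (1 / 2 * N ^ 2)
          - 1 / 2 * (r * (ψk * ψ ^ 2) * G2 * (a ^ 2 + b ^ 2)) := by ring
      _ ≤ _ := by
        refine sub_le_sub_right (x3.trans (le_of_eq ?_)) _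
        ring
  have T5 : - r * Q * (G1 * Φz) ≤ 18 * N * c * m ^ 2 * (ψk * G) := by
    calc - r * Q * (G1 * Φz) ≤ |- r * Q * (G1 * Φz)| := le_abs_self _
      _ = r * |Q| * (|G1| * |Φz|) := by
        rw [abs_mul, abs_mul, abs_mul, abs_neg, abs_of_nonneg (by linarith : 0 ≤ r)]
      _ ≤ 3 / 2 * N * ((2 * m * G) * (6 * m * c * ψk)) := by
        gcongr
        exact h2.trans hncψ
      _ = _ := by ring
  have e : lowerConst N c * m ^ 2 * (ψk * G) = 300 * (m ^ 2 * c ^ 2) * (ψk * G)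
      + 3 * N ^ 2 * m ^ 2 * (ψk * G) + 18 * N * c * m ^ 2 * (ψk * G) := by
    unfold lowerConst; ring
  have hp : 0 ≤ (m ^ 2 * c ^ 2) * (ψk * G) := by positivity
  rw [e]
  linarith

theorem energy_le_pointwise {N K : ℝ} {U V Q Ω : (ℝ × ℝ) × ℝ → ℝ} (D : LocalData N K U V Q Ω)
    {c : ℝ} (hc1 : 1 ≤ c) (hc : ∀ e ∈ ({er, ez, et} : Set ((ℝ × ℝ) × ℝ)), ∀ q,
      |dd e cutoff q| ≤ c ∧ |dd e (dd e cutoff) q| ≤ c)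
    {k m : ℕ} (hm : 1 ≤ m) (hkm : k + 2 ≤ 6 * m) {t : ℝ} (ht : t ∈ Icc (-1 : ℝ) 0)
    {x : ℝ × ℝ} (hx : x ∈ box) :
    dd et (moserA k m Ω) (x, t) ≤ lowerConst N c * m ^ 2 * moserB k m Ω (x, t)
      + 9 * c * m * ((|U (x, t)| + |V (x, t)|) * moserB (k + 1) m Ω (x, t))
      - 1 / 2 * moserD k m Ω (x, t)
      + dd er (fluxR (fun p => cutoff p ^ (k + 2)) U Ω m) (x, t)
      + dd ez (fluxZ (fun p => cutoff p ^ (k + 2)) V Q Ω m) (x, t) := by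
  have hr := half_le_of_mem_box hx
  have key := energy_identity_pointwise D.smooth_U D.smooth_V D.smooth_Q D.smooth_Ω
    (cutoff_smooth.pow (k + 2)) (hasDerivAt_wt m) (hasDerivAt_wt₁ m) (q := (x, t))
    (by simp; linarith) (D.div_eq x hx t ht) (D.vort_eq x hx t ht)
  have hA : dd et (moserA k m Ω) (x, t) =
    dd et (fun p => p.1.1 * wt m (Ω p) * cutoff p ^ (k + 2)) (x, t) := rfl
  rw [hA, key]
  have h0 : 0 ≤ cutoff (x, t) := cutoff.nonneg
  have b : ∀ e ∈ ({er, ez, et} : Set ((ℝ × ℝ) × ℝ)),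
      |dd e (fun p => cutoff p ^ (k + 2)) (x, t)| ≤
        ((k : ℝ) + 2) * c * (cutoff (x, t) ^ k * cutoff (x, t)) := by
    intro e he
    have := abs_dd_cutoff_pow_le (k + 1) (hc e he (x, t)).1
    push_cast at this
    rw [← pow_succ]
    refine this.trans (le_of_eq (by ring))
  have b2 : ∀ e ∈ ({er, ez, et} : Set ((ℝ × ℝ) × ℝ)),
      |dd e (dd e (fun p => cutoff p ^ (k + 2))) (x, t)| ≤
        2 * ((k : ℝ) + 2) ^ 2 * c ^ 2 * cutoff (x, t) ^ k :=
    fun e he => abs_dd_dd_cutoff_pow_le hc1 k (hc e he (x, t)).1 (hc e he (x, t)).2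
  have ar := energy_arith (r := x.1) (ψ := cutoff (x, t)) (ψk := cutoff (x, t) ^ k)
    (G := wt m (Ω (x, t))) (G1 := wt₁ m (Ω (x, t))) (G2 := wt₂ m (Ω (x, t)))
    (u := U (x, t)) (v := V (x, t)) (a := dd er Ω (x, t)) (b := dd ez Ω (x, t)) (m := m)
    (n := (k : ℝ) + 2) (Q := Q (x, t)) (N := N) hr (le_of_mem_box hx) h0 cutoff.le_one
    (pow_nonneg h0 k) (wt_pos _ _).le (wt₂_nonneg hm _) (by exact_mod_cast hm) hc1
    (by positivity) (by exact_mod_cast hkm) (D.source_le x hx t ht) (abs_wt₁_le hm _)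
    (wt₂_le hm _) (b et (by simp)) (b er (by simp)) (b ez (by simp)) (b2 er (by simp))
    (b2 ez (by simp))
  have ar2 := add_le_add_left (add_le_add_left ar
    (dd er (fluxR (fun p => cutoff p ^ (k + 2)) U Ω m) (x, t)))
    (dd ez (fluxZ (fun p => cutoff p ^ (k + 2)) V Q Ω m) (x, t))
  have e2 : cutoff (x, t) ^ k * cutoff (x, t) ^ 2 = cutoff (x, t) ^ (k + 2) := by ring
  rw [e2, ← pow_succ] at ar2
  exact ar2

theorem fluxR_eq_zero (k m : ℕ) (U Ω : (ℝ × ℝ) × ℝ → ℝ) : ∀ x ∉ box, ∀ t,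
    fluxR (fun p => cutoff p ^ (k + 2)) U Ω m (x, t) = 0 := by
  intro x hx t
  have : ∀ y ∉ box, ∀ s, (fun p => cutoff p ^ (k + 2)) (y, s) = 0 :=
    fun y hy s => by simp [cutoff_eq_zero hy]
  simp [fluxR, dd_eq_zero_of_notMem (f := fun p => cutoff p ^ (k + 2)) isCompact_box this _ x hx t, cutoff_eq_zero hx]

theorem fluxZ_eq_zero (k m : ℕ) (V Q Ω : (ℝ × ℝ) × ℝ → ℝ) : ∀ x ∉ box, ∀ t,
    fluxZ (fun p => cutoff p ^ (k + 2)) V Q Ω m (x, t) = 0 := by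
  intro x hx t
  have : ∀ y ∉ box, ∀ s, (fun p => cutoff p ^ (k + 2)) (y, s) = 0 :=
    fun y hy s => by simp [cutoff_eq_zero hy]
  simp [fluxZ, dd_eq_zero_of_notMem (f := fun p => cutoff p ^ (k + 2)) isCompact_box this _ x hx t, cutoff_eq_zero hx]

/-- The drift integral is controlled by the `L²` norm of the drift and a gradient. -/
theorem integral_drift_le {N K : ℝ} {U V Q Ω : (ℝ × ℝ) × ℝ → ℝ} (D : LocalData N K U V Q Ω)
    {S : ℝ} (hS0 : 0 < S) (hS : ∀ (h : (ℝ × ℝ) × ℝ → ℝ), ContDiff ℝ 1 h →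
    ∀ K : Set (ℝ × ℝ), IsCompact K → (∀ x ∉ K, ∀ t, h (x, t) = 0) → ∀ t : ℝ,
      ∫ x, h (x, t) ^ 2 ≤ (S * ∫ x, (|dd er h (x, t)| + |dd ez h (x, t)|)) ^ 2)
    (k m : ℕ) {t : ℝ} (ht : t ∈ Icc (-1 : ℝ) 0) :
    ∫ x, (|U (x, t)| + |V (x, t)|) * moserB (k + 1) m Ω (x, t) ≤
      2 * K * S * ∫ x, (|dd er (moserB (k + 1) m Ω) (x, t)|
        + |dd ez (moserB (k + 1) m Ω) (x, t)|) := by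
  have hK := D.one_le
  set Y := ∫ x, (|dd er (moserB (k + 1) m Ω) (x, t)| + |dd ez (moserB (k + 1) m Ω) (x, t)|)
    with hY
  have hY0 : 0 ≤ Y := integral_nonneg fun x => by positivity
  have hz : ∀ x ∉ box, ∀ t, moserB (k + 1) m Ω (x, t) = 0 :=
    fun x hx s => moserB_eq_zero (by omega) m Ω hx s
  have cB := (smooth_moserB D.smooth_Ω (k + 1) m).continuous
  have h1 := hS (moserB (k + 1) m Ω) ((smooth_moserB D.smooth_Ω _ m).of_le (by simp)) box
    isCompact_box hz t
  rw [← hY] at h1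
  have cU := D.smooth_U.continuous
  have cV := D.smooth_V.continuous
  have i2 : Integrable (fun x => moserB (k + 1) m Ω (x, t) ^ 2) :=
    integrable_slice (f := fun q => moserB (k + 1) m Ω q ^ 2) (by fun_prop) isCompact_box
      (fun x hx s => by simp [hz x hx s]) t
  have iUV : Integrable (box.indicator fun x => U (x, t) ^ 2 + V (x, t) ^ 2) := by
    rw [integrable_indicator_iff isCompact_box.measurableSet]
    exact ContinuousOn.integrableOn_compact isCompact_box (by fun_prop)
  have hE := D.energy_le t ht
  rw [← integral_indicator isCompact_box.measurableSet] at hE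
  have hE0 : 0 ≤ ∫ x, box.indicator (fun x => U (x, t) ^ 2 + V (x, t) ^ 2) x :=
    integral_nonneg fun x => indicator_nonneg (fun y _ => by positivity) x
  -- Cauchy-Schwarz for the drift against the Moser integrand. The factor `1/2` in `b` makes the
  -- product `4ab` equal to twice the product of the two squared norms, matching `(|U| + |V|)² ≤ 2
  -- (U² + V²)`.
  have key := sq_le_of_forall_le
    (X := ∫ x, (|U (x, t)| + |V (x, t)|) * moserB (k + 1) m Ω (x, t))
    (a := ∫ x, box.indicator (fun x => U (x, t) ^ 2 + V (x, t) ^ 2) x)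
    (b := 1 / 2 * ∫ x, moserB (k + 1) m Ω (x, t) ^ 2)
    (integral_nonneg fun x => mul_nonneg (by positivity) (moserB_nonneg _ _ _ _)) hE0
    (mul_nonneg (by norm_num) (integral_nonneg fun x => by positivity)) (by
      intro l hl
      have e0 : 1 / 2 * (∫ x, moserB (k + 1) m Ω (x, t) ^ 2) / l =
        1 / (2 * l) * ∫ x, moserB (k + 1) m Ω (x, t) ^ 2 := by field_simp
      rw [e0, ← integral_const_mul, ← integral_const_mul,
        ← integral_add (iUV.const_mul _) (i2.const_mul _)]
      refine integral_mono_of_nonneg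
        (ae_of_all _ fun x => mul_nonneg (by positivity) (moserB_nonneg _ _ _ _))
        ((iUV.const_mul _).add (i2.const_mul _)) (ae_of_all _ fun x => ?_)
      by_cases hx : x ∈ box
      swap
      · simp [hz x hx t, hx]
      simp only [hx, indicator_of_mem]
      refine (le_abs_self _).trans (abs_le_add_of_sq_le (by positivity) (by positivity) ?_)
      have : 4 * (l * (U (x, t) ^ 2 + V (x, t) ^ 2)) *
        (1 / (2 * l) * moserB (k + 1) m Ω (x, t) ^ 2) =
        2 * (U (x, t) ^ 2 + V (x, t) ^ 2) * moserB (k + 1) m Ω (x, t) ^ 2 := by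
          field_simp; ring
      rw [this, mul_pow]
      gcongr
      nlinarith [sq_nonneg (|U (x, t)| - |V (x, t)|), sq_abs (U (x, t)), sq_abs (V (x, t))])
  refine abs_le_of_sq_le_sq' (key.trans ?_) (by positivity) |>.2
  calc _ ≤ 4 * K ^ 2 * (1 / 2 * (S * Y) ^ 2) := by gcongr
    _ ≤ (2 * K * S * Y) ^ 2 := by nlinarith [sq_nonneg (K * S * Y)]

/-- The constant of the energy inequality. -/
def energyConst (N c S : ℝ) : ℝ := lowerConst N c + 216 * c ^ 2 * S + 18 * 9 * 16 * c ^ 2 * S ^ 2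

/-- The localized energy inequality. -/
theorem energy_le {N K : ℝ} {U V Q Ω : (ℝ × ℝ) × ℝ → ℝ} (D : LocalData N K U V Q Ω)
    {c : ℝ} (hc1 : 1 ≤ c) (hc : ∀ e ∈ ({er, ez, et} : Set ((ℝ × ℝ) × ℝ)), ∀ q,
      |dd e cutoff q| ≤ c ∧ |dd e (dd e cutoff) q| ≤ c)
    {S : ℝ} (hS0 : 0 < S) (hS : ∀ (h : (ℝ × ℝ) × ℝ → ℝ), ContDiff ℝ 1 h →
    ∀ K : Set (ℝ × ℝ), IsCompact K → (∀ x ∉ K, ∀ t, h (x, t) = 0) → ∀ t : ℝ,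
      ∫ x, h (x, t) ^ 2 ≤ (S * ∫ x, (|dd er h (x, t)| + |dd ez h (x, t)|)) ^ 2)
    {k m : ℕ} (hk : k ≠ 0) (hm : 1 ≤ m) (hkm : k + 2 ≤ 6 * m) {t : ℝ}
    (ht : t ∈ Icc (-1 : ℝ) 0) :
    ∫ x, dd et (moserA k m Ω) (x, t) ≤
      energyConst N c S * m ^ 2 * K ^ 2 * (∫ x, moserB k m Ω (x, t))
        - 1 / 4 * ∫ x, moserD k m Ω (x, t) := by
  have hK := D.one_le
  have hΩ := D.smooth_Ω
  have hm1 : (1 : ℝ) ≤ m := by exact_mod_cast hm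
  have iB : Integrable (fun x => moserB k m Ω (x, t)) :=
    integrable_slice (smooth_moserB hΩ k m).continuous isCompact_box
      (fun x hx s => moserB_eq_zero hk m Ω hx s) t
  have hAz : ∀ x ∉ box, ∀ t, moserA k m Ω (x, t) = 0 :=
    fun x hx s => moserA_eq_zero k m Ω hx s
  have iA : Integrable (fun x => dd et (moserA k m Ω) (x, t)) :=
    integrable_slice (smooth_dd et (smooth_moserA hΩ k m)).continuous isCompact_box
      (dd_eq_zero_of_notMem isCompact_box hAz et) t
  have iD : Integrable (fun x => moserD k m Ω (x, t)) :=
    integrable_slice (continuous_moserD hΩ k m) isCompact_box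
      (fun x hx s => moserD_eq_zero k m Ω hx s) t
  have cU := D.smooth_U.continuous
  have cV := D.smooth_V.continuous
  have cB := (smooth_moserB hΩ (k + 1) m).continuous
  have iDr : Integrable (fun x => (|U (x, t)| + |V (x, t)|) * moserB (k + 1) m Ω (x, t)) :=
    integrable_slice (f := fun q => (|U q| + |V q|) * moserB (k + 1) m Ω q) (by fun_prop)
      isCompact_box (fun x hx s => by simp [moserB_eq_zero (Nat.succ_ne_zero k) m Ω hx]) t
  have sR : ContDiff ℝ ∞ (fluxR (fun p => cutoff p ^ (k + 2)) U Ω m) :=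
    smooth_fluxR (cutoff_smooth.pow _) D.smooth_U hΩ m
  have sZ : ContDiff ℝ ∞ (fluxZ (fun p => cutoff p ^ (k + 2)) V Q Ω m) :=
    smooth_fluxZ (cutoff_smooth.pow _) D.smooth_V D.smooth_Q hΩ m
  have zR := fluxR_eq_zero k m U Ω
  have zZ := fluxZ_eq_zero k m V Q Ω
  have iR := integrable_slice (μ := volume) (smooth_dd er sR).continuous isCompact_box
    (dd_eq_zero_of_notMem isCompact_box zR er) t
  have iZ := integrable_slice (μ := volume) (smooth_dd ez sZ).continuous isCompact_box
    (dd_eq_zero_of_notMem isCompact_box zZ ez) t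
  have nR : ∫ x, dd er (fluxR (fun p => cutoff p ^ (k + 2)) U Ω m) (x, t) = 0 :=
    integral_slice_dd_eq_zero (sR.of_le (by simp)) isCompact_box zR (1, 0) t
  have nZ : ∫ x, dd ez (fluxZ (fun p => cutoff p ^ (k + 2)) V Q Ω m) (x, t) = 0 :=
    integral_slice_dd_eq_zero (sZ.of_le (by simp)) isCompact_box zZ (0, 1) t
  have i1 := iB.const_mul (lowerConst N c * m ^ 2)
  have i2 := iDr.const_mul (9 * c * m)
  have i3 := iD.const_mul (1 / 2)
  have step := integral_mono iA ((((i1.add i2).sub i3).add iR).add iZ) (fun x => by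
    by_cases hx : x ∈ box
    · exact energy_le_pointwise D hc1 hc hm hkm ht hx
    · simp [dd_eq_zero_of_notMem isCompact_box hAz et x hx t,
        dd_eq_zero_of_notMem isCompact_box zR er x hx t,
        dd_eq_zero_of_notMem isCompact_box zZ ez x hx t, moserB_eq_zero hk m Ω hx,
        moserB_eq_zero (Nat.succ_ne_zero k) m Ω hx, moserD_eq_zero k m Ω hx])
  rw [integral_add' (((i1.add i2).sub i3).add iR) iZ, integral_add' ((i1.add i2).sub i3) iR,
    integral_sub' (i1.add i2) i3, integral_add' i1 i2, nR, nZ, integral_const_mul,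
    integral_const_mul, integral_const_mul] at step
  have dr := integral_drift_le D hS0 hS k m ht
  -- Chosen so that `9 c m · 2 K S · 2 ε = 1/4`: the drift takes a quarter of the dissipation, and a
  -- quarter of the available half survives.
  set ε : ℝ := 1 / (144 * c * m * K * S) with hε
  have hden : 0 < 144 * c * m * K * S := by positivity
  have gr := integral_grad_moserB_le (fun e he q => (hc e he q).1) hΩ hk hm
    (ε := ε) (by positivity) t
  have hB0 : 0 ≤ ∫ x, moserB k m Ω (x, t) := integral_nonneg fun x => moserB_nonneg k m Ω _
  set IB := ∫ x, moserB k m Ω (x, t)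
  set ID := ∫ x, moserD k m Ω (x, t)
  have dr2 := dr.trans (mul_le_mul_of_nonneg_left gr (by positivity : 0 ≤ 2 * K * S))
  have dr3 := mul_le_mul_of_nonneg_left dr2 (by positivity : 0 ≤ 9 * c * m)
  have e1 : 9 * c * m * (2 * K * S * ((2 * (k + 1) * c + 1 / ε) * IB + 2 * ε * ID)) =
      (9 * c * m * (2 * K * S) * (2 * (k + 1) * c)
        + 9 * c * m * (2 * K * S) * (144 * c * m * K * S)) * IB + 1 / 4 * ID := by
    rw [hε]; field_simp; ring
  rw [e1] at dr3
  have hk1 : (k : ℝ) + 1 ≤ 6 * m := by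
    have : (k : ℝ) + 2 ≤ 6 * m := by exact_mod_cast hkm
    linarith
  have e2 : 9 * c * m * (2 * K * S) * (2 * (k + 1) * c)
        + 9 * c * m * (2 * K * S) * (144 * c * m * K * S) ≤
      (216 * c ^ 2 * S + 18 * 9 * 16 * c ^ 2 * S ^ 2) * m ^ 2 * K ^ 2 := by
    have hKK : K ≤ K ^ 2 := by nlinarith
    have : 9 * c * m * (2 * K * S) * (2 * (k + 1) * c) ≤ 216 * c ^ 2 * S * m ^ 2 * K ^ 2 := by
      calc _ ≤ 9 * c * m * (2 * K ^ 2 * S) * (2 * (6 * m) * c) := by gcongr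
        _ = _ := by ring
    nlinarith
  have hl : 0 ≤ lowerConst N c := by
    have := D.nonneg
    unfold lowerConst; positivity
  have e3 : lowerConst N c * m ^ 2 ≤ lowerConst N c * m ^ 2 * K ^ 2 :=
    le_mul_of_one_le_right (by positivity) (one_le_pow₀ hK)
  have e4 := mul_le_mul_of_nonneg_right (add_le_add e3 e2) hB0
  have e5 : energyConst N c S * m ^ 2 * K ^ 2 * IB = (lowerConst N c * m ^ 2 * K ^ 2 +
    (216 * c ^ 2 * S + 18 * 9 * 16 * c ^ 2 * S ^ 2) * m ^ 2 * K ^ 2) * IB := by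
    unfold energyConst; ring
  rw [e5]
  linarith

/-! ### Moser iteration and the local maximum estimate. -/

/-- The Moser quantity with exponent `m`. -/
def moserI (m : ℕ) (Ω : (ℝ × ℝ) × ℝ → ℝ) : ℝ :=
  ∫ t in (-1 : ℝ)..0, ∫ x, moserB (6 * m - 4) m Ω (x, t)

theorem moserI_nonneg (m : ℕ) (Ω : (ℝ × ℝ) × ℝ → ℝ) : 0 ≤ moserI m Ω :=
  intervalIntegral.integral_nonneg (by norm_num)
    fun t _ => integral_nonneg fun x => moserB_nonneg _ _ _ _

/-- Integrating the energy inequality in time bounds both the supremum of the localized energy and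
the integrated dissipation by `Λ` times the current Moser quantity. The slice estimate multiplies
the first by the second, hence the square. -/
theorem moserI_double_le {N K : ℝ} {U V Q Ω : (ℝ × ℝ) × ℝ → ℝ} (D : LocalData N K U V Q Ω)
    {c : ℝ} (hc1 : 1 ≤ c) (hc : ∀ e ∈ ({er, ez, et} : Set ((ℝ × ℝ) × ℝ)), ∀ q,
      |dd e cutoff q| ≤ c ∧ |dd e (dd e cutoff) q| ≤ c)
    {S : ℝ} (hS0 : 0 < S) (hS : ∀ (h : (ℝ × ℝ) × ℝ → ℝ), ContDiff ℝ 1 h →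
    ∀ K : Set (ℝ × ℝ), IsCompact K → (∀ x ∉ K, ∀ t, h (x, t) = 0) → ∀ t : ℝ,
      ∫ x, h (x, t) ^ 2 ≤ (S * ∫ x, (|dd er h (x, t)| + |dd ez h (x, t)|)) ^ 2)
    {m : ℕ} (hm : 1 ≤ m) :
    moserI (2 * m) Ω ≤ (13 * S * energyConst N c S * K ^ 2 * m ^ 2 * moserI m Ω) ^ 2 := by
  have hΩ := D.smooth_Ω
  have hK := D.one_le
  have hN := D.nonneg
  have hm1 : (1 : ℝ) ≤ m := by exact_mod_cast hm
  -- With this `k` one has `2 (k + 2) = 6 (2m) - 4`, so squaring `ψ^{k+2} (1 + Ω²)^m` gives exactly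
  -- the integrand with exponent `2m`. Moreover `k + 2 ≤ 6m` keeps the cost of differentiating the
  -- cutoff linear in `m`.
  set k := 6 * m - 4 with hkdef
  have hk : k ≠ 0 := by omega
  have hkm : k + 2 ≤ 6 * m := by omega
  set Λ : ℝ := energyConst N c S * m ^ 2 * K ^ 2 with hΛ
  have hl : 36 * c ^ 2 ≤ energyConst N c S := by
    unfold energyConst lowerConst
    have : 0 ≤ N * c := by positivity
    have : 0 ≤ c ^ 2 * S := by positivity
    have : 0 ≤ c ^ 2 * S ^ 2 := by positivity
    nlinarith [sq_nonneg N, sq_nonneg c]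
  have hE0 : 0 ≤ energyConst N c S := le_trans (by positivity) hl
  have hΛ0 : 0 ≤ Λ := by positivity
  let A := fun t => ∫ x, moserA k m Ω (x, t)
  let A' := fun t => ∫ x, dd et (moserA k m Ω) (x, t)
  let B := fun t => ∫ x, moserB k m Ω (x, t)
  let Di := fun t => ∫ x, moserD k m Ω (x, t)
  have hAz : ∀ x ∉ box, ∀ t, moserA k m Ω (x, t) = 0 := fun x hx s => moserA_eq_zero k m Ω hx s
  have cA' : Continuous A' := continuous_integral_slice
    (smooth_dd et (smooth_moserA hΩ k m)).continuous isCompact_box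
    (dd_eq_zero_of_notMem isCompact_box hAz et)
  have cA : Continuous A := continuous_integral_slice (smooth_moserA hΩ k m).continuous
    isCompact_box hAz
  have cB : Continuous B := continuous_integral_slice (smooth_moserB hΩ k m).continuous
    isCompact_box (fun x hx s => moserB_eq_zero hk m Ω hx s)
  have cD : Continuous Di := continuous_integral_slice (continuous_moserD hΩ k m)
    isCompact_box (fun x hx s => moserD_eq_zero k m Ω hx s)
  have hB0 : ∀ t, 0 ≤ B t := fun t => integral_nonneg fun x => moserB_nonneg k m Ω _
  have hA0 : ∀ t, 0 ≤ A t := fun t => integral_nonneg fun x => moserA_nonneg k m Ω x t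
  have hD0 : ∀ t, 0 ≤ Di t := fun t => integral_nonneg fun x => moserD_nonneg k hm Ω x t
  have hen : ∀ t ∈ Icc (-1 : ℝ) 0, A' t ≤ Λ * B t - 1 / 4 * Di t := fun t ht =>
    energy_le D hc1 hc hS0 hS hk hm hkm ht
  have hAstart : A (-1) = 0 := by
    refine integral_eq_zero_of_ae (ae_of_all _ fun x => ?_)
    simp [moserA, cutoff_eq_zero_of_le (show (-1 : ℝ) ≤ -1 / 2 by norm_num)]
  have hFTC : ∀ t, ∫ s in (-1 : ℝ)..t, A' s = A t - A (-1) := fun t =>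
    integral_slice_sub ((smooth_moserA hΩ k m).of_le (by simp)) isCompact_box hAz (-1) t
  have hIeq : moserI m Ω = ∫ t in (-1 : ℝ)..0, B t := rfl
  set I := moserI m Ω
  have hI0 : 0 ≤ I := moserI_nonneg m Ω
  have hAle : ∀ t ∈ Icc (-1 : ℝ) 0, A t ≤ Λ * I := by
    intro t ht
    have h1 := hFTC t
    rw [hAstart, sub_zero] at h1
    rw [← h1]
    calc ∫ s in (-1 : ℝ)..t, A' s ≤ ∫ s in (-1 : ℝ)..t, Λ * B s := by
          refine intervalIntegral.integral_mono_on ht.1 (cA'.intervalIntegrable _ _)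
            ((cB.const_mul Λ).intervalIntegrable _ _) (fun s hs => ?_)
          have := hen s ⟨hs.1, hs.2.trans ht.2⟩
          linarith [hD0 s]
      _ = Λ * ∫ s in (-1 : ℝ)..t, B s := intervalIntegral.integral_const_mul _ _
      _ ≤ Λ * I := by
          gcongr
          rw [hIeq]
          exact intervalIntegral.integral_mono_interval le_rfl ht.1 ht.2
            (ae_of_all _ hB0) (cB.intervalIntegrable _ _)
  have hDle : ∫ t in (-1 : ℝ)..0, Di t ≤ 4 * Λ * I := by
    have h1 := hFTC 0
    rw [hAstart, sub_zero] at h1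
    have h2 : ∫ s in (-1 : ℝ)..0, A' s ≤ ∫ s in (-1 : ℝ)..0, (Λ * B s - 1 / 4 * Di s) :=
      intervalIntegral.integral_mono_on (by norm_num) (cA'.intervalIntegrable _ _)
        (((cB.const_mul Λ).sub (cD.const_mul _)).intervalIntegrable _ _) hen
    rw [intervalIntegral.integral_sub ((cB.const_mul Λ).intervalIntegrable _ _)
      ((cD.const_mul _).intervalIntegrable _ _), intervalIntegral.integral_const_mul,
      intervalIntegral.integral_const_mul, ← hIeq] at h2
    linarith [hA0 0]
  have hk2 : ((k : ℝ) + 2) ^ 2 * c ^ 2 ≤ Λ := by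
    have : (k : ℝ) + 2 ≤ 6 * m := by exact_mod_cast hkm
    calc ((k : ℝ) + 2) ^ 2 * c ^ 2 ≤ (6 * m) ^ 2 * c ^ 2 := by gcongr
      _ = (36 * c ^ 2) * m ^ 2 * 1 := by ring
      _ ≤ energyConst N c S * m ^ 2 * K ^ 2 := by
          gcongr
          exact one_le_pow₀ hK
  have hstep : ∀ t ∈ Icc (-1 : ℝ) 0, ∫ x, moserB (6 * (2 * m) - 4) (2 * m) Ω (x, t) ≤
      32 * S ^ 2 * (Λ * I) * (Λ * B t + Di t) := by
    intro t ht
    have h := integral_moserB_sq_le hS (fun e he q => (hc e he q).1) hΩ hk hm t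
    have e : ∀ x, moserB (6 * (2 * m) - 4) (2 * m) Ω (x, t) = moserB (k + 2) m Ω (x, t) ^ 2 := by
      intro x
      unfold moserB wt
      rw [mul_pow, ← pow_mul, ← pow_mul, show (k + 2) * 2 = 6 * (2 * m) - 4 by omega,
        mul_comm m 2]
    simp only [e]
    refine h.trans ?_
    have hb := hB0 t
    have hd := hD0 t
    have ha := hAle t ht
    change 32 * S ^ 2 * A t * (((k : ℝ) + 2) ^ 2 * c ^ 2 * B t + Di t) ≤ _
    gcongr
  have c2 : Continuous fun t => ∫ x, moserB (6 * (2 * m) - 4) (2 * m) Ω (x, t) :=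
    continuous_integral_slice (smooth_moserB hΩ _ _).continuous isCompact_box
      (fun x hx s => moserB_eq_zero (by omega) _ Ω hx s)
  calc moserI (2 * m) Ω ≤ ∫ t in (-1 : ℝ)..0, 32 * S ^ 2 * (Λ * I) * (Λ * B t + Di t) :=
        intervalIntegral.integral_mono_on (by norm_num) (c2.intervalIntegrable _ _)
          ((((cB.const_mul Λ).add cD).const_mul _).intervalIntegrable _ _) hstep
    _ = 32 * S ^ 2 * (Λ * I) * (Λ * I + ∫ t in (-1 : ℝ)..0, Di t) := by
        rw [intervalIntegral.integral_const_mul, intervalIntegral.integral_add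
          ((cB.const_mul Λ).intervalIntegrable _ _) (cD.intervalIntegrable _ _),
          intervalIntegral.integral_const_mul, ← hIeq]
    _ ≤ 32 * S ^ 2 * (Λ * I) * (Λ * I + 4 * Λ * I) := by gcongr
    -- The factor is `32 · 5 = 160`, which is at most `13²`.
    _ ≤ (13 * (S * Λ * I)) ^ 2 := by nlinarith [sq_nonneg (S * Λ * I)]
    _ = _ := by rw [hΛ]; ring

/-- At `m = 2^k` the factor `m⁴` is `16^k`. With `J_k = Λ² 16^{k+1} I_{2^k}` the recursion becomes
`J_{k+1} ≤ J_k²`, which iterates without further constants. -/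
theorem moserI_iterate {Ω : (ℝ × ℝ) × ℝ → ℝ}
    {Λ : ℝ} (hΛ : 1 ≤ Λ)
    (hstep : ∀ m : ℕ, 1 ≤ m → moserI (2 * m) Ω ≤ (Λ * m ^ 2 * moserI m Ω) ^ 2) (k : ℕ) :
    moserI (2 ^ k) Ω ≤ (16 * Λ ^ 2 * moserI 1 Ω) ^ 2 ^ k := by
  have key : ∀ k : ℕ, Λ ^ 2 * 16 ^ (k + 1) * moserI (2 ^ k) Ω ≤
      (16 * Λ ^ 2 * moserI 1 Ω) ^ 2 ^ k := by
    intro k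
    induction k with
    | zero => simp; linarith
    | succ k ih =>
      have h1 := hstep (2 ^ k) Nat.one_le_two_pow
      have hn := moserI_nonneg (2 ^ k) Ω
      rw [← pow_succ'] at h1
      calc Λ ^ 2 * 16 ^ (k + 1 + 1) * moserI (2 ^ (k + 1)) Ω
          ≤ Λ ^ 2 * 16 ^ (k + 1 + 1) * (Λ * ((2 ^ k : ℕ) : ℝ) ^ 2 * moserI (2 ^ k) Ω) ^ 2 := by
            gcongr
        _ = (Λ ^ 2 * 16 ^ (k + 1) * moserI (2 ^ k) Ω) ^ 2 := by
            push_cast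
            rw [show (16 : ℝ) ^ (k + 1 + 1) = 256 * (2 ^ k) ^ 4 by
                rw [← pow_mul, mul_comm k 4, pow_mul]; norm_num; ring,
              show (16 : ℝ) ^ (k + 1) = 16 * (2 ^ k) ^ 4 by
                rw [← pow_mul, mul_comm k 4, pow_mul]; norm_num; ring]
            ring
        _ ≤ ((16 * Λ ^ 2 * moserI 1 Ω) ^ 2 ^ k) ^ 2 := by gcongr
        _ = _ := by rw [← pow_mul, ← pow_succ]
  refine le_trans ?_ (key k)
  refine le_mul_of_one_le_left (moserI_nonneg _ _) ?_
  exact one_le_mul_of_one_le_of_one_le (one_le_pow₀ hΛ) (one_le_pow₀ (by norm_num))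

/-- A pointwise bound from the bounds on all Moser quantities. -/
theorem wt_le_of_moserI_le {Ω : (ℝ × ℝ) × ℝ → ℝ} (hΩ : ContDiff ℝ ∞ Ω) {Y : ℝ} (hY : 0 < Y)
    (h : ∀ k : ℕ, moserI (2 ^ k) Ω ≤ Y ^ 2 ^ k) : 1 + Ω ((1, 0), 0) ^ 2 ≤ Y := by
  by_contra hcon
  push Not at hcon
  -- If the bound fails, `1 + Ω²` exceeds some `Z > Y` on a small cylinder where the cutoff is `1`.
  -- The Moser quantities then grow at least like a constant times `Z^{2^k}`, which eventually beats
  -- `Y^{2^k}`.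
  obtain ⟨Z, hYZ, hZ⟩ := exists_between hcon
  have hZ0 : 0 < Z := hY.trans hYZ
  have hopen : {q : (ℝ × ℝ) × ℝ | Z < 1 + Ω q ^ 2} ∈ 𝓝 (((1, 0), 0) : (ℝ × ℝ) × ℝ) :=
    (isOpen_lt continuous_const (by have := hΩ.continuous; fun_prop)).mem_nhds hZ
  obtain ⟨δ, hδ, hball⟩ := Metric.mem_nhds_iff.1 hopen
  set η := min (δ / 2) (1 / 4) with hη
  have hη0 : 0 < η := by positivity
  have hη4 : η ≤ 1 / 4 := min_le_right _ _
  have hηδ : η < δ := (min_le_left _ _).trans_lt (by linarith)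
  set R : Set (ℝ × ℝ) := Metric.closedBall (1, 0) η
  have hRv : 0 < volume.real R := by
    have h1 : 0 < volume R := Metric.measure_closedBall_pos _ _ hη0
    exact ENNReal.toReal_pos h1.ne' (isCompact_closedBall _ _).measure_lt_top.ne
  have hlow : ∀ k : ℕ, η * volume.real R * Z ^ 2 ^ k ≤ moserI (2 ^ k) Ω := by
    intro k
    have hpos : 1 ≤ 2 ^ k := Nat.one_le_two_pow
    have hz : ∀ x ∉ box, ∀ t, moserB (6 * 2 ^ k - 4) (2 ^ k) Ω (x, t) = 0 :=
      fun x hx s => moserB_eq_zero (by omega) _ Ω hx s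
    have cB := continuous_integral_slice (μ := volume)
      (smooth_moserB hΩ (6 * 2 ^ k - 4) (2 ^ k)).continuous isCompact_box hz
    have hsl : ∀ t ∈ Icc (-η) 0, volume.real R * Z ^ 2 ^ k ≤
        ∫ x, moserB (6 * 2 ^ k - 4) (2 ^ k) Ω (x, t) := by
      intro t ht
      have hi := integrable_slice (μ := volume)
        (smooth_moserB hΩ (6 * 2 ^ k - 4) (2 ^ k)).continuous isCompact_box hz t
      calc volume.real R * Z ^ 2 ^ k = ∫ x in R, Z ^ 2 ^ k := by
            simp [Measure.real]
        _ ≤ ∫ x in R, moserB (6 * 2 ^ k - 4) (2 ^ k) Ω (x, t) := by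
            refine setIntegral_mono_on
              (integrableOn_const (isCompact_closedBall _ _).measure_lt_top.ne)
              hi.integrableOn Metric.isClosed_closedBall.measurableSet (fun x hx => ?_)
            have hd : dist (x, t) (((1, 0), 0) : (ℝ × ℝ) × ℝ) ≤ η := by
              refine max_le hx ?_
              rw [Real.dist_eq, sub_zero]
              exact abs_le.2 ⟨ht.1, ht.2.trans hη0.le⟩
            have h1 : cutoff (x, t) = 1 :=
              cutoff.one_of_mem_closedBall (Metric.mem_closedBall.2 (hd.trans hη4))
            have h2 : Z < 1 + Ω (x, t) ^ 2 := hball (Metric.mem_ball.2 (hd.trans_lt hηδ))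
            unfold moserB wt
            rw [h1, one_pow, one_mul]
            gcongr
        _ ≤ _ := setIntegral_le_integral hi (ae_of_all _ fun x => moserB_nonneg _ _ _ _)
    calc η * volume.real R * Z ^ 2 ^ k = ∫ t in (-η)..0, volume.real R * Z ^ 2 ^ k := by
          simp; ring
      _ ≤ ∫ t in (-η)..0, ∫ x, moserB (6 * 2 ^ k - 4) (2 ^ k) Ω (x, t) :=
          intervalIntegral.integral_mono_on (by linarith) (by simp)
            (cB.intervalIntegrable _ _) hsl
      _ ≤ moserI (2 ^ k) Ω :=
          intervalIntegral.integral_mono_interval (by linarith) (by linarith) le_rfl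
            (ae_of_all _ fun t => integral_nonneg fun x => moserB_nonneg _ _ _ _)
            (cB.intervalIntegrable _ _)
  have hb : ∀ k : ℕ, η * volume.real R * (Z / Y) ^ 2 ^ k ≤ 1 := by
    intro k
    have := (hlow k).trans (h k)
    rw [div_pow, ← mul_div_assoc, div_le_one (by positivity)]
    exact this
  have ht : Tendsto (fun k : ℕ => (Z / Y) ^ 2 ^ k) atTop atTop :=
    (tendsto_pow_atTop_atTop_of_one_lt ((one_lt_div hY).2 hYZ)).comp
      (tendsto_pow_atTop_atTop_of_one_lt (by norm_num : 1 < 2))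
  obtain ⟨k, hk⟩ := (ht.eventually_gt_atTop (1 / (η * volume.real R))).exists
  have h1 := hb k
  have hp : 0 < η * volume.real R := by positivity
  rw [div_lt_iff₀ hp] at hk
  linarith

/-- The local maximum estimate for the drift-diffusion problem. -/
theorem exists_local_bound {N : ℝ} (hN : 0 ≤ N) : ∃ C : ℝ, 0 < C ∧
    ∀ (K W : ℝ) (U V Q Ω : (ℝ × ℝ) × ℝ → ℝ), LocalData N K U V Q Ω → 0 ≤ W →
      (∫ t in (-1 : ℝ)..0, ∫ x in box, Ω (x, t) ^ 2) ≤ W ^ 2 →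
      |Ω ((1, 0), 0)| ≤ C * K ^ 2 * (W + 1) := by
  obtain ⟨S, hS0, hS⟩ := exists_gagliardo_slice
  obtain ⟨c, hc1, hc⟩ := exists_cutoff_bound
  have hE0 : 0 ≤ energyConst N c S := by
    unfold energyConst lowerConst; positivity
  set L := 13 * S * energyConst N c S + 1 with hL
  have hL1 : 1 ≤ L := by rw [hL]; have : 0 ≤ 13 * S * energyConst N c S := by positivity
                         linarith
  refine ⟨4 * L, by positivity, ?_⟩
  intro K W U V Q Ω D hW hvort
  have hK := D.one_le
  have hΩ := D.smooth_Ω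
  have hstep : ∀ m : ℕ, 1 ≤ m → moserI (2 * m) Ω ≤ (L * K ^ 2 * m ^ 2 * moserI m Ω) ^ 2 := by
    intro m hm
    have hn := moserI_nonneg m Ω
    refine (moserI_double_le D hc1 hc hS0 hS hm).trans ?_
    gcongr
    linarith
  have hLK : 1 ≤ L * K ^ 2 := one_le_mul_of_one_le_of_one_le hL1 (one_le_pow₀ hK)
  have hit := moserI_iterate hLK hstep
  -- Box and time interval both have measure one, so the constant part of `1 + Ω²` contributes at
  -- most `1` to the first Moser quantity.
  have hvol : volume.real box = 1 := by
    have : box = Icc (1 / 2 : ℝ) (3 / 2) ×ˢ Icc (-1 / 2 : ℝ) (1 / 2) := by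
      ext x
      rw [mem_box, abs_le, abs_le]
      simp only [mem_prod, mem_Icc]
      constructor
      · rintro ⟨⟨h1, h2⟩, h3, h4⟩; refine ⟨⟨?_, ?_⟩, ?_, ?_⟩ <;> linarith
      · rintro ⟨⟨h1, h2⟩, h3, h4⟩; refine ⟨⟨?_, ?_⟩, ?_, ?_⟩ <;> linarith
    rw [this, Measure.real, Measure.volume_eq_prod, Measure.prod_prod]
    simp; norm_num
  have cΩ := hΩ.continuous
  have cI : Continuous fun t => ∫ x in box, Ω (x, t) ^ 2 :=
    continuous_parametric_integral_of_continuous (f := fun t x => Ω (x, t) ^ 2)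
      (by fun_prop) isCompact_box
  have hI1 : moserI 1 Ω ≤ 1 + W ^ 2 := by
    have cB := continuous_integral_slice (μ := volume)
      (smooth_moserB hΩ (6 * 1 - 4) 1).continuous isCompact_box
      (fun x hx s => moserB_eq_zero (by omega) _ Ω hx s)
    calc moserI 1 Ω ≤ ∫ t in (-1 : ℝ)..0, (1 + ∫ x in box, Ω (x, t) ^ 2) := by
          refine intervalIntegral.integral_mono_on (by norm_num) (cB.intervalIntegrable _ _)
            ((continuous_const.add cI).intervalIntegrable _ _) (fun t _ => ?_)
          have i1 : IntegrableOn (fun x => Ω (x, t) ^ 2) box :=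
            ContinuousOn.integrableOn_compact isCompact_box (by fun_prop)
          have i0 : IntegrableOn (fun _ : ℝ × ℝ => (1 : ℝ)) box :=
            integrableOn_const isCompact_box.measure_lt_top.ne
          have e1 : 1 + ∫ x in box, Ω (x, t) ^ 2 = ∫ x in box, (1 + Ω (x, t) ^ 2) := by
            rw [integral_add i0 i1]; simp [hvol]
          rw [e1, ← setIntegral_eq_integral_of_forall_compl_eq_zero (s := box)
            (fun x hx => moserB_eq_zero (by omega) _ Ω hx t)]
          refine setIntegral_mono_on ?_ (i0.add i1) isCompact_box.measurableSet (fun x _ => ?_)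
          · exact (integrable_slice (smooth_moserB hΩ (6 * 1 - 4) 1).continuous isCompact_box
              (fun x hx s => moserB_eq_zero (by omega) _ Ω hx s) t).integrableOn
          · unfold moserB wt
            rw [pow_one]
            exact mul_le_of_le_one_left (by positivity)
              (pow_le_one₀ cutoff.nonneg cutoff.le_one)
      _ = 1 + ∫ t in (-1 : ℝ)..0, ∫ x in box, Ω (x, t) ^ 2 := by
          rw [intervalIntegral.integral_add (by simp) (cI.intervalIntegrable _ _)]; simp
      _ ≤ _ := by linarith
  have hfin := wt_le_of_moserI_le hΩ (Y := 16 * (L * K ^ 2) ^ 2 * (1 + W ^ 2)) (by positivity)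
    (fun k => (hit k).trans (by
      have := moserI_nonneg 1 Ω
      gcongr))
  refine abs_le_of_sq_le_sq ?_ (by positivity)
  calc Ω ((1, 0), 0) ^ 2 ≤ 16 * (L * K ^ 2) ^ 2 * (1 + W ^ 2) := by linarith
    _ ≤ 16 * (L * K ^ 2) ^ 2 * (W + 1) ^ 2 := by gcongr; nlinarith
    _ = _ := by ring

/-! ### Globally smooth flows in Cartesian components. -/

/-- The `j`-th coordinate direction in space-time. -/
def sd (j : Fin 3) : E3 × ℝ := (EuclideanSpace.single j 1, 0)

/-- The time direction in space-time. -/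
def td : E3 × ℝ := (0, 1)

/-- A globally smooth axially symmetric velocity field, given by Cartesian components on
space-time, which solves the Navier-Stokes equations for times in `I`. -/
structure SmoothFlow (I : Set ℝ) (w : Fin 3 → E3 × ℝ → ℝ) (π : E3 × ℝ → ℝ) : Prop where
  smooth_w : ∀ i, ContDiff ℝ ∞ (w i)
  smooth_π : ContDiff ℝ ∞ π
  momentum : ∀ i x, ∀ t ∈ I,
    ∑ j, dd (sd j) (dd (sd j) (w i)) (x, t) - ∑ j, w j (x, t) * dd (sd j) (w i) (x, t)
      - dd (sd i) π (x, t) - dd td (w i) (x, t) = 0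
  div_eq : ∀ x t, ∑ i, dd (sd i) (w i) (x, t) = 0
  radial_eq : ∀ (x y : E3) (t : ℝ), rad x = rad y → x 2 = y 2 →
    x 0 * w 0 (x, t) + x 1 * w 1 (x, t) = y 0 * w 0 (y, t) + y 1 * w 1 (y, t)
  swirl_eq : ∀ (x y : E3) (t : ℝ), rad x = rad y → x 2 = y 2 →
    x 0 * w 1 (x, t) - x 1 * w 0 (x, t) = y 0 * w 1 (y, t) - y 1 * w 0 (y, t)
  vertical_eq : ∀ (x y : E3) (t : ℝ), rad x = rad y → x 2 = y 2 → w 2 (x, t) = w 2 (y, t)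

theorem dd_slice {E : Type*} [NormedAddCommGroup E] [NormedSpace ℝ E] {f : E × ℝ → ℝ}
    (hf : Differentiable ℝ f) (e x : E) (t : ℝ) :
    dd (e, 0) f (x, t) = fderiv ℝ (fun y => f (y, t)) x e := by
  have hA : HasFDerivAt (fun y : E => (y, t)) (ContinuousLinearMap.inl ℝ E ℝ) x :=
    hasFDerivAt_prodMk_left x t
  have := dd_comp_map (f := f) e (hf _) hA
  simpa [dd] using this.symm

theorem dd_time {E : Type*} [NormedAddCommGroup E] [NormedSpace ℝ E] {f : E × ℝ → ℝ}
    (hf : Differentiable ℝ f) (x : E) (t : ℝ) :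
    dd (0, 1) f (x, t) = deriv (fun s => f (x, s)) t := by
  have hcv : HasDerivAt (fun s : ℝ => (x, s)) ((0 : E), (1 : ℝ)) t :=
    (hasDerivAt_const t x).prodMk (hasDerivAt_id t)
  exact (hasDerivAt_dd (f := f) (hf _) hcv).deriv.symm

/-- A smooth map into an open interval which is the identity on a compact subinterval. -/
theorem exists_smooth_retraction {a b a' b' : ℝ} (ha : a' < a) (hab : a < b) (hb : b < b') :
    ∃ σ : ℝ → ℝ, ContDiff ℝ ∞ σ ∧ (∀ t, σ t ∈ Ioo a' b') ∧ ∀ t ∈ Icc a b, σ t = t := by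
  set c := (a + b) / 2 with hc
  have hr : (b - a) / 2 < min (c - a') (b' - c) := lt_min (by linarith) (by linarith)
  let β : ContDiffBump c := ⟨(b - a) / 2, min (c - a') (b' - c), by linarith, hr⟩
  refine ⟨fun t => c + (t - c) * β t, ?_, ?_, ?_⟩
  · have : ContDiff ℝ ∞ (β : ℝ → ℝ) := β.contDiff
    fun_prop
  · intro t
    have hlt : |(t - c) * β t| < min (c - a') (b' - c) := by
      rcases lt_or_ge (dist t c) (min (c - a') (b' - c)) with h | h
      · rw [abs_mul, abs_of_nonneg β.nonneg]
        refine lt_of_le_of_lt ?_ h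
        exact mul_le_of_le_one_right (abs_nonneg _) β.le_one
      · have : β t = 0 := β.zero_of_le_dist h
        rw [this, mul_zero, abs_zero]; linarith
    have h1 := abs_lt.1 (hlt.trans_le (min_le_left _ _))
    have h2 := abs_lt.1 (hlt.trans_le (min_le_right _ _))
    constructor <;> simp only <;> linarith [h1.1, h2.2]
  · intro t ht
    have : β t = 1 := β.one_of_mem_closedBall (by
      rw [Metric.mem_closedBall, Real.dist_eq, abs_le]
      change -((b - a) / 2) ≤ t - c ∧ t - c ≤ (b - a) / 2
      constructor <;> linarith [ht.1, ht.2])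
    simp [this]

theorem compR_mul_rad (u : E3 → E3) (x : E3) (hx : rad x ≠ 0) :
    rad x * compR u x = x 0 * u x 0 + x 1 * u x 1 := by
  simp only [compR, eR, PiLp.inner_apply, Fin.sum_univ_three]
  simp
  field_simp

theorem rad_mul_compTheta (u : E3 → E3) (x : E3) :
    rad x * compTheta u x = x 0 * u x 1 - x 1 * u x 0 := by
  by_cases hx : rad x = 0
  · have h : x 0 ^ 2 + x 1 ^ 2 = 0 := by
      have := (Real.sqrt_eq_zero (by positivity)).1 hx
      exact this
    have h0 : x 0 = 0 := by nlinarith [sq_nonneg (x 0), sq_nonneg (x 1)]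
    have h1 : x 1 = 0 := by nlinarith [sq_nonneg (x 0), sq_nonneg (x 1)]
    simp [hx, h0, h1]
  · simp only [compTheta, eTheta, PiLp.inner_apply, Fin.sum_univ_three]
    simp
    field_simp
    ring

theorem rad_eq_zero_iff {x : E3} : rad x = 0 ↔ x 0 = 0 ∧ x 1 = 0 := by
  unfold rad
  rw [Real.sqrt_eq_zero (by positivity)]
  constructor
  · intro h
    constructor <;> nlinarith [sq_nonneg (x 0), sq_nonneg (x 1)]
  · rintro ⟨h0, h1⟩; simp [h0, h1]

theorem laplacian_component {f : E3 → E3} (hf : ContDiff ℝ ∞ f) (x : E3) (i : Fin 3) :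
    (Laplacian.laplacian f x) i = ∑ j : Fin 3, fderiv ℝ (fun y => fderiv ℝ (fun z => f z i) y
      (EuclideanSpace.single j 1)) x (EuclideanSpace.single j 1) := by
  have h2 : ContDiff ℝ 2 f := hf.of_le (WithTop.coe_le_coe.2 le_top)
  have h := ContDiffAt.laplacian_CLM_comp_left (l := (EuclideanSpace.proj i : E3 →L[ℝ] ℝ))
    (h2.contDiffAt (x := x))
  have hfi : ContDiff ℝ 2 (fun z => f z i) := by fun_prop
  have hd : Differentiable ℝ (fderiv ℝ (fun z => f z i)) :=
    (hfi.fderiv_right (m := 1) (by norm_num)).differentiable (by norm_num)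
  have h3 : (Laplacian.laplacian f x) i = Laplacian.laplacian (fun z => f z i) x := h.symm
  rw [h3, InnerProductSpace.laplacian_eq_iteratedFDeriv_orthonormalBasis _
    (EuclideanSpace.basisFun (Fin 3) ℝ)]
  refine Finset.sum_congr rfl fun j _ => ?_
  rw [iteratedFDeriv_two_apply]
  simp only [EuclideanSpace.basisFun_apply, Matrix.cons_val_zero, Matrix.cons_val_one]
  rw [fderiv_clm_apply (hd x) (by fun_prop)]
  simp

theorem gradient_component (f : E3 → ℝ) (x : E3) (i : Fin 3) :
    (gradient f x) i = fderiv ℝ f x (EuclideanSpace.single i 1) := by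
  have h : inner ℝ (gradient f x) (EuclideanSpace.single i (1 : ℝ)) =
      fderiv ℝ f x (EuclideanSpace.single i 1) := by
    unfold gradient
    rw [InnerProductSpace.toDual_symm_apply]
  rw [← h, EuclideanSpace.inner_single_right]
  simp

/-- A classical solution can be modified outside a compact time interval to a globally smooth
field. -/
theorem exists_smoothFlow {T : ℝ} {v : E3 → ℝ → E3} {p : E3 → ℝ → ℝ}
    (hv : IsSmoothNSSolution T v p) (hax : ∀ t ∈ Ioo (-T) 0, IsAxisymmetric (fun x => v x t))
    {a b : ℝ} (ha : -T < a) (hab : a < b) (hb : b < 0) :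
    ∃ (w : Fin 3 → E3 × ℝ → ℝ) (π : E3 × ℝ → ℝ), SmoothFlow (Ioo a b) w π ∧
      ∀ i x, ∀ t ∈ Icc a b, w i (x, t) = v x t i := by
  -- Precomposing time with `σ` preserves everything that holds slice by slice, namely
  -- incompressibility and axial symmetry, at all times. The momentum equation contains a time
  -- derivative and survives only where `σ` is the identity.
  obtain ⟨σ, hσ, hσm, hσi⟩ := exists_smooth_retraction ha hab hb
  have hmap : ContDiff ℝ ∞ (fun q : E3 × ℝ => (q.1, σ q.2)) := by fun_prop
  have hmem : ∀ q : E3 × ℝ, (q.1, σ q.2) ∈ (univ : Set E3) ×ˢ Ioo (-T) 0 :=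
    fun q => ⟨trivial, hσm q.2⟩
  have hvs : ContDiff ℝ ∞ (fun q : E3 × ℝ => v q.1 (σ q.2)) :=
    hv.smooth_velocity.comp_contDiff hmap hmem
  have hps : ContDiff ℝ ∞ (fun q : E3 × ℝ => p q.1 (σ q.2)) :=
    hv.smooth_pressure.comp_contDiff hmap hmem
  have hw : ∀ i : Fin 3, ContDiff ℝ ∞ (fun q : E3 × ℝ => v q.1 (σ q.2) i) := by
    intro i; exact (EuclideanSpace.proj i : E3 →L[ℝ] ℝ).contDiff.comp hvs
  have dw : ∀ i : Fin 3, Differentiable ℝ (fun q : E3 × ℝ => v q.1 (σ q.2) i) :=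
    fun i => (hw i).differentiable (by simp)
  have hsl : ∀ t, ContDiff ℝ ∞ (fun y => v y (σ t)) := fun t =>
    hvs.comp (by fun_prop : ContDiff ℝ ∞ (fun y : E3 => (y, t)))
  have hcomp : ∀ (t : ℝ) (x e : E3) (i : Fin 3),
      fderiv ℝ (fun y => v y (σ t) i) x e = (fderiv ℝ (fun y => v y (σ t)) x e) i := by
    intro t x e i
    have := ((EuclideanSpace.proj i : E3 →L[ℝ] ℝ).hasFDerivAt.comp x
      ((hsl t).differentiable (by simp) x).hasFDerivAt).fderiv
    rw [show (fun y => v y (σ t) i) = (EuclideanSpace.proj i : E3 →L[ℝ] ℝ) ∘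
      (fun y => v y (σ t)) from rfl, this]
    simp
  refine ⟨fun i q => v q.1 (σ q.2) i, fun q => p q.1 (σ q.2), ⟨hw, hps, ?_, ?_, ?_, ?_, ?_⟩, ?_⟩
  · intro i x t ht
    have hσt : σ t = t := hσi t ⟨ht.1.le, ht.2.le⟩
    have htT : t ∈ Ioo (-T) 0 := ⟨ha.trans ht.1, ht.2.trans hb⟩
    have hm := hv.momentum x t htT
    have hmi := congrArg (fun u : E3 => u i) hm
    simp only [PiLp.sub_apply, PiLp.zero_apply] at hmi
    have hslt := hsl t
    rw [hσt] at hslt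
    rw [laplacian_component hslt, gradient_component] at hmi
    have e1 : ∀ j, dd (sd j) (dd (sd j) (fun q : E3 × ℝ => v q.1 (σ q.2) i)) (x, t) =
        fderiv ℝ (fun y => fderiv ℝ (fun z => v z t i) y
          (EuclideanSpace.single j 1)) x (EuclideanSpace.single j 1) := by
      intro j
      unfold sd
      rw [dd_slice ((smooth_dd _ (hw i)).differentiable (by simp))]
      simp only [dd_slice (dw i), hσt]
    have e2 : dd (sd i) (fun q : E3 × ℝ => p q.1 (σ q.2)) (x, t) =
        fderiv ℝ (fun y => p y t) x (EuclideanSpace.single i 1) := by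
      unfold sd
      rw [dd_slice (hps.differentiable (by simp))]
      simp only [hσt]
    have e3 : dd td (fun q : E3 × ℝ => v q.1 (σ q.2) i) (x, t) =
        (deriv (fun s => v x s) t) i := by
      unfold td
      rw [dd_time (dw i)]
      -- The open interval is needed here: the time derivative requires `σ` to be the identity on a
      -- neighbourhood of `t`.
      have hev : (fun s => v x (σ s)) =ᶠ[𝓝 t] fun s => v x s := by
        filter_upwards [Ioo_mem_nhds ht.1 ht.2] with s hs
        rw [hσi s ⟨hs.1.le, hs.2.le⟩]
      rw [← hev.deriv_eq]
      have hd : DifferentiableAt ℝ (fun s => v x (σ s)) t :=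
        (hvs.comp (by fun_prop : ContDiff ℝ ∞ (fun s : ℝ => (x, s)))).differentiable (by simp) t
      exact ((EuclideanSpace.proj i : E3 →L[ℝ] ℝ).hasFDerivAt.comp_hasDerivAt t
        hd.hasDerivAt).deriv
    have e4 : ∑ j, v x (σ t) j * dd (sd j) (fun q : E3 × ℝ => v q.1 (σ q.2) i) (x, t) =
        (fderiv ℝ (fun y => v y t) x (v x t)) i := by
      have hc := hcomp t x (v x t) i
      rw [hσt] at hc
      rw [← hc]
      have hdec : v x t = ∑ j, (v x t j) • (EuclideanSpace.single j (1 : ℝ) : E3) := by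
        ext l
        simp [Pi.single_apply]
      conv_rhs => rw [hdec]
      rw [map_sum]
      refine Finset.sum_congr rfl fun j _ => ?_
      unfold sd
      rw [dd_slice (dw i), map_smul, smul_eq_mul]
      simp only [hσt]
    simp only [e1, e2, e3]
    rw [e4]
    exact hmi
  · intro x t
    have := hv.incompressible x (σ t) (hσm t)
    unfold div3 pd at this
    rw [← this]
    refine Finset.sum_congr rfl fun i _ => ?_
    unfold sd
    rw [dd_slice (dw i), ← hcomp]
  · intro x y t hr hz
    by_cases hx : rad x = 0
    · have h0 := rad_eq_zero_iff.1 hx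
      have h1 := rad_eq_zero_iff.1 (hr ▸ hx)
      simp [h0.1, h0.2, h1.1, h1.2]
    · have h := (hax (σ t) (hσm t) x y hr hz).1
      have e1 := compR_mul_rad (fun x => v x (σ t)) x hx
      have e2 := compR_mul_rad (fun x => v x (σ t)) y (hr ▸ hx)
      simp only at e1 e2 ⊢
      rw [← e1, ← e2, h, hr]
  · intro x y t hr hz
    have h := (hax (σ t) (hσm t) x y hr hz).2.1
    have e1 := rad_mul_compTheta (fun x => v x (σ t)) x
    have e2 := rad_mul_compTheta (fun x => v x (σ t)) y
    simp only at e1 e2 ⊢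
    rw [← e1, ← e2, h, hr]
  · intro x y t hr hz
    exact (hax (σ t) (hσm t) x y hr hz).2.2
  · intro i x t ht
    simp only [hσi t ht]

/-! ### The equation for the angular vorticity and for its quotient by `r`. -/

/-- The vorticity equation of the meridional system, cleared of denominators. -/
theorem meridional_vorticity_eq {U Z Θ P : (ℝ × ℝ) × ℝ → ℝ} (hU : ContDiff ℝ ∞ U)
    (hZ : ContDiff ℝ ∞ Z) (hΘ : ContDiff ℝ ∞ Θ) (hP : ContDiff ℝ ∞ P)
    {O : Set ((ℝ × ℝ) × ℝ)} (hO : IsOpen O)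
    (h1 : ∀ q ∈ O, q.1.1 ^ 2 * (dd et U q + U q * dd er U q + Z q * dd ez U q + dd er P q
      - dd er (dd er U) q - dd ez (dd ez U) q) - q.1.1 * Θ q ^ 2 - q.1.1 * dd er U q + U q = 0)
    (h2 : ∀ q ∈ O, q.1.1 * (dd et Z q + U q * dd er Z q + Z q * dd ez Z q + dd ez P q
      - dd er (dd er Z) q - dd ez (dd ez Z) q) - dd er Z q = 0)
    (h3 : ∀ q ∈ O, q.1.1 * dd er U q + U q + q.1.1 * dd ez Z q = 0)
    {w : (ℝ × ℝ) × ℝ → ℝ} (hw : w = fun q => dd ez U q - dd er Z q) :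
    ∀ q ∈ O, q.1.1 ^ 2 * (dd et w q + U q * dd er w q + Z q * dd ez w q
      - dd er (dd er w) q - dd ez (dd ez w) q) - q.1.1 * U q * w q
      - 2 * q.1.1 * Θ q * dd ez Θ q - q.1.1 * dd er w q + w q = 0 := by
  intro q hq
  have ev : ∀ F : (ℝ × ℝ) × ℝ → ℝ, (∀ q ∈ O, F q = 0) → ∀ e, dd e F q = 0 := by
    intro F hF e
    rw [dd_congr (g := fun _ => 0) e, dd_const]
    filter_upwards [hO.mem_nhds hq] with p hp using hF p hp
  have d : ∀ f : (ℝ × ℝ) × ℝ → ℝ, ContDiff ℝ ∞ f → Differentiable ℝ f :=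
    fun f hf => hf.differentiable (by simp)
  have s := @smooth_dd ((ℝ × ℝ) × ℝ) _ _
  have dU := d _ hU
  have dZ := d _ hZ
  have dΘ := d _ hΘ
  have dUe := fun e => d _ (s e hU)
  have dZe := fun e => d _ (s e hZ)
  have dPe := fun e => d _ (s e hP)
  have dUee := fun e e' => d _ (s e (s e' hU))
  have dZee := fun e e' => d _ (s e (s e' hZ))
  have le2 : (2 : WithTop ℕ∞) ≤ ∞ := WithTop.coe_le_coe.2 le_top
  have cm : ∀ f : (ℝ × ℝ) × ℝ → ℝ, ContDiff ℝ ∞ f → ∀ e e', dd e (dd e' f) = dd e' (dd e f) :=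
    fun f hf e e' => funext fun x => dd_comm (hf.of_le le2) e e' x
  -- Cross-differentiation of the two momentum equations eliminates the pressure; the identities
  -- hold on an open set, so they may be differentiated.
  have z1 := ev _ h1 ez
  have z2 := ev _ h2 er
  simp (disch := fun_prop) only [dd_add, dd_sub, dd_mul, dd_pow, dd_radius] at z1 z2
  have wd : ∀ e, dd e w = fun q => dd e (dd ez U) q - dd e (dd er Z) q := by
    intro e; rw [hw]; funext x; exact dd_sub e (dUe ez x) (dZe er x)
  have wdd : ∀ e, dd e (dd e w) q = dd e (dd e (dd ez U)) q - dd e (dd e (dd er Z)) q := by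
    intro e; rw [wd e]; exact dd_sub e (dUee e ez q) (dZee e er q)
  have y2 := h2 q hq
  have y3 := h3 q hq
  rw [wdd, wdd, wd, wd, wd, hw]
  have c1 : dd ez (dd et U) q = dd et (dd ez U) q := by rw [cm U hU ez et]
  have c2 : dd ez (dd er U) q = dd er (dd ez U) q := by rw [cm U hU ez er]
  have c3 : dd ez (dd er P) q = dd er (dd ez P) q := by rw [cm P hP ez er]
  have c4 : dd ez (dd er (dd er U)) q = dd er (dd er (dd ez U)) q := by
    rw [cm (dd er U) (s er hU) ez er, cm U hU ez er]
  have c5 : dd er (dd et Z) q = dd et (dd er Z) q := by rw [cm Z hZ er et]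
  have c6 : dd er (dd ez Z) q = dd ez (dd er Z) q := by rw [cm Z hZ er ez]
  have c7 : dd er (dd ez (dd ez Z)) q = dd ez (dd ez (dd er Z)) q := by
    rw [cm (dd ez Z) (s ez hZ) er ez, cm Z hZ er ez]
  rw [c1, c2, c3, c4] at z1
  rw [c5, c6, c7] at z2
  have ar : er.1.1 = 1 := rfl
  have az : ez.1.1 = 0 := rfl
  rw [az] at z1
  rw [ar] at z2
  push_cast at z1
  -- The term `y2` compensates for the radial derivative falling on the factor `r` of the vertical
  -- equation. The divergence equation `y3` turns `w (∂_r U + ∂_z Z)` into `-U w / r`.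
  linear_combination z1 - q.1.1 * z2 + y2 - q.1.1 * (dd ez U q - dd er Z q) * y3

/-- A globally smooth function which agrees with `1 / s` for `s ≥ 1/4`. -/
theorem exists_smooth_inv : ∃ ι : ℝ → ℝ, ContDiff ℝ ∞ ι ∧ ∀ s, 1 / 4 ≤ s → ι s = 1 / s := by
  refine ⟨fun s => s / (s ^ 2 + (1 - Real.smoothTransition (8 * s - 1))), ?_, ?_⟩
  · have h1 : ContDiff ℝ ∞ (fun s : ℝ => Real.smoothTransition (8 * s - 1)) :=
      Real.smoothTransition.contDiff.comp (by fun_prop)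
    refine ContDiff.div (by fun_prop) (by fun_prop) (fun s => ?_)
    have h2 := Real.smoothTransition.le_one (8 * s - 1)
    rcases eq_or_ne s 0 with rfl | hs
    · rw [Real.smoothTransition.zero_of_nonpos (by norm_num)]; norm_num
    · have : 0 < s ^ 2 := by positivity
      have : 0 < s ^ 2 + (1 - Real.smoothTransition (8 * s - 1)) := by linarith
      exact this.ne'
  · intro s hs
    simp only []
    rw [Real.smoothTransition.one_of_one_le (by linarith), sub_self, add_zero]
    have : s ≠ 0 := by linarith
    field_simp

/-- The equation for `Ω = w / r` deduced from the one for the vorticity `w`. -/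
theorem reduced_vorticity_eq {U Z Θ w Ω : (ℝ × ℝ) × ℝ → ℝ} {ι : ℝ → ℝ} (hΘ : ContDiff ℝ ∞ Θ)
    (hw : ContDiff ℝ ∞ w) (hι : ContDiff ℝ ∞ ι) (hι' : ∀ s, 1 / 4 ≤ s → ι s = 1 / s)
    (hΩ : Ω = fun q => w q * ι q.1.1) {q : (ℝ × ℝ) × ℝ} (hq : 1 / 4 < q.1.1)
    (h : q.1.1 ^ 2 * (dd et w q + U q * dd er w q + Z q * dd ez w q
      - dd er (dd er w) q - dd ez (dd ez w) q) - q.1.1 * U q * w q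
      - 2 * q.1.1 * Θ q * dd ez Θ q - q.1.1 * dd er w q + w q = 0) :
    dd et Ω q + U q * dd er Ω q + Z q * dd ez Ω q =
      dd er (dd er Ω) q + 3 / q.1.1 * dd er Ω q + dd ez (dd ez Ω) q
        + dd ez (fun p => Θ p ^ 2 * ι p.1.1 ^ 2) q := by
  have sr : ContDiff ℝ ∞ (fun p : (ℝ × ℝ) × ℝ => ι p.1.1) := hι.comp (by fun_prop)
  have sΩ : ContDiff ℝ ∞ Ω := by rw [hΩ]; exact hw.mul sr
  have dΩ := sΩ.differentiable (by simp)
  have dΩe := fun e => (smooth_dd e sΩ).differentiable (by simp)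
  have dΘ := hΘ.differentiable (by simp)
  have dr := sr.differentiable (by simp)
  have hopen : IsOpen {p : (ℝ × ℝ) × ℝ | 1 / 4 < p.1.1} :=
    isOpen_lt continuous_const (by fun_prop)
  have hr0 : q.1.1 ≠ 0 := by linarith
  have ewΩ : ∀ p : (ℝ × ℝ) × ℝ, 1 / 4 < p.1.1 → w p = p.1.1 * Ω p := by
    intro p hp
    rw [hΩ]
    simp only [hι' _ hp.le]
    have : p.1.1 ≠ 0 := by linarith
    field_simp
  have e1 : ∀ e : (ℝ × ℝ) × ℝ, ∀ p : (ℝ × ℝ) × ℝ, 1 / 4 < p.1.1 →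
      dd e w p = e.1.1 * Ω p + p.1.1 * dd e Ω p := by
    intro e p hp
    rw [dd_congr (g := fun p => p.1.1 * Ω p) e, dd_mul e (by fun_prop) (dΩ p), dd_radius]
    filter_upwards [hopen.mem_nhds hp] with y hy using ewΩ y hy
  have e2 : ∀ e : (ℝ × ℝ) × ℝ, dd e (dd e w) q =
      2 * e.1.1 * dd e Ω q + q.1.1 * dd e (dd e Ω) q := by
    intro e
    rw [dd_congr (g := fun p => e.1.1 * Ω p + p.1.1 * dd e Ω p) e,
      dd_add e ((dΩ q).const_mul _) ((by fun_prop : DifferentiableAt ℝ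
        (fun p : (ℝ × ℝ) × ℝ => p.1.1) q).fun_mul (dΩe e q)), dd_const_mul e _ (dΩ q), dd_mul e (by fun_prop) (dΩe e q), dd_radius]
    · ring
    · filter_upwards [hopen.mem_nhds hq] with y hy using e1 e y hy
  have eι : dd ez (fun p : (ℝ × ℝ) × ℝ => ι p.1.1) q = 0 := by
    rw [dd_comp (F := ι) (f := fun p : (ℝ × ℝ) × ℝ => p.1.1) ez
      (hι.differentiable (by simp) _).hasDerivAt (by fun_prop), dd_radius]
    simp [ez]
  have eQ : dd ez (fun p => Θ p ^ 2 * ι p.1.1 ^ 2) q = 2 * Θ q * dd ez Θ q / q.1.1 ^ 2 := by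
    rw [dd_mul ez ((dΘ q).fun_pow 2) ((dr q).fun_pow 2), dd_pow ez 2 (dΘ q),
      dd_pow ez 2 (dr q), eι, hι' _ hq.le]
    field_simp
    push_cast
    ring
  rw [e2, e2, e1 et q hq, e1 er q hq, e1 ez q hq, ewΩ q hq] at h
  have ar : er.1.1 = 1 := rfl
  have az : ez.1.1 = 0 := rfl
  have at' : et.1.1 = 0 := rfl
  rw [ar, az, at'] at h
  rw [eQ]
  field_simp
  have h' : q.1.1 * (q.1.1 ^ 2 * (dd et Ω q + U q * dd er Ω q + Z q * dd ez Ω q)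
      - (q.1.1 * (q.1.1 * dd er (dd er Ω) q + 3 * dd er Ω q + q.1.1 * dd ez (dd ez Ω) q)
        + 2 * Θ q * dd ez Θ q)) = 0 := by
    linear_combination h
  have := (mul_eq_zero.1 h').resolve_left hr0
  linarith

/-! ### Axial symmetry expressed through angular derivatives. -/

/-- Functions of `(r, z)` have vanishing angular derivative. -/
theorem angular_dd_eq_zero {f : E3 × ℝ → ℝ} (hf : Differentiable ℝ f)
    (h : ∀ (x y : E3) (t : ℝ), rad x = rad y → x 2 = y 2 → f (x, t) = f (y, t)) (x : E3) (t : ℝ) :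
    x 0 * dd (sd 1) f (x, t) - x 1 * dd (sd 0) f (x, t) = 0 := by
  let c : ℝ → E3 × ℝ := fun θ =>
    (x 0 * Real.cos θ - x 1 * Real.sin θ) • sd 0 + (x 0 * Real.sin θ + x 1 * Real.cos θ) • sd 1
      + (x 2 • sd 2 + t • td)
  have hc : HasDerivAt c ((-(x 1)) • sd 0 + x 0 • sd 1) 0 := by
    have a1 : HasDerivAt (fun θ => x 0 * Real.cos θ - x 1 * Real.sin θ) (-(x 1)) 0 := by
      have := ((Real.hasDerivAt_cos 0).const_mul (x 0)).fun_sub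
        ((Real.hasDerivAt_sin 0).const_mul (x 1))
      simpa using this
    have a2 : HasDerivAt (fun θ => x 0 * Real.sin θ + x 1 * Real.cos θ) (x 0) 0 := by
      have := ((Real.hasDerivAt_sin 0).const_mul (x 0)).fun_add
        ((Real.hasDerivAt_cos 0).const_mul (x 1))
      simpa using this
    exact ((a1.smul_const (sd 0)).add (a2.smul_const (sd 1))).add_const _
  have c0 : c 0 = (x, t) := by
    ext i
    · fin_cases i <;> simp [c, sd, td]
    · simp [c, sd, td]
  have hconst : ∀ θ, f (c θ) = f (x, t) := by
    intro θ
    have e : c θ = ((c θ).1, t) := by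
      ext i
      · rfl
      · simp [c, sd, td]
    rw [e]
    apply h
    · have a0 : (c θ).1 0 = x 0 * Real.cos θ - x 1 * Real.sin θ := by simp [c, sd, td]
      have a1 : (c θ).1 1 = x 0 * Real.sin θ + x 1 * Real.cos θ := by simp [c, sd, td]
      unfold rad
      rw [a0, a1]
      congr 1
      linear_combination (x 0 ^ 2 + x 1 ^ 2) * Real.sin_sq_add_cos_sq θ
    · simp [c, sd, td]
  have h1 := hasDerivAt_dd (f := f) (hf _) hc
  simp only [hconst] at h1
  rw [c0] at h1
  have h2 := h1.unique (hasDerivAt_const 0 (f (x, t)))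
  rw [dd_add_dir, dd_smul_dir, dd_smul_dir] at h2
  linarith

theorem dd_coord (e : E3 × ℝ) (i : Fin 3) (q : E3 × ℝ) :
    dd e (fun p : E3 × ℝ => p.1 i) q = e.1 i :=
  dd_clm e ((EuclideanSpace.proj i : E3 →L[ℝ] ℝ).comp (ContinuousLinearMap.fst ℝ E3 ℝ)) q

theorem smooth_coord (i : Fin 3) : ContDiff ℝ ∞ (fun p : E3 × ℝ => p.1 i) :=
  ((EuclideanSpace.proj i : E3 →L[ℝ] ℝ).comp (ContinuousLinearMap.fst ℝ E3 ℝ)).contDiff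

/-- The swirl `Γ = x₀ w₁ - x₁ w₀`. -/
def swirl (w : Fin 3 → E3 × ℝ → ℝ) (q : E3 × ℝ) : ℝ := q.1 0 * w 1 q - q.1 1 * w 0 q

theorem smooth_swirl {I : Set ℝ} {w : Fin 3 → E3 × ℝ → ℝ} {π : E3 × ℝ → ℝ}
    (F : SmoothFlow I w π) : ContDiff ℝ ∞ (swirl w) :=
  ((smooth_coord 0).mul (F.smooth_w 1)).sub ((smooth_coord 1).mul (F.smooth_w 0))

theorem swirl_angular {I : Set ℝ} {w : Fin 3 → E3 × ℝ → ℝ} {π : E3 × ℝ → ℝ}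
    (F : SmoothFlow I w π) (x : E3) (t : ℝ) :
    x 0 * dd (sd 1) (swirl w) (x, t) - x 1 * dd (sd 0) (swirl w) (x, t) = 0 :=
  angular_dd_eq_zero ((smooth_swirl F).differentiable (by simp)) F.swirl_eq x t

theorem dd_swirl {I : Set ℝ} {w : Fin 3 → E3 × ℝ → ℝ} {π : E3 × ℝ → ℝ}
    (F : SmoothFlow I w π) (e q : E3 × ℝ) :
    dd e (swirl w) q = e.1 0 * w 1 q + q.1 0 * dd e (w 1) q - e.1 1 * w 0 q
      - q.1 1 * dd e (w 0) q := by
  have d0 := (F.smooth_w 0).differentiable (by simp) q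
  have d1 := (F.smooth_w 1).differentiable (by simp) q
  have x0 := (smooth_coord 0).differentiable (by simp) q
  have x1 := (smooth_coord 1).differentiable (by simp) q
  unfold swirl
  rw [dd_sub e (x0.fun_mul d1) (x1.fun_mul d0), dd_mul e x0 d1, dd_mul e x1 d0, dd_coord, dd_coord]
  ring

/-- The rotational derivative acts on the horizontal velocity as an infinitesimal rotation. -/
theorem angular_velocity {I : Set ℝ} {w : Fin 3 → E3 × ℝ → ℝ} {π : E3 × ℝ → ℝ}
    (F : SmoothFlow I w π) {x : E3} (hx : rad x ≠ 0) (t : ℝ) :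
    x 0 * dd (sd 1) (w 0) (x, t) - x 1 * dd (sd 0) (w 0) (x, t) = - w 1 (x, t) ∧
    x 0 * dd (sd 1) (w 1) (x, t) - x 1 * dd (sd 0) (w 1) (x, t) = w 0 (x, t) := by
  have hr : 0 < x 0 ^ 2 + x 1 ^ 2 := by
    have h := Real.sqrt_ne_zero'.1 hx
    exact h
  have d0 := (F.smooth_w 0).differentiable (by simp)
  have d1 := (F.smooth_w 1).differentiable (by simp)
  have x0 := (smooth_coord 0).differentiable (by simp)
  have x1 := (smooth_coord 1).differentiable (by simp)
  have hS := angular_dd_eq_zero (f := fun q => q.1 0 * w 0 q + q.1 1 * w 1 q)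
    ((x0.mul d0).add (x1.mul d1)) F.radial_eq x t
  have hG := swirl_angular F x t
  have eS : ∀ e q, dd e (fun q => q.1 0 * w 0 q + q.1 1 * w 1 q) q =
      e.1 0 * w 0 q + q.1 0 * dd e (w 0) q + (e.1 1 * w 1 q + q.1 1 * dd e (w 1) q) := by
    intro e q
    rw [dd_add e ((x0 q).fun_mul (d0 q)) ((x1 q).fun_mul (d1 q)), dd_mul e (x0 q) (d0 q),
      dd_mul e (x1 q) (d1 q), dd_coord, dd_coord]
  rw [eS, eS] at hS
  rw [dd_swirl F, dd_swirl F] at hG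
  have a00 : (sd 0).1 0 = 1 := by simp [sd]
  have a01 : (sd 0).1 1 = 0 := by simp [sd]
  have a10 : (sd 1).1 0 = 0 := by simp [sd]
  have a11 : (sd 1).1 1 = 1 := by simp [sd]
  simp only [a00, a01, a10, a11] at hS hG
  constructor
  -- Symmetry of `r v_r` and of `r v_θ` gives two linear equations for the angular derivatives of `w
  -- 0` and `w 1`; the determinant is `x₀² + x₁²`.
  · apply mul_left_cancel₀ hr.ne'
    linear_combination x 0 * hS - x 1 * hG
  · apply mul_left_cancel₀ hr.ne'
    linear_combination x 1 * hS + x 0 * hG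

/-- Second angular derivatives on the half-plane `x₁ = 0`. -/
theorem second_angular_velocity {I : Set ℝ} {w : Fin 3 → E3 × ℝ → ℝ} {π : E3 × ℝ → ℝ}
    (F : SmoothFlow I w π) {x : E3} (hx : rad x ≠ 0) (h1 : x 1 = 0) (t : ℝ) :
    x 0 * dd (sd 1) (dd (sd 1) (w 0)) (x, t) - dd (sd 0) (w 0) (x, t)
      + dd (sd 1) (w 1) (x, t) = 0 ∧
    x 0 * dd (sd 1) (dd (sd 1) (w 2)) (x, t) - dd (sd 0) (w 2) (x, t) = 0 := by
  have X := fun i => (smooth_coord i).differentiable (by simp) (x, t)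
  have hd : ∀ j i, DifferentiableAt ℝ (dd (sd j) (w i)) (x, t) :=
    fun j i => (smooth_dd (sd j) (F.smooth_w i)).differentiable (by simp) _
  have a10 : (sd 1).1 0 = 0 := by simp [sd]
  have a11 : (sd 1).1 1 = 1 := by simp [sd]
  -- Differentiating the first-order angular identity once more in the direction `x₁` and evaluating
  -- at `x₁ = 0` yields the second angular derivative, up to the contribution of the right-hand
  -- side.
  have ex : ∀ i, dd (sd 1) (fun q => q.1 0 * dd (sd 1) (w i) q - q.1 1 * dd (sd 0) (w i) q) (x, t)
      = x 0 * dd (sd 1) (dd (sd 1) (w i)) (x, t) - dd (sd 0) (w i) (x, t) := by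
    intro i
    rw [dd_sub _ ((X 0).fun_mul (hd 1 i)) ((X 1).fun_mul (hd 0 i)), dd_mul _ (X 0) (hd 1 i),
      dd_mul _ (X 1) (hd 0 i), dd_coord, dd_coord, a10, a11]
    simp [h1]
  constructor
  · rw [← ex 0, ← dd_add _ (((X 0).fun_mul (hd 1 0)).fun_sub ((X 1).fun_mul (hd 0 0)))
      ((F.smooth_w 1).differentiable (by simp) _), dd_congr (g := fun _ => 0), dd_const]
    have ho : IsOpen {q : E3 × ℝ | rad q.1 ≠ 0} := by
      have : Continuous (fun q : E3 × ℝ => rad q.1) := by unfold rad; fun_prop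
      exact isOpen_ne_fun this continuous_const
    filter_upwards [ho.mem_nhds hx] with q hq
    have := (angular_velocity F hq q.2).1
    simp only [Prod.mk.eta] at this
    rw [this]; ring
  · rw [← ex 2, dd_congr (g := fun _ => 0), dd_const]
    exact Eventually.of_forall fun q => angular_dd_eq_zero
      ((F.smooth_w 2).differentiable (by simp)) F.vertical_eq q.1 q.2

/-! ### Parabolic rescaling onto the half-plane. -/

/-- The parabolic dilation which maps `(r, z, t)`-space to the half-plane `x₁ = 0` in space-time. -/
def dil (l z₀ t₀ : ℝ) (q : (ℝ × ℝ) × ℝ) : E3 × ℝ :=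
  q.1.1 • (l • sd 0) + q.1.2 • (l • sd 2) + q.2 • (l ^ 2 • td) + (z₀ • sd 2 + t₀ • td)

theorem dil_eq (l z₀ t₀ : ℝ) (q : (ℝ × ℝ) × ℝ) :
    dil l z₀ t₀ q = (!₂[l * q.1.1, 0, z₀ + l * q.1.2], t₀ + l ^ 2 * q.2) := by
  ext i
  · fin_cases i <;> simp [dil, sd, td] <;> ring
  · simp [dil, sd, td]; ring

theorem contDiff_dil (l z₀ t₀ : ℝ) : ContDiff ℝ ∞ (dil l z₀ t₀) := by
  unfold dil; fun_prop

theorem dd_dil {f : E3 × ℝ → ℝ} (hf : Differentiable ℝ f) (l z₀ t₀ c : ℝ) :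
    (dd er (fun q => c * f (dil l z₀ t₀ q)) = fun q => (c * l) * dd (sd 0) f (dil l z₀ t₀ q)) ∧
    (dd ez (fun q => c * f (dil l z₀ t₀ q)) = fun q => (c * l) * dd (sd 2) f (dil l z₀ t₀ q)) ∧
    (dd et (fun q => c * f (dil l z₀ t₀ q)) = fun q => (c * l ^ 2) * dd td f (dil l z₀ t₀ q)) := by
  let p1 : ((ℝ × ℝ) × ℝ) →L[ℝ] ℝ :=
    (ContinuousLinearMap.fst ℝ ℝ ℝ).comp (ContinuousLinearMap.fst ℝ (ℝ × ℝ) ℝ)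
  let p2 : ((ℝ × ℝ) × ℝ) →L[ℝ] ℝ :=
    (ContinuousLinearMap.snd ℝ ℝ ℝ).comp (ContinuousLinearMap.fst ℝ (ℝ × ℝ) ℝ)
  let p3 : ((ℝ × ℝ) × ℝ) →L[ℝ] ℝ := ContinuousLinearMap.snd ℝ (ℝ × ℝ) ℝ
  let L : ((ℝ × ℝ) × ℝ) →L[ℝ] (E3 × ℝ) :=
    p1.smulRight (l • sd 0) + p2.smulRight (l • sd 2) + p3.smulRight (l ^ 2 • td)
  have hA : ∀ q, HasFDerivAt (dil l z₀ t₀) L q := fun q =>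
    L.hasFDerivAt.add_const (z₀ • sd 2 + t₀ • td)
  have dA : ∀ q, DifferentiableAt ℝ (fun q => f (dil l z₀ t₀ q)) q := fun q =>
    (hf _).comp q (hA q).differentiableAt
  have key : ∀ e q, dd e (fun q => c * f (dil l z₀ t₀ q)) q = c * dd (L e) f (dil l z₀ t₀ q) := by
    intro e q
    rw [dd_const_mul e c (dA q), dd_comp_map (f := f) e (hf _) (hA q)]
  have Lr : L er = l • sd 0 := by simp [L, p1, p2, p3, er]
  have Lz : L ez = l • sd 2 := by simp [L, p1, p2, p3, ez]
  have Lt : L et = l ^ 2 • td := by simp [L, p1, p2, p3, et]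
  refine ⟨?_, ?_, ?_⟩ <;> funext q <;> rw [key]
  · rw [Lr, dd_smul_dir]; ring
  · rw [Lz, dd_smul_dir]; ring
  · rw [Lt, dd_smul_dir]; ring

theorem rad_of_snd_eq_zero {x : E3} (h1 : x 1 = 0) (h0 : 0 ≤ x 0) : rad x = x 0 := by
  unfold rad; rw [h1]; simp [Real.sqrt_sq h0]

/-- The rescaled velocity component `λ wᵢ` on the half-plane. -/
def scaled (l z₀ t₀ : ℝ) (f : E3 × ℝ → ℝ) (q : (ℝ × ℝ) × ℝ) : ℝ := l * f (dil l z₀ t₀ q)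

theorem smooth_scaled (l z₀ t₀ : ℝ) {f : E3 × ℝ → ℝ} (hf : ContDiff ℝ ∞ f) :
    ContDiff ℝ ∞ (scaled l z₀ t₀ f) :=
  contDiff_const.mul (hf.comp (contDiff_dil l z₀ t₀))

/-- The rescaled vorticity on the half-plane. -/
def scaledVort (l z₀ t₀ : ℝ) (w : Fin 3 → E3 × ℝ → ℝ) (q : (ℝ × ℝ) × ℝ) : ℝ :=
  dd ez (scaled l z₀ t₀ (w 0)) q - dd er (scaled l z₀ t₀ (w 2)) q

/-- A smooth axially symmetric flow gives, after rescaling, a drift-diffusion problem. -/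
theorem localData_of_smoothFlow {a b : ℝ} {w : Fin 3 → E3 × ℝ → ℝ} {π : E3 × ℝ → ℝ}
    (F : SmoothFlow (Ioo a b) w π) {l z₀ t₀ M K : ℝ} (hl : 0 < l) (ha : a < t₀ - l ^ 2)
    (hb : t₀ < b) (hK : 1 ≤ K) (hsw : ∀ x, ∀ t ∈ Ioo a b, |swirl w (x, t)| ≤ M)
    (hen : ∀ t ∈ Icc (-1 : ℝ) 0, ∫ x in box, (scaled l z₀ t₀ (w 0) (x, t) ^ 2
      + scaled l z₀ t₀ (w 2) (x, t) ^ 2) ≤ K ^ 2)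
    {ι : ℝ → ℝ} (hι : ContDiff ℝ ∞ ι) (hι' : ∀ s, 1 / 4 ≤ s → ι s = 1 / s) :
    LocalData (16 * M ^ 2) K (scaled l z₀ t₀ (w 0)) (scaled l z₀ t₀ (w 2))
      (fun q => scaled l z₀ t₀ (w 1) q ^ 2 * ι q.1.1 ^ 2)
      (fun q => scaledVort l z₀ t₀ w q * ι q.1.1) := by
  have d : ∀ i, Differentiable ℝ (w i) := fun i => (F.smooth_w i).differentiable (by simp)
  have de : ∀ e i, Differentiable ℝ (dd e (w i)) :=
    fun e i => (smooth_dd e (F.smooth_w i)).differentiable (by simp)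
  have sU := fun i => smooth_scaled l z₀ t₀ (F.smooth_w i)
  have sr : ContDiff ℝ ∞ (fun p : (ℝ × ℝ) × ℝ => ι p.1.1) := hι.comp (by fun_prop)
  have sV : ContDiff ℝ ∞ (scaledVort l z₀ t₀ w) :=
    (smooth_dd ez (sU 0)).sub (smooth_dd er (sU 2))
  -- Only the restriction of the pressure to the half-plane and its two derivatives there enter, so
  -- no symmetry of the pressure is required.
  have sP : ContDiff ℝ ∞ (fun q => l ^ 2 * π (dil l z₀ t₀ q)) :=
    contDiff_const.mul (F.smooth_π.comp (contDiff_dil l z₀ t₀))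
  -- An open neighbourhood of the box and the closed time interval, still away from the axis. It
  -- allows the meridional equations to be differentiated at all points of interest, and `ι` is the
  -- reciprocal on it.
  set O : Set ((ℝ × ℝ) × ℝ) := {q | 1 / 4 < q.1.1 ∧ t₀ + l ^ 2 * q.2 ∈ Ioo a b} with hOdef
  have hO : IsOpen O := by
    have h1 : IsOpen {q : (ℝ × ℝ) × ℝ | 1 / 4 < q.1.1} :=
      isOpen_lt continuous_const (by fun_prop)
    exact h1.inter <| isOpen_Ioo.preimage (by fun_prop : Continuous fun q : (ℝ × ℝ) × ℝ => t₀ + l ^ 2 * q.2)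
  have u1 : ∀ i, (dd er (scaled l z₀ t₀ (w i)) =
        fun q => (l * l) * dd (sd 0) (w i) (dil l z₀ t₀ q)) ∧
      (dd ez (scaled l z₀ t₀ (w i)) = fun q => (l * l) * dd (sd 2) (w i) (dil l z₀ t₀ q)) ∧
      (dd et (scaled l z₀ t₀ (w i)) = fun q => (l * l ^ 2) * dd td (w i) (dil l z₀ t₀ q)) :=
    fun i => dd_dil (d i) l z₀ t₀ l
  have u2 : ∀ i, (dd er (dd er (scaled l z₀ t₀ (w i))) =
        fun q => (l * l * l) * dd (sd 0) (dd (sd 0) (w i)) (dil l z₀ t₀ q)) ∧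
      (dd ez (dd ez (scaled l z₀ t₀ (w i))) =
        fun q => (l * l * l) * dd (sd 2) (dd (sd 2) (w i)) (dil l z₀ t₀ q)) := by
    intro i
    rw [(u1 i).1, (u1 i).2.1]
    exact ⟨(dd_dil (de (sd 0) i) l z₀ t₀ (l * l)).1, (dd_dil (de (sd 2) i) l z₀ t₀ (l * l)).2.1⟩
  have uP := dd_dil (F.smooth_π.differentiable (by simp)) l z₀ t₀ (l ^ 2)
  have pt : ∀ q ∈ O, ∃ (x : E3) (t : ℝ), dil l z₀ t₀ q = (x, t) ∧ x 0 = l * q.1.1 ∧ x 1 = 0 ∧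
      rad x ≠ 0 ∧ t ∈ Ioo a b := by
    intro q hq
    have hq1 : 0 < q.1.1 := by linarith [hq.1]
    refine ⟨_, _, dil_eq l z₀ t₀ q, by simp, by simp, ?_, hq.2⟩
    rw [rad_of_snd_eq_zero (by simp) (by simp; positivity)]
    simp; exact ⟨hl.ne', hq1.ne'⟩
  have g3 : ∀ q ∈ O, q.1.1 * dd er (scaled l z₀ t₀ (w 0)) q + scaled l z₀ t₀ (w 0) q
      + q.1.1 * dd ez (scaled l z₀ t₀ (w 2)) q = 0 := by
    intro q hq
    rw [(u1 0).1, (u1 2).2.1]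
    unfold scaled
    obtain ⟨x, t, e, h0, h1, hr, -⟩ := pt q hq
    simp only [e]
    have dv := F.div_eq x t
    have av := (angular_velocity F hr t).2
    rw [Fin.sum_univ_three] at dv
    rw [h1, h0] at av
    linear_combination (l * (l * q.1.1)) * dv - l * av
  have g1 : ∀ q ∈ O, q.1.1 ^ 2 * (dd et (scaled l z₀ t₀ (w 0)) q
      + scaled l z₀ t₀ (w 0) q * dd er (scaled l z₀ t₀ (w 0)) q
      + scaled l z₀ t₀ (w 2) q * dd ez (scaled l z₀ t₀ (w 0)) q
      + dd er (fun q => l ^ 2 * π (dil l z₀ t₀ q)) q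
      - dd er (dd er (scaled l z₀ t₀ (w 0))) q - dd ez (dd ez (scaled l z₀ t₀ (w 0))) q)
      - q.1.1 * scaled l z₀ t₀ (w 1) q ^ 2 - q.1.1 * dd er (scaled l z₀ t₀ (w 0)) q
      + scaled l z₀ t₀ (w 0) q = 0 := by
    intro q hq
    rw [(u2 0).1, (u2 0).2, (u1 0).1, (u1 0).2.1, (u1 0).2.2, uP.1]
    unfold scaled
    obtain ⟨x, t, e, h0, h1, hr, ht⟩ := pt q hq
    simp only [e]
    have mm := F.momentum 0 x t ht
    rw [Fin.sum_univ_three, Fin.sum_univ_three] at mm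
    have av := angular_velocity F hr t
    have sv := (second_angular_velocity F hr h1 t).1
    rw [h1, h0] at av
    rw [h0] at sv
    linear_combination (-(l * (l * q.1.1) ^ 2)) * mm - l * (l * q.1.1) * w 1 (x, t) * av.1
      + l * (l * q.1.1) * sv - l * av.2
  have g2 : ∀ q ∈ O, q.1.1 * (dd et (scaled l z₀ t₀ (w 2)) q
      + scaled l z₀ t₀ (w 0) q * dd er (scaled l z₀ t₀ (w 2)) q
      + scaled l z₀ t₀ (w 2) q * dd ez (scaled l z₀ t₀ (w 2)) q
      + dd ez (fun q => l ^ 2 * π (dil l z₀ t₀ q)) q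
      - dd er (dd er (scaled l z₀ t₀ (w 2))) q - dd ez (dd ez (scaled l z₀ t₀ (w 2))) q)
      - dd er (scaled l z₀ t₀ (w 2)) q = 0 := by
    intro q hq
    rw [(u2 2).1, (u2 2).2, (u1 2).1, (u1 2).2.1, (u1 2).2.2, uP.2.1]
    unfold scaled
    obtain ⟨x, t, e, h0, h1, hr, ht⟩ := pt q hq
    simp only [e]
    have mm := F.momentum 2 x t ht
    rw [Fin.sum_univ_three, Fin.sum_univ_three] at mm
    have av := angular_dd_eq_zero (d 2) F.vertical_eq x t
    have sv := (second_angular_velocity F hr h1 t).2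
    rw [h1, h0] at av
    rw [h0] at sv
    linear_combination (-(l ^ 2 * (l * q.1.1))) * mm - l ^ 2 * w 1 (x, t) * av + l ^ 2 * sv
  have hmem : ∀ x ∈ box, ∀ t ∈ Icc (-1 : ℝ) 0, (x, t) ∈ O := by
    intro x hx t ht
    have := half_le_of_mem_box hx
    refine ⟨by simp only; linarith, ?_, ?_⟩
    · have : l ^ 2 * (-1) ≤ l ^ 2 * t := by gcongr; exact ht.1
      simp only; linarith
    · have : l ^ 2 * t ≤ 0 := mul_nonpos_of_nonneg_of_nonpos (by positivity) ht.2
      simp only; linarith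
  have vq := meridional_vorticity_eq (sU 0) (sU 2) (sU 1) sP hO g1 g2 g3
    (w := scaledVort l z₀ t₀ w) rfl
  refine ⟨sU 0, sU 2, ((sU 1).pow 2).mul (sr.pow 2), sV.mul sr, hK, by positivity, ?_, ?_, ?_, hen⟩
  · exact fun x hx t ht => g3 _ (hmem x hx t ht)
  · intro x hx t ht
    exact reduced_vorticity_eq (sU 1) sV hι hι' rfl (hmem x hx t ht).1 (vq _ (hmem x hx t ht))
  · intro x hx t ht
    have hr := half_le_of_mem_box hx
    obtain ⟨y, s, e, h0, h1, -, hs⟩ := pt _ (hmem x hx t ht)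
    have hG := hsw y s hs
    -- The swirl is invariant under the dilation, so its bound `M` carries over without a power of
    -- `l`. The source is the squared swirl divided by `r⁴`, and `r ≥ 1/2` gives the factor `16`.
    have eG : swirl w (y, s) = x.1 * scaled l z₀ t₀ (w 1) (x, t) := by
      unfold swirl scaled
      rw [e]
      simp only [h0, h1]; ring
    rw [eG] at hG
    simp only
    rw [hι' _ (by linarith), abs_of_nonneg (by positivity)]
    have h2 : (x.1 * scaled l z₀ t₀ (w 1) (x, t)) ^ 2 ≤ M ^ 2 := by
      rw [← sq_abs]; gcongr
    have hx0 : 0 < x.1 := by linarith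
    have h3 : scaled l z₀ t₀ (w 1) (x, t) ^ 2 * (1 / x.1) ^ 2 =
        (x.1 * scaled l z₀ t₀ (w 1) (x, t)) ^ 2 / x.1 ^ 4 := by field_simp
    rw [h3, div_le_iff₀ (by positivity)]
    have h4 : (1 / 2 : ℝ) ^ 4 ≤ x.1 ^ 4 := by gcongr
    nlinarith [sq_nonneg M]

/-! ### A convex truncation with linear and quadratic upper bounds. -/

/-- A `C²` convex function which vanishes for `s ≤ 0` and is at most linear at infinity. -/
def hub (s : ℝ) : ℝ := max s 0 ^ 3 / (1 + max s 0) ^ 2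

/-- Derivative of `hub`. -/
def hub₁ (s : ℝ) : ℝ := max s 0 ^ 2 * (max s 0 + 3) / (1 + max s 0) ^ 3

/-- Second derivative of `hub`. -/
def hub₂ (s : ℝ) : ℝ := 6 * max s 0 / (1 + max s 0) ^ 4

/-- A quadratic bound gives derivative zero at the origin. It glues the zero branch of the
truncation and of its derivative to the rational branch. -/
theorem hasDerivAt_zero_of_abs_le {f : ℝ → ℝ} {C : ℝ} (h : ∀ s, |f s| ≤ C * s ^ 2) :
    HasDerivAt f 0 0 := by
  have f0 : f 0 = 0 := by simpa using h 0
  rw [hasDerivAt_iff_isLittleO_nhds_zero]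
  simp only [zero_add, f0, sub_zero, smul_zero]
  have h1 : f =O[𝓝 0] fun s : ℝ => s ^ 2 :=
    Asymptotics.IsBigO.of_bound C (Eventually.of_forall fun s => by
      rw [Real.norm_eq_abs, Real.norm_eq_abs, abs_of_nonneg (sq_nonneg s)]; exact h s)
  refine h1.trans_isLittleO ?_
  simpa using Asymptotics.isLittleO_pow_pow (𝕜 := ℝ) (show 1 < 2 by norm_num)

theorem hub_nonneg (s : ℝ) : 0 ≤ hub s := by unfold hub; positivity

theorem hub_le_max (s : ℝ) : hub s ≤ max s 0 := by
  unfold hub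
  have h : 0 ≤ max s 0 := le_max_right _ _
  rw [div_le_iff₀ (by positivity)]
  nlinarith [sq_nonneg (max s 0), pow_nonneg h 3]

theorem hub_le_sq (s : ℝ) : hub s ≤ max s 0 ^ 2 := by
  unfold hub
  have h : 0 ≤ max s 0 := le_max_right _ _
  rw [div_le_iff₀ (by positivity)]
  nlinarith [sq_nonneg (max s 0), pow_nonneg h 3, pow_nonneg h 4]

theorem hub_pos {s : ℝ} (hs : 0 < s) : 0 < hub s := by
  unfold hub; rw [max_eq_left hs.le]; positivity

theorem hub_of_nonpos {s : ℝ} (hs : s ≤ 0) : hub s = 0 := by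
  unfold hub; rw [max_eq_right hs]; simp

theorem hub₁_of_nonpos {s : ℝ} (hs : s ≤ 0) : hub₁ s = 0 := by
  unfold hub₁; rw [max_eq_right hs]; simp

theorem hub₂_of_nonpos {s : ℝ} (hs : s ≤ 0) : hub₂ s = 0 := by
  unfold hub₂; rw [max_eq_right hs]; simp

theorem hub₂_nonneg (s : ℝ) : 0 ≤ hub₂ s := by unfold hub₂; positivity

theorem continuous_hub₂ : Continuous hub₂ := by
  unfold hub₂
  refine Continuous.div (by fun_prop) (by fun_prop) (fun s => ?_)
  have : 0 ≤ max s 0 := le_max_right _ _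
  positivity

theorem max_sq_le (s : ℝ) : max s 0 ^ 2 ≤ s ^ 2 := by
  rcases le_total s 0 with h | h
  · rw [max_eq_right h]; nlinarith [sq_nonneg s]
  · rw [max_eq_left h]

theorem hasDerivAt_hub (s : ℝ) : HasDerivAt hub (hub₁ s) s := by
  rcases lt_trichotomy s 0 with h | rfl | h
  · rw [hub₁_of_nonpos h.le]
    refine (hasDerivAt_const s (0 : ℝ)).congr_of_eventuallyEq ?_
    filter_upwards [gt_mem_nhds h] with u hu using hub_of_nonpos hu.le
  · rw [hub₁_of_nonpos le_rfl]
    refine hasDerivAt_zero_of_abs_le (C := 1) fun s => ?_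
    rw [abs_of_nonneg (hub_nonneg s), one_mul]
    exact (hub_le_sq s).trans (max_sq_le s)
  · have h1 : HasDerivAt (fun u : ℝ => u ^ 3 / (1 + u) ^ 2) (hub₁ s) s := by
      have a := hasDerivAt_pow 3 s
      have b : HasDerivAt (fun u : ℝ => (1 + u) ^ 2) (2 * (1 + s)) s := by
        simpa using ((hasDerivAt_id s).const_add 1).fun_pow 2
      have hne : (1 + s) ^ 2 ≠ 0 := by positivity
      refine (a.fun_div b hne).congr_deriv ?_
      unfold hub₁
      rw [max_eq_left h.le]
      have : 1 + s ≠ 0 := by positivity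
      field_simp
      push_cast
      ring
    refine h1.congr_of_eventuallyEq ?_
    filter_upwards [lt_mem_nhds h] with u hu
    unfold hub; rw [max_eq_left hu.le]

theorem hasDerivAt_hub₁ (s : ℝ) : HasDerivAt hub₁ (hub₂ s) s := by
  rcases lt_trichotomy s 0 with h | rfl | h
  · rw [hub₂_of_nonpos h.le]
    refine (hasDerivAt_const s (0 : ℝ)).congr_of_eventuallyEq ?_
    filter_upwards [gt_mem_nhds h] with u hu using hub₁_of_nonpos hu.le
  · rw [hub₂_of_nonpos le_rfl]
    refine hasDerivAt_zero_of_abs_le (C := 3) fun s => ?_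
    have h0 : 0 ≤ max s 0 := le_max_right _ _
    have : hub₁ s ≤ 3 * max s 0 ^ 2 := by
      unfold hub₁
      rw [div_le_iff₀ (by positivity)]
      nlinarith [pow_nonneg h0 2, pow_nonneg h0 3, pow_nonneg h0 4, pow_nonneg h0 5]
    rw [abs_of_nonneg (by unfold hub₁; positivity)]
    linarith [max_sq_le s]
  · have h1 : HasDerivAt (fun u : ℝ => u ^ 2 * (u + 3) / (1 + u) ^ 3) (hub₂ s) s := by
      have a := (hasDerivAt_pow 2 s).fun_mul ((hasDerivAt_id s).add_const 3)
      have b : HasDerivAt (fun u : ℝ => (1 + u) ^ 3) (3 * (1 + s) ^ 2) s := by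
        simpa using ((hasDerivAt_id s).const_add 1).fun_pow 3
      have hne : (1 + s) ^ 3 ≠ 0 := by positivity
      refine (a.fun_div b hne).congr_deriv ?_
      unfold hub₂
      rw [max_eq_left h.le]
      have : 1 + s ≠ 0 := by positivity
      simp only [id]
      field_simp
      push_cast
      ring
    refine h1.congr_of_eventuallyEq ?_
    filter_upwards [lt_mem_nhds h] with u hu
    unfold hub₁; rw [max_eq_left hu.le]

/-- The convex truncation measuring the excess of `|s|` over `m`. -/
def exc (m s : ℝ) : ℝ := hub (s - m) + hub (-s - m)

/-- Derivative of `exc m`. -/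
def exc₁ (m s : ℝ) : ℝ := hub₁ (s - m) - hub₁ (-s - m)

/-- Second derivative of `exc m`. -/
def exc₂ (m s : ℝ) : ℝ := hub₂ (s - m) + hub₂ (-s - m)

theorem hasDerivAt_exc (m s : ℝ) : HasDerivAt (exc m) (exc₁ m s) s := by
  have a : HasDerivAt (fun s => s - m) 1 s := (hasDerivAt_id s).sub_const m
  have b : HasDerivAt (fun s => -s - m) (-1) s := (hasDerivAt_id s).neg.sub_const m
  refine (((hasDerivAt_hub _).comp s a).fun_add ((hasDerivAt_hub _).comp s b)).congr_deriv ?_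
  unfold exc₁; ring

theorem hasDerivAt_exc₁ (m s : ℝ) : HasDerivAt (exc₁ m) (exc₂ m s) s := by
  have a : HasDerivAt (fun s => s - m) 1 s := (hasDerivAt_id s).sub_const m
  have b : HasDerivAt (fun s => -s - m) (-1) s := (hasDerivAt_id s).neg.sub_const m
  refine (((hasDerivAt_hub₁ _).comp s a).fun_sub ((hasDerivAt_hub₁ _).comp s b)).congr_deriv ?_
  unfold exc₂; ring

theorem contDiff_exc₁ (m : ℝ) : ContDiff ℝ 1 (exc₁ m) := by
  rw [contDiff_one_iff_deriv]
  refine ⟨fun s => (hasDerivAt_exc₁ m s).differentiableAt, ?_⟩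
  rw [show deriv (exc₁ m) = exc₂ m from funext fun s => (hasDerivAt_exc₁ m s).deriv]
  unfold exc₂
  have := continuous_hub₂
  fun_prop

theorem contDiff_exc (m : ℝ) : ContDiff ℝ 1 (exc m) := by
  rw [contDiff_one_iff_deriv]
  refine ⟨fun s => (hasDerivAt_exc m s).differentiableAt, ?_⟩
  rw [show deriv (exc m) = exc₁ m from funext fun s => (hasDerivAt_exc m s).deriv]
  exact (contDiff_exc₁ m).continuous

theorem exc₂_nonneg (m s : ℝ) : 0 ≤ exc₂ m s := add_nonneg (hub₂_nonneg _) (hub₂_nonneg _)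

theorem exc_nonneg (m s : ℝ) : 0 ≤ exc m s := add_nonneg (hub_nonneg _) (hub_nonneg _)

theorem exc_le_max {m : ℝ} (hm : 0 ≤ m) (s : ℝ) : exc m s ≤ max (|s| - m) 0 := by
  unfold exc
  rcases le_total 0 s with h | h
  · rw [hub_of_nonpos (show -s - m ≤ 0 by linarith), abs_of_nonneg h, add_zero]
    exact hub_le_max _
  · rw [hub_of_nonpos (show s - m ≤ 0 by linarith), abs_of_nonpos h, zero_add]
    exact hub_le_max _

/-- The linear bound controls the drift error, where one factor of the velocity is already present.
The quadratic bound `exc_le_sq` controls the second derivatives of the cutoff and the axis term. -/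
theorem exc_le_abs {m : ℝ} (hm : 0 ≤ m) (s : ℝ) : exc m s ≤ |s| :=
  (exc_le_max hm s).trans (max_le (by linarith) (abs_nonneg s))

theorem exc_le_sq {m : ℝ} (hm : 0 ≤ m) (s : ℝ) : exc m s ≤ s ^ 2 := by
  have key : ∀ u, 0 ≤ u → hub (u - m) ≤ u ^ 2 := by
    intro u hu
    refine (hub_le_sq _).trans ?_
    have h1 : max (u - m) 0 ≤ u := max_le (by linarith) hu
    have h2 : 0 ≤ max (u - m) 0 := le_max_right _ _
    gcongr
  unfold exc
  rcases le_total 0 s with h | h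
  · rw [hub_of_nonpos (show -s - m ≤ 0 by linarith), add_zero]
    exact key s h
  · rw [hub_of_nonpos (show s - m ≤ 0 by linarith), zero_add]
    have := key (-s) (by linarith)
    rwa [neg_sq] at this

theorem exc_pos {m s : ℝ} (h : m < |s|) : 0 < exc m s := by
  unfold exc
  rcases le_total 0 s with hs | hs
  · rw [abs_of_nonneg hs] at h
    exact add_pos_of_pos_of_nonneg (hub_pos (by linarith)) (hub_nonneg _)
  · rw [abs_of_nonpos hs] at h
    exact add_pos_of_nonneg_of_pos (hub_nonneg _) (hub_pos (by linarith))

theorem exc_eq_zero {m s : ℝ} (h : |s| ≤ m) : exc m s = 0 ∧ exc₁ m s = 0 := by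
  have := abs_le.1 h
  unfold exc exc₁
  rw [hub_of_nonpos (by linarith), hub_of_nonpos (by linarith), hub₁_of_nonpos (by linarith),
    hub₁_of_nonpos (by linarith)]
  simp

/-! ### Evolution of the swirl and of convex functions of it. -/

/-- The algebra behind the localized estimate for a convex function of the swirl. -/
theorem swirl_identity_pointwise {E : Type*} [NormedAddCommGroup E] [NormedSpace ℝ E]
    {e0 e1 e2 τ : E} {c0 c1 φ Γ G G1 π w0 w1 w2 ρ : E → ℝ} {q : E} {g2 w3 : ℝ}
    (dc0 : DifferentiableAt ℝ c0 q) (dc1 : DifferentiableAt ℝ c1 q) (dφ : DifferentiableAt ℝ φ q)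
    (dG : DifferentiableAt ℝ G q) (dG1 : DifferentiableAt ℝ G1 q) (dπ : DifferentiableAt ℝ π q)
    (dw0 : DifferentiableAt ℝ w0 q) (dw1 : DifferentiableAt ℝ w1 q)
    (dw2 : DifferentiableAt ℝ w2 q) (dρ : DifferentiableAt ℝ ρ q)
    (dΓ : ∀ e, DifferentiableAt ℝ (dd e Γ) q) (dφ' : ∀ e, DifferentiableAt ℝ (dd e φ) q)
    (h00 : dd e0 c0 q = 1) (h10 : dd e1 c0 q = 0) (h01 : dd e0 c1 q = 0) (h11 : dd e1 c1 q = 1)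
    (hρ0 : dd e0 ρ q = -2 * c0 q * ρ q ^ 2) (hρ1 : dd e1 ρ q = -2 * c1 q * ρ q ^ 2)
    (hρ : ρ q * (c0 q ^ 2 + c1 q ^ 2) = 1)
    (hG : ∀ e, dd e G q = G1 q * dd e Γ q) (hG1 : ∀ e, dd e G1 q = g2 * dd e Γ q)
    (hφt : dd τ φ q = 0) (haΓ : c0 q * dd e1 Γ q - c1 q * dd e0 Γ q = 0)
    (haφ : c0 q * dd e1 φ q - c1 q * dd e0 φ q = 0)
    (hw3 : c0 q * dd e0 Γ q + c1 q * dd e1 Γ q = (c0 q ^ 2 + c1 q ^ 2) * w3)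
    (hdiv : dd e0 w0 q + dd e1 w1 q + dd e2 w2 q = 0)
    (hev : dd τ Γ q = dd e0 (dd e0 Γ) q + dd e1 (dd e1 Γ) q + dd e2 (dd e2 Γ) q - 2 * w3
      - (w0 q * dd e0 Γ q + w1 q * dd e1 Γ q + w2 q * dd e2 Γ q)
      - (c0 q * dd e1 π q - c1 q * dd e0 π q)) :
    dd τ (fun p => G p * φ p) q =
      - (g2 * φ q * (dd e0 Γ q ^ 2 + dd e1 Γ q ^ 2 + dd e2 Γ q ^ 2))
      + G q * (dd e0 (dd e0 φ) q + dd e1 (dd e1 φ) q + dd e2 (dd e2 φ) q)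
      + G q * (w0 q * dd e0 φ q + w1 q * dd e1 φ q + w2 q * dd e2 φ q)
      + 2 * G q * ρ q * (c0 q * dd e0 φ q + c1 q * dd e1 φ q)
      + dd e0 (fun p => G1 p * φ p * dd e0 Γ p - G p * dd e0 φ p - G p * φ p * w0 p
          + G1 p * φ p * π p * c1 p) q
      + dd e1 (fun p => G1 p * φ p * dd e1 Γ p - G p * dd e1 φ p - G p * φ p * w1 p
          - G1 p * φ p * π p * c0 p) q
      + dd e2 (fun p => G1 p * φ p * dd e2 Γ p - G p * dd e2 φ p - G p * φ p * w2 p) q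
      - 2 * (dd e0 (fun p => φ p * G p * c0 p * ρ p) q
        + dd e1 (fun p => φ p * G p * c1 p * ρ p) q) := by
  have a0 := dΓ e0
  have a1 := dΓ e1
  have a2 := dΓ e2
  have b0 := dφ' e0
  have b1 := dφ' e1
  have b2 := dφ' e2
  simp (disch := fun_prop) only [dd_add, dd_sub, dd_mul, hG, hG1, h00, h10, h01, h11, hρ0, hρ1,
    hφt, hev]
  -- Off the axis the vertical vorticity is `r⁻¹ ∂_r Γ`. The zeroth-order looking term is thus a
  -- first-order term in `Γ` with the singular field `x' / r²`.
  have hw3' : w3 = ρ q * (c0 q * dd e0 Γ q + c1 q * dd e1 Γ q) := by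
    rw [hw3]; linear_combination (-w3) * hρ
  rw [hw3']
  -- Incompressibility puts the drift in flux form. The vanishing angular derivatives of `Γ` and `φ`
  -- allow the pressure term to be a pure divergence, and `hρ` expresses that `x' / r²` is
  -- divergence-free off the axis.
  linear_combination (φ q * G q) * hdiv
    + (g2 * φ q * π q) * haΓ + (G1 q * π q) * haφ
    - (4 * φ q * G q * ρ q) * hρ

theorem sd_apply (i j : Fin 3) : (sd i).1 j = if j = i then 1 else 0 := by
  simp [sd]

/-- The evolution equation of the swirl. -/
theorem swirl_evolution {I : Set ℝ} {w : Fin 3 → E3 × ℝ → ℝ} {π : E3 × ℝ → ℝ}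
    (F : SmoothFlow I w π) (x : E3) {t : ℝ} (ht : t ∈ I) :
    dd td (swirl w) (x, t) = dd (sd 0) (dd (sd 0) (swirl w)) (x, t)
      + dd (sd 1) (dd (sd 1) (swirl w)) (x, t) + dd (sd 2) (dd (sd 2) (swirl w)) (x, t)
      - 2 * (dd (sd 0) (w 1) (x, t) - dd (sd 1) (w 0) (x, t))
      - (w 0 (x, t) * dd (sd 0) (swirl w) (x, t) + w 1 (x, t) * dd (sd 1) (swirl w) (x, t)
        + w 2 (x, t) * dd (sd 2) (swirl w) (x, t))
      - (x 0 * dd (sd 1) π (x, t) - x 1 * dd (sd 0) π (x, t)) := by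
  have d : ∀ i, Differentiable ℝ (w i) := fun i => (F.smooth_w i).differentiable (by simp)
  have de : ∀ e i, Differentiable ℝ (dd e (w i)) :=
    fun e i => (smooth_dd e (F.smooth_w i)).differentiable (by simp)
  have X := fun i => (smooth_coord i).differentiable (by simp)
  have h2 : ∀ e : E3 × ℝ, dd e (dd e (swirl w)) (x, t) = 2 * e.1 0 * dd e (w 1) (x, t)
      + x 0 * dd e (dd e (w 1)) (x, t) - 2 * e.1 1 * dd e (w 0) (x, t)
      - x 1 * dd e (dd e (w 0)) (x, t) := by
    intro e
    have : dd e (swirl w) = fun q => e.1 0 * w 1 q + q.1 0 * dd e (w 1) q - e.1 1 * w 0 q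
      - q.1 1 * dd e (w 0) q := funext fun q => dd_swirl F e q
    rw [this]
    generalize hc0 : (fun q : E3 × ℝ => q.1 0) = c0
    generalize hc1 : (fun q : E3 × ℝ => q.1 1) = c1
    have f0 : ∀ q : E3 × ℝ, q.1 0 = c0 q := fun q => by rw [← hc0]
    have f1 : ∀ q : E3 × ℝ, q.1 1 = c1 q := fun q => by rw [← hc1]
    have g0 : Differentiable ℝ c0 := hc0 ▸ X 0
    have g1 : Differentiable ℝ c1 := hc1 ▸ X 1
    have k0 : dd e c0 (x, t) = e.1 0 := by rw [← hc0]; exact dd_coord e 0 _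
    have k1 : dd e c1 (x, t) = e.1 1 := by rw [← hc1]; exact dd_coord e 1 _
    have m0 : x 0 = c0 (x, t) := f0 (x, t)
    have m1 : x 1 = c1 (x, t) := f1 (x, t)
    have n1 := de e 1
    have n0 := de e 0
    have n1' := d 1
    have n0' := d 0
    rw [m0, m1]
    have e2 : (fun q : E3 × ℝ => e.1 0 * w 1 q + q.1 0 * dd e (w 1) q - e.1 1 * w 0 q
      - q.1 1 * dd e (w 0) q) = fun q : E3 × ℝ => e.1 0 * w 1 q + c0 q * dd e (w 1) q
        - e.1 1 * w 0 q - c1 q * dd e (w 0) q := by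
      funext q; rw [f0 q, f1 q]
    rw [e2]
    simp (disch := fun_prop) only [dd_add, dd_sub, dd_mul, dd_const, k0, k1]
    ring
  have m0 := F.momentum 0 x t ht
  have m1 := F.momentum 1 x t ht
  rw [Fin.sum_univ_three, Fin.sum_univ_three] at m0 m1
  rw [h2, h2, h2, dd_swirl F, dd_swirl F, dd_swirl F, dd_swirl F]
  have t0 : td.1 0 = 0 := by simp [td]
  have t1 : td.1 1 = 0 := by simp [td]
  simp only [sd_apply, t0, t1]
  simp
  linear_combination x 1 * m0 - x 0 * m1

/-- Off the axis the vertical vorticity is the radial derivative of the swirl. -/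
theorem swirl_radial {I : Set ℝ} {w : Fin 3 → E3 × ℝ → ℝ} {π : E3 × ℝ → ℝ}
    (F : SmoothFlow I w π) {x : E3} (hx : rad x ≠ 0) (t : ℝ) :
    x 0 * dd (sd 0) (swirl w) (x, t) + x 1 * dd (sd 1) (swirl w) (x, t) =
      (x 0 ^ 2 + x 1 ^ 2) * (dd (sd 0) (w 1) (x, t) - dd (sd 1) (w 0) (x, t)) := by
  have av := angular_velocity F hx t
  rw [dd_swirl F, dd_swirl F]
  simp only [sd_apply]
  simp
  linear_combination x 0 * av.1 + x 1 * av.2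

/-! ### Cutoffs at radius `R` and the localized excess inequality. -/

/-- The squared distance to the origin. -/
def sqn (x : E3) : ℝ := x 0 ^ 2 + x 1 ^ 2 + x 2 ^ 2

theorem sqn_eq (x : E3) : sqn x = ‖x‖ ^ 2 := by
  rw [EuclideanSpace.norm_sq_eq, Fin.sum_univ_three]
  simp [sqn]

theorem contDiff_sqn : ContDiff ℝ ∞ (fun q : E3 × ℝ => sqn q.1) :=
  (((smooth_coord 0).pow 2).add ((smooth_coord 1).pow 2)).add ((smooth_coord 2).pow 2)

theorem dd_sqn (e q : E3 × ℝ) : dd e (fun q : E3 × ℝ => sqn q.1) q =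
    2 * (q.1 0 * e.1 0 + q.1 1 * e.1 1 + q.1 2 * e.1 2) := by
  have X := fun i => (smooth_coord i).differentiable (by simp) q
  unfold sqn
  rw [dd_add e (((X 0).fun_pow 2).fun_add ((X 1).fun_pow 2)) ((X 2).fun_pow 2),
    dd_add e ((X 0).fun_pow 2) ((X 1).fun_pow 2), dd_pow e 2 (X 0), dd_pow e 2 (X 1),
    dd_pow e 2 (X 2), dd_coord, dd_coord, dd_coord]
  push_cast
  ring

/-- The profile of the spatial cutoff. -/
def prof (s : ℝ) : ℝ := Real.smoothTransition (2 - s)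

theorem contDiff_prof : ContDiff ℝ ∞ prof := Real.smoothTransition.contDiff.comp (by fun_prop)

theorem smooth_deriv {f : ℝ → ℝ} (hf : ContDiff ℝ ∞ f) : ContDiff ℝ ∞ (deriv f) :=
  (contDiff_infty_iff_deriv.1 hf).2

theorem deriv_eq_zero_of_eventuallyConst {f : ℝ → ℝ} {s c : ℝ} (h : f =ᶠ[𝓝 s] fun _ => c) :
    deriv f s = 0 := by
  rw [h.deriv_eq]; simp

theorem deriv_prof_eq_zero {s : ℝ} (hs : s < 1 ∨ 2 < s) :
    deriv prof s = 0 ∧ deriv (deriv prof) s = 0 := by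
  have key : ∀ u : ℝ, u < 1 ∨ 2 < u → deriv prof u = 0 := by
    intro u hu
    rcases hu with h | h
    · refine deriv_eq_zero_of_eventuallyConst (c := 1) ?_
      filter_upwards [gt_mem_nhds h] with y hy
      exact Real.smoothTransition.one_of_one_le (by linarith)
    · refine deriv_eq_zero_of_eventuallyConst (c := 0) ?_
      filter_upwards [lt_mem_nhds h] with y hy
      exact Real.smoothTransition.zero_of_nonpos (by linarith)
  refine ⟨key s hs, deriv_eq_zero_of_eventuallyConst (c := 0) ?_⟩
  have ho : IsOpen {u : ℝ | u < 1 ∨ 2 < u} := isOpen_Iio.union isOpen_Ioi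
  filter_upwards [ho.mem_nhds hs] with u hu using key u hu

theorem exists_prof_bound : ∃ c : ℝ, 0 < c ∧ ∀ s, |deriv prof s| ≤ c ∧ |deriv (deriv prof) s| ≤ c := by
  have s1 := smooth_deriv contDiff_prof
  have s2 := smooth_deriv s1
  have z : ∀ s ∉ Icc (1 : ℝ) 2, s < 1 ∨ 2 < s := by
    intro s hs
    by_contra hcon
    push Not at hcon
    exact hs hcon
  obtain ⟨c1, h1⟩ := s1.continuous.bounded_above_of_compact_support
    (HasCompactSupport.intro isCompact_Icc fun s hs => (deriv_prof_eq_zero (z s hs)).1)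
  obtain ⟨c2, h2⟩ := s2.continuous.bounded_above_of_compact_support
    (HasCompactSupport.intro isCompact_Icc fun s hs => (deriv_prof_eq_zero (z s hs)).2)
  exact ⟨max 1 (max c1 c2), by positivity, fun s =>
    ⟨(h1 s).trans (by simp), (h2 s).trans (by simp)⟩⟩

/-- The spatial cutoff at scale `R`. -/
def radCut (R : ℝ) (q : E3 × ℝ) : ℝ := prof (sqn q.1 / R ^ 2)

theorem smooth_radCut (R : ℝ) : ContDiff ℝ ∞ (radCut R) :=
  contDiff_prof.comp (contDiff_sqn.div_const _)

theorem radCut_nonneg (R : ℝ) (q : E3 × ℝ) : 0 ≤ radCut R q := Real.smoothTransition.nonneg _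

theorem radCut_le_one (R : ℝ) (q : E3 × ℝ) : radCut R q ≤ 1 := Real.smoothTransition.le_one _

theorem radCut_eq_one {R : ℝ} (hR : 0 < R) {x : E3} (hx : sqn x ≤ R ^ 2) (t : ℝ) :
    radCut R (x, t) = 1 := by
  refine Real.smoothTransition.one_of_one_le ?_
  have : sqn x / R ^ 2 ≤ 1 := (div_le_one (by positivity)).2 hx
  simp only; linarith

theorem radCut_eq_zero {R : ℝ} (hR : 0 < R) {x : E3} (hx : 2 * R ^ 2 ≤ sqn x) (t : ℝ) :
    radCut R (x, t) = 0 := by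
  refine Real.smoothTransition.zero_of_nonpos ?_
  have : 2 ≤ sqn x / R ^ 2 := (le_div_iff₀ (by positivity)).2 hx
  simp only; linarith

theorem dd_radCut (R : ℝ) (e : E3 × ℝ) : dd e (radCut R) = fun q =>
    deriv prof (sqn q.1 / R ^ 2) * (2 * (q.1 0 * e.1 0 + q.1 1 * e.1 1 + q.1 2 * e.1 2) / R ^ 2) := by
  funext q
  have ds : DifferentiableAt ℝ (fun q : E3 × ℝ => sqn q.1) q :=
    contDiff_sqn.differentiable (by simp) q
  have ds2 : DifferentiableAt ℝ (fun q : E3 × ℝ => sqn q.1 / R ^ 2) q :=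
    (contDiff_sqn.div_const _).differentiable (by simp) q
  have e1 : dd e (fun q : E3 × ℝ => sqn q.1 / R ^ 2) q =
      2 * (q.1 0 * e.1 0 + q.1 1 * e.1 1 + q.1 2 * e.1 2) / R ^ 2 := by
    simp only [div_eq_inv_mul]
    rw [dd_const_mul e _ ds, dd_sqn]
  rw [← e1]
  exact dd_comp (F := prof) (f := fun q : E3 × ℝ => sqn q.1 / R ^ 2) e
    (contDiff_prof.differentiable (by simp) _).hasDerivAt ds2

theorem dd_dd_radCut (R : ℝ) (e q : E3 × ℝ) : dd e (dd e (radCut R)) q =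
    deriv (deriv prof) (sqn q.1 / R ^ 2)
      * (2 * (q.1 0 * e.1 0 + q.1 1 * e.1 1 + q.1 2 * e.1 2) / R ^ 2) ^ 2
    + deriv prof (sqn q.1 / R ^ 2) * (2 * (e.1 0 ^ 2 + e.1 1 ^ 2 + e.1 2 ^ 2) / R ^ 2) := by
  have ds : DifferentiableAt ℝ (fun q : E3 × ℝ => sqn q.1) q :=
    contDiff_sqn.differentiable (by simp) q
  have ds2 : DifferentiableAt ℝ (fun q : E3 × ℝ => sqn q.1 / R ^ 2) q :=
    (contDiff_sqn.div_const _).differentiable (by simp) q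
  have X := fun i => (smooth_coord i).differentiable (by simp) q
  have e1 : dd e (fun q : E3 × ℝ => sqn q.1 / R ^ 2) q =
      2 * (q.1 0 * e.1 0 + q.1 1 * e.1 1 + q.1 2 * e.1 2) / R ^ 2 := by
    simp only [div_eq_inv_mul]
    rw [dd_const_mul e _ ds, dd_sqn]
  have hl : DifferentiableAt ℝ (fun q : E3 × ℝ =>
      q.1 0 * e.1 0 + q.1 1 * e.1 1 + q.1 2 * e.1 2) q :=
    (((X 0).mul_const _).fun_add ((X 1).mul_const _)).fun_add ((X 2).mul_const _)
  have e2 : dd e (fun q : E3 × ℝ => 2 * (q.1 0 * e.1 0 + q.1 1 * e.1 1 + q.1 2 * e.1 2) / R ^ 2) q =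
      2 * (e.1 0 ^ 2 + e.1 1 ^ 2 + e.1 2 ^ 2) / R ^ 2 := by
    simp only [div_eq_inv_mul]
    rw [dd_const_mul e _ (hl.const_mul 2), dd_const_mul e _ hl,
      dd_add e (((X 0).mul_const _).fun_add ((X 1).mul_const _)) ((X 2).mul_const _),
      dd_add e ((X 0).mul_const _) ((X 1).mul_const _), dd_mul e (X 0) (by fun_prop),
      dd_mul e (X 1) (by fun_prop), dd_mul e (X 2) (by fun_prop), dd_coord, dd_coord, dd_coord,
      dd_const, dd_const, dd_const]
    ring
  have dp : DifferentiableAt ℝ (fun q : E3 × ℝ => deriv prof (sqn q.1 / R ^ 2)) q :=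
    ((smooth_deriv contDiff_prof).comp (contDiff_sqn.div_const _)).differentiable (by simp) q
  have hl2 : DifferentiableAt ℝ (fun q : E3 × ℝ =>
      2 * (q.1 0 * e.1 0 + q.1 1 * e.1 1 + q.1 2 * e.1 2) / R ^ 2) q := by
    simpa only [div_eq_mul_inv] using (hl.const_mul 2).mul_const _
  rw [dd_radCut, dd_mul e dp hl2, e2,
    dd_comp (F := deriv prof) (f := fun q : E3 × ℝ => sqn q.1 / R ^ 2) e
      ((smooth_deriv contDiff_prof).differentiable (by simp) _).hasDerivAt ds2, e1]
  ring

/-- The shell on which the derivatives of `radCut R` live. -/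
def shell (R : ℝ) : Set E3 := {x | R ^ 2 ≤ sqn x ∧ sqn x ≤ 2 * R ^ 2}

theorem continuous_sqn : Continuous sqn := by unfold sqn; fun_prop

theorem isCompact_sqn_le {R : ℝ} (hR : 0 < R) : IsCompact {x : E3 | sqn x ≤ 2 * R ^ 2} := by
  refine Metric.isCompact_of_isClosed_isBounded
    (isClosed_le continuous_sqn continuous_const) ?_
  refine Metric.isBounded_closedBall (x := (0 : E3)) (r := 2 * R) |>.subset fun x hx => ?_
  rw [mem_closedBall_zero_iff]
  have hx' : sqn x ≤ 2 * R ^ 2 := hx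
  rw [sqn_eq] at hx'
  nlinarith [norm_nonneg x]

theorem isCompact_shell {R : ℝ} (hR : 0 < R) : IsCompact (shell R) := by
  refine (isCompact_sqn_le hR).of_isClosed_subset ?_ fun x hx => hx.2
  exact (isClosed_le continuous_const continuous_sqn).inter
    (isClosed_le continuous_sqn continuous_const)

/-- The squared speed. -/
def speedSq (w : Fin 3 → E3 × ℝ → ℝ) (q : E3 × ℝ) : ℝ := w 0 q ^ 2 + w 1 q ^ 2 + w 2 q ^ 2

/-- On the shell `|x|² = n` is comparable to `R²`. Each error is of the form `G / R²` or `G |d| /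
R²` with `Γ²` and `d²` at most `n s`, so all powers of `R` cancel and only the energy density `s`
remains. This scale invariance is what makes the dyadic summation work. -/
theorem swirl_error_arith {n R c G Γ s p p' d : ℝ} (hR : 0 < R) (hn1 : R ^ 2 ≤ n)
    (hn2 : n ≤ 2 * R ^ 2) (hc : 0 < c) (hp : |p| ≤ c) (hp' : |p'| ≤ c) (hG0 : 0 ≤ G)
    (hG1 : G ≤ |Γ|) (hG2 : G ≤ Γ ^ 2) (hs : 0 ≤ s) (hΓ : Γ ^ 2 ≤ n * s) (hd : d ^ 2 ≤ n * s) :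
    G * (p' * (4 * n / R ^ 4) + p * (6 / R ^ 2)) + G * (p * (2 * d / R ^ 2)) + G * (p * (4 / R ^ 2))
      ≤ 40 * c * s := by
  have hR2 : 0 < R ^ 2 := by positivity
  have hn0 : 0 ≤ n := hR2.le.trans hn1
  have hns : n * s / R ^ 2 ≤ 2 * s := by
    rw [div_le_iff₀ hR2]; nlinarith
  have hGn : G ≤ n * s := hG2.trans hΓ
  have t1 : G * (p' * (4 * n / R ^ 4)) ≤ 16 * c * s := by
    calc G * (p' * (4 * n / R ^ 4)) ≤ G * (c * (4 * n / R ^ 4)) := by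
          gcongr; exact (le_abs_self _).trans hp'
      _ ≤ (n * s) * (c * (4 * (2 * R ^ 2) / R ^ 4)) := by gcongr
      _ = 8 * c * (n * s / R ^ 2) := by field_simp; ring
      _ ≤ 8 * c * (2 * s) := by gcongr
      _ = _ := by ring
  have t2 : G * (p * (10 / R ^ 2)) ≤ 20 * c * s := by
    calc G * (p * (10 / R ^ 2)) ≤ (n * s) * (c * (10 / R ^ 2)) := by
          have : p ≤ c := (le_abs_self _).trans hp
          calc _ ≤ G * (c * (10 / R ^ 2)) := by gcongr
            _ ≤ _ := by gcongr
      _ = 10 * c * (n * s / R ^ 2) := by ring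
      _ ≤ 10 * c * (2 * s) := by gcongr
      _ = _ := by ring
  have hGd : G * |d| ≤ n * s := by
    have h1 : G * |d| ≤ |Γ| * |d| := by gcongr
    nlinarith [sq_abs Γ, sq_abs d, sq_nonneg (|Γ| - |d|)]
  have t3 : G * (p * (2 * d / R ^ 2)) ≤ 4 * c * s := by
    calc G * (p * (2 * d / R ^ 2)) ≤ |G * (p * (2 * d / R ^ 2))| := le_abs_self _
      _ = |p| * (2 * (G * |d|) / R ^ 2) := by
          rw [abs_mul, abs_mul, abs_div, abs_mul, abs_of_nonneg hG0, abs_of_pos hR2,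
            abs_of_pos (by norm_num : (0 : ℝ) < 2)]
          ring
      _ ≤ c * (2 * (n * s) / R ^ 2) := by gcongr
      _ = 2 * c * (n * s / R ^ 2) := by ring
      _ ≤ 2 * c * (2 * s) := by gcongr
      _ = _ := by ring
  have e : G * (p' * (4 * n / R ^ 4) + p * (6 / R ^ 2)) + G * (p * (2 * d / R ^ 2))
      + G * (p * (4 / R ^ 2)) = G * (p' * (4 * n / R ^ 4)) + G * (p * (10 / R ^ 2))
      + G * (p * (2 * d / R ^ 2)) := by ring
  rw [e]; linarith

/-- The growth of the localized excess of the swirl is controlled by the energy in a shell. -/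
theorem swirl_excess_le {a b : ℝ} {w : Fin 3 → E3 × ℝ → ℝ} {π : E3 × ℝ → ℝ}
    (F : SmoothFlow (Ioo a b) w π) {m R c : ℝ} (hm : 0 < m) (hR : 0 < R) (hc0 : 0 < c)
    (hc : ∀ s, |deriv prof s| ≤ c ∧ |deriv (deriv prof) s| ≤ c) {t₀ t₁ : ℝ} (h01 : t₀ ≤ t₁)
    (ha : a < t₀) (hb : t₁ < b) :
    ∫ x, exc m (swirl w (x, t₁)) * radCut R (x, t₁) ≤
      (∫ x, exc m (swirl w (x, t₀)) * radCut R (x, t₀))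
        + 40 * c * ∫ t in t₀..t₁, ∫ x in shell R, speedSq w (x, t) := by
  have sΓ := smooth_swirl F
  have sφ := smooth_radCut R
  set K : Set E3 := {x | sqn x ≤ 2 * R ^ 2} with hKdef
  have hK : IsCompact K := isCompact_sqn_le hR
  have hφ0 : ∀ x ∉ K, ∀ t, radCut R (x, t) = 0 := fun x hx t =>
    radCut_eq_zero hR (not_le.1 hx).le t
  set G : E3 × ℝ → ℝ := fun q => exc m (swirl w q) with hG
  set G1 : E3 × ℝ → ℝ := fun q => exc₁ m (swirl w q) with hG1
  set φ := radCut R with hφ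
  set Γ := swirl w with hΓ
  let c0 : E3 × ℝ → ℝ := fun q => q.1 0
  let c1 : E3 × ℝ → ℝ := fun q => q.1 1
  let ρ : E3 × ℝ → ℝ := fun q => (c0 q ^ 2 + c1 q ^ 2)⁻¹
  have one : (1 : WithTop ℕ∞) ≤ ∞ := WithTop.coe_le_coe.2 le_top
  have k0 : ContDiff ℝ 1 c0 := (smooth_coord 0).of_le one
  have k1 : ContDiff ℝ 1 c1 := (smooth_coord 1).of_le one
  have kG : ContDiff ℝ 1 G := (contDiff_exc m).comp (sΓ.of_le one)
  have kG1 : ContDiff ℝ 1 G1 := (contDiff_exc₁ m).comp (sΓ.of_le one)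
  have kφ : ContDiff ℝ 1 φ := sφ.of_le one
  have kπ : ContDiff ℝ 1 π := F.smooth_π.of_le one
  have kw : ∀ i, ContDiff ℝ 1 (w i) := fun i => (F.smooth_w i).of_le one
  have kΓ' : ∀ e, ContDiff ℝ 1 (dd e Γ) := fun e => (smooth_dd e sΓ).of_le one
  have kφ' : ∀ e, ContDiff ℝ 1 (dd e φ) := fun e => (smooth_dd e sφ).of_le one
  have w0 := kw 0
  have w1 := kw 1
  have w2 := kw 2
  have g0 := kΓ' (sd 0)
  have g1 := kΓ' (sd 1)
  have g2 := kΓ' (sd 2)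
  have f0 := kφ' (sd 0)
  have f1 := kφ' (sd 1)
  have f2 := kφ' (sd 2)
  let X0 : E3 × ℝ → ℝ := fun p => G1 p * φ p * dd (sd 0) Γ p - G p * dd (sd 0) φ p
    - G p * φ p * w 0 p + G1 p * φ p * π p * c1 p
  let X1 : E3 × ℝ → ℝ := fun p => G1 p * φ p * dd (sd 1) Γ p - G p * dd (sd 1) φ p
    - G p * φ p * w 1 p - G1 p * φ p * π p * c0 p
  let X2 : E3 × ℝ → ℝ := fun p => G1 p * φ p * dd (sd 2) Γ p - G p * dd (sd 2) φ p
    - G p * φ p * w 2 p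
  let Y0 : E3 × ℝ → ℝ := fun p => φ p * G p * c0 p * ρ p
  let Y1 : E3 × ℝ → ℝ := fun p => φ p * G p * c1 p * ρ p
  have sX0 : ContDiff ℝ 1 X0 := by fun_prop
  have sX1 : ContDiff ℝ 1 X1 := by fun_prop
  have sX2 : ContDiff ℝ 1 X2 := by fun_prop
  -- The swirl vanishes on the axis and `m > 0`, so the truncation is identically zero nearby. Hence
  -- the fields containing `1 / r²` are `C¹` everywhere and no boundary term appears on the axis.
  have nearAxis : ∀ q : E3 × ℝ, rad q.1 = 0 → ∀ᶠ p in 𝓝 q, G p = 0 ∧ G1 p = 0 := by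
    intro q hq
    obtain ⟨z0, z1⟩ := rad_eq_zero_iff.1 hq
    have h0 : |Γ q| < m := by simp [hΓ, swirl, z0, z1, hm]
    have ho : IsOpen {p | |Γ p| < m} := isOpen_lt sΓ.continuous.abs continuous_const
    filter_upwards [ho.mem_nhds h0] with p hp
    exact exc_eq_zero (le_of_lt hp)
  have hρd : ∀ q : E3 × ℝ, rad q.1 ≠ 0 → c0 q ^ 2 + c1 q ^ 2 ≠ 0 := by
    intro q hq
    have h := Real.sqrt_ne_zero'.1 hq
    exact h.ne'
  have sρ : ∀ q : E3 × ℝ, rad q.1 ≠ 0 → ContDiffAt ℝ 1 ρ q := fun q hq =>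
    ContDiffAt.inv (by fun_prop) (hρd q hq)
  have sY : ∀ cc : E3 × ℝ → ℝ, ContDiff ℝ 1 cc →
      ContDiff ℝ 1 (fun p => φ p * G p * cc p * ρ p) := by
    intro cc hcc
    rw [contDiff_iff_contDiffAt]
    intro q
    by_cases hq : rad q.1 = 0
    · refine (contDiffAt_const (c := (0 : ℝ))).congr_of_eventuallyEq ?_
      filter_upwards [nearAxis q hq] with p hp
      simp [hp.1]
    · exact (((kφ.mul kG).mul hcc).contDiffAt).mul (sρ q hq)
  have sY0 : ContDiff ℝ 1 Y0 := sY c0 k0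
  have sY1 : ContDiff ℝ 1 Y1 := sY c1 k1
  have hφd : ∀ e, ∀ x ∉ K, ∀ t, dd e φ (x, t) = 0 := fun e => dd_eq_zero_of_notMem hK hφ0 e
  have zX0 : ∀ x ∉ K, ∀ t, X0 (x, t) = 0 := fun x hx t => by simp [X0, hφ0 x hx, hφd _ x hx]
  have zX1 : ∀ x ∉ K, ∀ t, X1 (x, t) = 0 := fun x hx t => by simp [X1, hφ0 x hx, hφd _ x hx]
  have zX2 : ∀ x ∉ K, ∀ t, X2 (x, t) = 0 := fun x hx t => by simp [X2, hφ0 x hx, hφd _ x hx]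
  have zY0 : ∀ x ∉ K, ∀ t, Y0 (x, t) = 0 := fun x hx t => by simp [Y0, hφ0 x hx]
  have zY1 : ∀ x ∉ K, ∀ t, Y1 (x, t) = 0 := fun x hx t => by simp [Y1, hφ0 x hx]
  let Z : E3 × ℝ → ℝ := fun p => G p * φ p
  have sZ : ContDiff ℝ 1 Z := kG.mul kφ
  have zZ : ∀ x ∉ K, ∀ t, Z (x, t) = 0 := fun x hx t => by simp [Z, hφ0 x hx]
  have main : ∀ x : E3, ∀ t ∈ Ioo a b, dd td Z (x, t) ≤
      (shell R).indicator (fun x => 40 * c * speedSq w (x, t)) x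
      + dd (sd 0) X0 (x, t) + dd (sd 1) X1 (x, t) + dd (sd 2) X2 (x, t)
      - 2 * (dd (sd 0) Y0 (x, t) + dd (sd 1) Y1 (x, t)) := by
    intro x t ht
    have hsp : 0 ≤ speedSq w (x, t) := by unfold speedSq; positivity
    by_cases hx : rad x = 0
    · have hn := nearAxis (x, t) hx
      have zero : ∀ f : E3 × ℝ → ℝ, (∀ p, G p = 0 → G1 p = 0 → f p = 0) → ∀ e,
          dd e f (x, t) = 0 := by
        intro f hf e
        rw [dd_congr (g := fun _ => 0) e (hn.mono fun p hp => hf p hp.1 hp.2), dd_const]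
      rw [zero Z (fun p h h' => by simp [Z, h]), zero X0 (fun p h h' => by simp [X0, h, h']),
        zero X1 (fun p h h' => by simp [X1, h, h']), zero X2 (fun p h h' => by simp [X2, h, h']),
        zero Y0 (fun p h h' => by simp [Y0, h]), zero Y1 (fun p h h' => by simp [Y1, h])]
      have : 0 ≤ (shell R).indicator (fun x => 40 * c * speedSq w (x, t)) x := by
        refine indicator_nonneg (fun y _ => ?_) x
        unfold speedSq; positivity
      linarith
    · have D : ∀ {f : E3 × ℝ → ℝ}, ContDiff ℝ 1 f → DifferentiableAt ℝ f (x, t) :=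
        fun hf => hf.differentiable (by norm_num) _
      have hne := hρd (x, t) hx
      have dρ : DifferentiableAt ℝ ρ (x, t) := (sρ (x, t) hx).differentiableAt (by norm_num)
      have hc0' : ∀ e : E3 × ℝ, dd e c0 (x, t) = e.1 0 := fun e => dd_coord e 0 _
      have hc1' : ∀ e : E3 × ℝ, dd e c1 (x, t) = e.1 1 := fun e => dd_coord e 1 _
      have hρe : ∀ e : E3 × ℝ, dd e ρ (x, t) =
          -2 * (c0 (x, t) * e.1 0 + c1 (x, t) * e.1 1) * ρ (x, t) ^ 2 := by
        intro e
        have h1 := dd_comp (F := fun s : ℝ => s⁻¹) (f := fun q => c0 q ^ 2 + c1 q ^ 2)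
          (x := (x, t)) e (hasDerivAt_inv hne) (((D k0).fun_pow 2).fun_add ((D k1).fun_pow 2))
        rw [dd_add e ((D k0).fun_pow 2) ((D k1).fun_pow 2), dd_pow e 2 (D k0), dd_pow e 2 (D k1),
          hc0', hc1'] at h1
        refine h1.trans ?_
        simp only [ρ]
        field_simp
        push_cast
        ring
      have id := swirl_identity_pointwise (e0 := sd 0) (e1 := sd 1) (e2 := sd 2) (τ := td)
        (c0 := c0) (c1 := c1) (φ := φ) (Γ := Γ) (G := G) (G1 := G1) (π := π) (w0 := w 0)
        (w1 := w 1) (w2 := w 2) (ρ := ρ) (q := (x, t)) (g2 := exc₂ m (Γ (x, t)))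
        (w3 := dd (sd 0) (w 1) (x, t) - dd (sd 1) (w 0) (x, t)) (D k0) (D k1) (D kφ) (D kG)
        (D kG1) (D kπ) (D w0) (D w1) (D w2) dρ (fun e => D (kΓ' e)) (fun e => D (kφ' e))
        (by rw [hc0']; simp [sd]) (by rw [hc0']; simp [sd]) (by rw [hc1']; simp [sd])
        (by rw [hc1']; simp [sd]) (by rw [hρe]; simp [sd]) (by rw [hρe]; simp [sd])
        (inv_mul_cancel₀ hne)
        (fun e => dd_comp e (hasDerivAt_exc m _) (sΓ.differentiable (by simp) _))
        (fun e => dd_comp e (hasDerivAt_exc₁ m _) (sΓ.differentiable (by simp) _))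
        (by rw [hφ, dd_radCut]; simp [td]) (swirl_angular F x t)
        (by rw [hφ, dd_radCut, dd_radCut]; simp [sd, c0, c1]; ring)
        (swirl_radial F hx t) (by simpa [Fin.sum_univ_three] using F.div_eq x t)
        (swirl_evolution F x ht)
      have hpos : 0 ≤ exc₂ m (Γ (x, t)) * φ (x, t) * (dd (sd 0) Γ (x, t) ^ 2
          + dd (sd 1) Γ (x, t) ^ 2 + dd (sd 2) Γ (x, t) ^ 2) :=
        mul_nonneg (mul_nonneg (exc₂_nonneg _ _) (radCut_nonneg _ _)) (by positivity)
      have err : G (x, t) * (dd (sd 0) (dd (sd 0) φ) (x, t) + dd (sd 1) (dd (sd 1) φ) (x, t)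
          + dd (sd 2) (dd (sd 2) φ) (x, t))
          + G (x, t) * (w 0 (x, t) * dd (sd 0) φ (x, t) + w 1 (x, t) * dd (sd 1) φ (x, t)
            + w 2 (x, t) * dd (sd 2) φ (x, t))
          + 2 * G (x, t) * ρ (x, t) * (c0 (x, t) * dd (sd 0) φ (x, t)
            + c1 (x, t) * dd (sd 1) φ (x, t))
          ≤ (shell R).indicator (fun x => 40 * c * speedSq w (x, t)) x := by
        rw [hφ, dd_dd_radCut, dd_dd_radCut, dd_dd_radCut, dd_radCut, dd_radCut, dd_radCut]
        simp only [sd_apply]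
        by_cases hsh : x ∈ shell R
        · rw [indicator_of_mem hsh]
          have ar := swirl_error_arith (n := sqn x) (G := G (x, t)) (Γ := Γ (x, t))
            (s := speedSq w (x, t)) (p := deriv prof (sqn x / R ^ 2))
            (p' := deriv (deriv prof) (sqn x / R ^ 2))
            (d := w 0 (x, t) * x 0 + w 1 (x, t) * x 1 + w 2 (x, t) * x 2) hR hsh.1 hsh.2 hc0
            (hc _).1 (hc _).2 (exc_nonneg _ _) (exc_le_abs hm.le _) (exc_le_sq hm.le _) hsp (by
              simp only [hΓ, swirl, sqn, speedSq]
              nlinarith [sq_nonneg (x 0 * w 0 (x, t) + x 1 * w 1 (x, t)),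
                sq_nonneg (x 2 * w 0 (x, t)), sq_nonneg (x 2 * w 1 (x, t)),
                sq_nonneg (x 2 * w 2 (x, t)), sq_nonneg (x 0 * w 2 (x, t)),
                sq_nonneg (x 1 * w 2 (x, t))]) (by
              simp only [sqn, speedSq]
              nlinarith [sq_nonneg (x 0 * w 1 (x, t) - x 1 * w 0 (x, t)),
                sq_nonneg (x 0 * w 2 (x, t) - x 2 * w 0 (x, t)),
                sq_nonneg (x 1 * w 2 (x, t) - x 2 * w 1 (x, t))])
          refine le_trans (le_of_eq ?_) ar
          have hρ1 : ρ (x, t) * (x 0 ^ 2 + x 1 ^ 2) = 1 := inv_mul_cancel₀ hne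
          simp only [c0, c1]
          have e1 : sqn x = x 0 ^ 2 + x 1 ^ 2 + x 2 ^ 2 := rfl
          simp
          generalize deriv prof (sqn x / R ^ 2) = p
          generalize deriv (deriv prof) (sqn x / R ^ 2) = p'
          rw [e1]
          have hR0 : R ≠ 0 := hR.ne'
          field_simp
          linear_combination (4 * R ^ 2 * p * G (x, t)) * hρ1
        · rw [indicator_of_notMem hsh]
          have hout : sqn x / R ^ 2 < 1 ∨ 2 < sqn x / R ^ 2 := by
            by_contra hcon
            push Not at hcon
            refine hsh ⟨?_, ?_⟩
            · have := (le_div_iff₀ (by positivity : 0 < R ^ 2)).1 hcon.1; linarith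
            · exact (div_le_iff₀ (by positivity : 0 < R ^ 2)).1 hcon.2
          rw [(deriv_prof_eq_zero hout).1, (deriv_prof_eq_zero hout).2]
          simp
      have id' : dd td Z (x, t) = _ := id
      rw [id']
      change _ ≤ (shell R).indicator (fun x => 40 * c * speedSq w (x, t)) x
        + dd (sd 0) (fun p => G1 p * φ p * dd (sd 0) Γ p - G p * dd (sd 0) φ p
    - G p * φ p * w 0 p + G1 p * φ p * π p * c1 p) (x, t)
        + dd (sd 1) (fun p => G1 p * φ p * dd (sd 1) Γ p - G p * dd (sd 1) φ p
    - G p * φ p * w 1 p - G1 p * φ p * π p * c0 p) (x, t)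
        + dd (sd 2) (fun p => G1 p * φ p * dd (sd 2) Γ p - G p * dd (sd 2) φ p
    - G p * φ p * w 2 p) (x, t)
        - 2 * (dd (sd 0) (fun p => φ p * G p * c0 p * ρ p) (x, t)
          + dd (sd 1) (fun p => φ p * G p * c1 p * ρ p) (x, t))
      linarith
  have csp : Continuous (speedSq w) := by
    unfold speedSq
    have := w0.continuous
    have := w1.continuous
    have := w2.continuous
    fun_prop
  have slice : ∀ t ∈ Ioo a b, ∫ x, dd td Z (x, t) ≤
      40 * c * ∫ x in shell R, speedSq w (x, t) := by
    intro t ht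
    have iI : Integrable ((shell R).indicator (fun x => 40 * c * speedSq w (x, t))) := by
      rw [integrable_indicator_iff (isCompact_shell hR).measurableSet]
      exact ContinuousOn.integrableOn_compact (isCompact_shell hR) (by fun_prop)
    have iZ := integrable_slice (μ := volume) (continuous_dd td sZ) hK
      (dd_eq_zero_of_notMem hK zZ td) t
    have iX : ∀ {f : E3 × ℝ → ℝ} (e : E3 × ℝ), ContDiff ℝ 1 f → (∀ x ∉ K, ∀ t, f (x, t) = 0) →
        Integrable (fun x => dd e f (x, t)) := fun e hf hz =>
      integrable_slice (continuous_dd e hf) hK (dd_eq_zero_of_notMem hK hz e) t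
    have nX : ∀ {f : E3 × ℝ → ℝ} (j : Fin 3), ContDiff ℝ 1 f → (∀ x ∉ K, ∀ t, f (x, t) = 0) →
        ∫ x, dd (sd j) f (x, t) = 0 := fun j hf hz =>
      integral_slice_dd_eq_zero hf hK hz _ t
    have i0 := iX (sd 0) sX0 zX0
    have i1 := iX (sd 1) sX1 zX1
    have i2 := iX (sd 2) sX2 zX2
    have j0 := iX (sd 0) sY0 zY0
    have j1 := iX (sd 1) sY1 zY1
    have st := integral_mono iZ ((((iI.add i0).add i1).add i2).sub ((j0.add j1).const_mul 2))
      (fun x => main x t ht)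
    rw [integral_sub' (((iI.add i0).add i1).add i2) ((j0.add j1).const_mul 2),
      integral_add' ((iI.add i0).add i1) i2, integral_add' (iI.add i0) i1, integral_add' iI i0,
      nX 0 sX0 zX0, nX 1 sX1 zX1, nX 2 sX2 zX2, integral_const_mul, integral_add' j0 j1,
      nX 0 sY0 zY0, nX 1 sY1 zY1, integral_indicator (isCompact_shell hR).measurableSet,
      integral_const_mul] at st
    linarith
  have ftc := integral_slice_sub (μ := volume) sZ hK zZ t₀ t₁
  have cS : Continuous fun t => ∫ x in shell R, speedSq w (x, t) :=
    continuous_parametric_integral_of_continuous (f := fun t x => speedSq w (x, t))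
      (by fun_prop) (isCompact_shell hR)
  have cZ : Continuous fun t => ∫ x, dd td Z (x, t) :=
    continuous_integral_slice (continuous_dd td sZ) hK (dd_eq_zero_of_notMem hK zZ td)
  have fin : ∫ t in t₀..t₁, ∫ x, dd td Z (x, t) ≤
      ∫ t in t₀..t₁, 40 * c * ∫ x in shell R, speedSq w (x, t) :=
    intervalIntegral.integral_mono_on h01 (cZ.intervalIntegrable _ _)
      ((cS.const_mul _).intervalIntegrable _ _)
      (fun t ht => slice t ⟨ha.trans_le ht.1, ht.2.trans_lt hb⟩)
  rw [intervalIntegral.integral_const_mul] at fin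
  have ftc' : ∫ t in t₀..t₁, ∫ x, dd td Z (x, t) = (∫ x, Z (x, t₁)) - ∫ x, Z (x, t₀) := ftc
  rw [ftc'] at fin
  change ∫ x, Z (x, t₁) ≤ (∫ x, Z (x, t₀)) + _
  linarith

/-! ### The maximum principle for the swirl. -/

/-- The swirl `r u_θ` of a vector field. -/
def circ (u : E3 → E3) (x : E3) : ℝ := x 0 * u x 1 - x 1 * u x 0

theorem abs_circ_le (u : E3 → E3) (x : E3) : |circ u x| ≤ ‖x‖ * ‖u x‖ := by
  refine abs_le_of_sq_le_sq ?_ (by positivity)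
  rw [mul_pow, ← sqn_eq x, ← sqn_eq (u x)]
  unfold circ sqn
  nlinarith [sq_nonneg (x 0 * u x 0 + x 1 * u x 1), sq_nonneg (x 2 * u x 0), sq_nonneg (x 2 * u x 1),
    sq_nonneg (x 2 * u x 2), sq_nonneg (x 0 * u x 2), sq_nonneg (x 1 * u x 2)]

theorem circ_sub (u u' : E3 → E3) (x : E3) :
    circ (fun y => u y - u' y) x = circ u x - circ u' x := by
  simp only [circ, PiLp.sub_apply]; ring

/-- The localized excess of the swirl above the level `m`. -/
def locEx (m R : ℝ) (u : E3 → E3) : ℝ := ∫ x, exc m (circ u x) * radCut R (x, 0)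

theorem continuous_circ {u : E3 → E3} (hu : Continuous u) : Continuous (circ u) := by
  unfold circ; fun_prop

theorem continuous_exc_circ {u : E3 → E3} (hu : Continuous u) (m R : ℝ) :
    Continuous fun x => exc m (circ u x) * radCut R (x, 0) :=
  ((contDiff_exc m).continuous.comp (continuous_circ hu)).mul
    ((smooth_radCut R).continuous.comp (by fun_prop))

theorem hasCompactSupport_exc_circ (u : E3 → E3) (m : ℝ) {R : ℝ} (hR : 0 < R) :
    HasCompactSupport fun x => exc m (circ u x) * radCut R (x, 0) := by
  refine HasCompactSupport.intro (isCompact_sqn_le hR) fun x hx => ?_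
  rw [radCut_eq_zero hR (not_le.1 hx).le, mul_zero]

/-- The cutoff at scale `R` lives in `|x| ≤ √2 R`, while the one at scale `R'` equals `1` on `|x| ≤
R'`; a factor `2` between the scales makes the cutoffs pointwise ordered. -/
theorem locEx_mono {u : E3 → E3} (hu : Continuous u) {m R R' : ℝ} (hR : 0 < R)
    (hRR' : 2 * R ≤ R') : locEx m R u ≤ locEx m R' u := by
  have hR' : 0 < R' := by linarith
  refine integral_mono
    ((continuous_exc_circ hu m R).integrable_of_hasCompactSupport (hasCompactSupport_exc_circ u m hR))
    ((continuous_exc_circ hu m R').integrable_of_hasCompactSupport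
      (hasCompactSupport_exc_circ u m hR')) fun x => ?_
  refine mul_le_mul_of_nonneg_left ?_ (exc_nonneg _ _)
  rcases le_total (sqn x) (R' ^ 2) with h | h
  · rw [radCut_eq_one hR' h]; exact radCut_le_one _ _
  · rw [radCut_eq_zero hR (by nlinarith)]; exact radCut_nonneg _ _

theorem locEx_pos {u : E3 → E3} (hu : Continuous u) {m R : ℝ} (hR : 0 < R) {x : E3}
    (hx : sqn x ≤ R ^ 2) (hm : m < |circ u x|) : 0 < locEx m R u := by
  refine (continuous_exc_circ hu m R).integral_pos_of_hasCompactSupport_nonneg_nonzero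
    (hasCompactSupport_exc_circ u m hR)
    (fun y => mul_nonneg (exc_nonneg _ _) (radCut_nonneg _ _)) (x := x) ?_
  rw [radCut_eq_one hR hx, mul_one]
  exact (exc_pos hm).ne'

/-- The outer and inner radii of a shell have ratio `√2`, which is less than the dyadic step. -/
theorem pairwise_disjoint_shell {R : ℝ} (hR : 0 < R) :
    Pairwise (Function.onFun Disjoint fun n : ℕ => shell (2 ^ n * R)) := by
  have key : ∀ i j : ℕ, i < j → Disjoint (shell (2 ^ i * R)) (shell (2 ^ j * R)) := by
    intro i j hij
    rw [Set.disjoint_left]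
    intro x hx hx'
    have h1 : sqn x ≤ 2 * (2 ^ i * R) ^ 2 := hx.2
    have h2 : (2 ^ j * R) ^ 2 ≤ sqn x := hx'.1
    have h3 : 2 * (2 ^ i * R) ≤ 2 ^ j * R := by
      have : (2 : ℝ) ^ (i + 1) ≤ 2 ^ j := pow_le_pow_right₀ (by norm_num) hij
      rw [pow_succ] at this
      nlinarith
    have h4 : 0 < 2 ^ i * R := by positivity
    nlinarith
  intro i j hij
  rcases lt_or_gt_of_ne hij with h | h
  · exact key i j h
  · exact (key j i h).symm

theorem continuous_velocity {T : ℝ} {v : E3 → ℝ → E3} {p : E3 → ℝ → ℝ}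
    (hv : IsSmoothNSSolution T v p) {t : ℝ} (ht : t ∈ Ioo (-T) 0) : Continuous fun x => v x t := by
  have := hv.smooth_velocity.continuousOn
  exact this.comp_continuous (f := fun x : E3 => (x, t)) (by fun_prop) fun x => ⟨mem_univ _, ht⟩

theorem integrable_normSq {T : ℝ} {v₀ : E3 → E3} {v : E3 → ℝ → E3} {p : E3 → ℝ → ℝ}
    (hv₀ : MemLp v₀ 2 volume) (hv : IsSmoothNSSolution T v p) (hL : IsLerayHopf T v₀ v) {t : ℝ}
    (ht : t ∈ Ioo (-T) 0) :
    Integrable (fun x => ‖v x t‖ ^ 2) ∧ ∫ x, ‖v x t‖ ^ 2 ≤ ∫ x, ‖v₀ x‖ ^ 2 := by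
  have h0 : Integrable (fun x => ‖v₀ x‖ ^ 2) := hv₀.integrable_norm_pow (by norm_num)
  have hE := hL.energy t ht
  have hle : (∫⁻ x, ENNReal.ofReal (‖v x t‖ ^ 2)) ≤ ∫⁻ x, ENNReal.ofReal (‖v₀ x‖ ^ 2) :=
    le_self_add.trans hE
  rw [← ofReal_integral_eq_lintegral_ofReal h0 (ae_of_all _ fun x => by positivity)] at hle
  have hc : Continuous fun x => ‖v x t‖ ^ 2 := (continuous_velocity hv ht).norm.pow 2
  have hi : Integrable (fun x => ‖v x t‖ ^ 2) := by
    refine ⟨hc.aestronglyMeasurable, ?_⟩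
    rw [hasFiniteIntegral_iff_ofReal (ae_of_all _ fun x => by positivity)]
    exact hle.trans_lt ENNReal.ofReal_lt_top
  refine ⟨hi, ?_⟩
  rw [← ofReal_integral_eq_lintegral_ofReal hi (ae_of_all _ fun x => by positivity)] at hle
  exact (ENNReal.ofReal_le_ofReal_iff (integral_nonneg fun x => by positivity)).1 hle

/-- Dyadic summation: the energy in disjoint shells adds up to at most the total energy. -/
theorem card_mul_locEx_le {T : ℝ} {v₀ : E3 → E3} {v : E3 → ℝ → E3} {p : E3 → ℝ → ℝ}
    (hv₀ : MemLp v₀ 2 volume) (hv : IsSmoothNSSolution T v p)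
    (hax : ∀ t ∈ Ioo (-T) 0, IsAxisymmetric fun x => v x t) (hL : IsLerayHopf T v₀ v)
    {c : ℝ} (hc0 : 0 < c) (hc : ∀ s, |deriv prof s| ≤ c ∧ |deriv (deriv prof) s| ≤ c)
    {m R : ℝ} (hm : 0 < m) (hR : 0 < R) {t₀ t₁ : ℝ} (h0 : -T < t₀) (h01 : t₀ ≤ t₁) (h1 : t₁ < 0)
    (L : ℕ) :
    L * locEx m R (fun x => v x t₁) ≤
      (∑ n ∈ Finset.range L, locEx m (2 ^ (n + 1) * R) (fun x => v x t₀))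
        + 40 * c * (T * ∫ x, ‖v₀ x‖ ^ 2) := by
  obtain ⟨a, ha, ha'⟩ := exists_between h0
  obtain ⟨b, hb, hb'⟩ := exists_between h1
  have hab : a < b := ha'.trans_le (h01.trans hb.le)
  obtain ⟨w, π, F, hw⟩ := exists_smoothFlow hv hax ha hab hb'
  have hsp : ∀ x, ∀ t ∈ Icc a b, speedSq w (x, t) = ‖v x t‖ ^ 2 := fun x t ht => by
    rw [← sqn_eq, speedSq, sqn, hw 0 x t ht, hw 1 x t ht, hw 2 x t ht]
  have hlocEx : ∀ R, ∀ t ∈ Icc a b,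
      ∫ x, exc m (swirl w (x, t)) * radCut R (x, t) = locEx m R (fun x => v x t) := by
    intro R t ht
    refine integral_congr_ae (ae_of_all _ fun x => ?_)
    simp only [swirl, circ, hw 0 x t ht, hw 1 x t ht]
    rfl
  have ht0 : t₀ ∈ Icc a b := ⟨ha'.le, h01.trans hb.le⟩
  have ht1 : t₁ ∈ Icc a b := ⟨ha'.le.trans h01, hb.le⟩
  have hspc : Continuous (speedSq w) := by
    have h := fun i => (F.smooth_w i).continuous
    exact (((h 0).pow 2).add ((h 1).pow 2)).add ((h 2).pow 2)
  have hpos : ∀ n : ℕ, 0 < 2 ^ (n + 1) * R := fun n => by positivity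
  have hcont : ∀ n : ℕ, Continuous fun t => ∫ x in shell (2 ^ (n + 1) * R), speedSq w (x, t) :=
    fun n => continuous_parametric_integral_of_continuous (f := fun t x => speedSq w (x, t))
      (hspc.comp (by fun_prop)) (isCompact_shell (hpos n))
  have hstep : ∀ n ∈ Finset.range L, locEx m R (fun x => v x t₁) ≤
      locEx m (2 ^ (n + 1) * R) (fun x => v x t₀)
        + 40 * c * ∫ t in t₀..t₁, ∫ x in shell (2 ^ (n + 1) * R), speedSq w (x, t) := by
    intro n _
    have h := swirl_excess_le F hm (hpos n) hc0 hc h01 ha' hb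
    rw [hlocEx _ _ ht0, hlocEx _ _ ht1] at h
    refine (locEx_mono (continuous_velocity hv ⟨h0.trans_le h01, h1⟩) hR ?_).trans h
    have : (1 : ℝ) ≤ 2 ^ n := one_le_pow₀ (by norm_num)
    rw [pow_succ]; nlinarith
  have hsum := Finset.sum_le_sum hstep
  rw [Finset.sum_const, Finset.card_range, nsmul_eq_mul, Finset.sum_add_distrib,
    ← Finset.mul_sum, ← intervalIntegral.integral_finsetSum fun n _ =>
      (hcont n).intervalIntegrable _ _] at hsum
  refine hsum.trans ?_
  gcongr
  have hE0 : 0 ≤ ∫ x, ‖v₀ x‖ ^ 2 := integral_nonneg fun x => by positivity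
  have hbound : ∀ t ∈ Icc t₀ t₁,
      ∑ n ∈ Finset.range L, ∫ x in shell (2 ^ (n + 1) * R), speedSq w (x, t)
        ≤ ∫ x, ‖v₀ x‖ ^ 2 := by
    intro t ht
    have htab : t ∈ Icc a b := ⟨ht0.1.trans ht.1, ht.2.trans ht1.2⟩
    obtain ⟨hi, hle⟩ := integrable_normSq hv₀ hv hL (t := t) ⟨h0.trans_le ht.1, ht.2.trans_lt h1⟩
    have e : (fun x => speedSq w (x, t)) = fun x => ‖v x t‖ ^ 2 := funext fun x => hsp x t htab
    simp only [e]
    rw [← integral_biUnion_finset]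
    · exact (setIntegral_le_integral hi (ae_of_all _ fun x => by positivity)).trans hle
    · exact fun n _ => (isCompact_shell (hpos n)).isClosed.measurableSet
    · intro i _ j _ hij
      exact pairwise_disjoint_shell hR (fun h => hij (Nat.succ_injective h) : i + 1 ≠ j + 1)
    · exact fun n _ => hi.integrableOn
  calc ∫ t in t₀..t₁, ∑ n ∈ Finset.range L, ∫ x in shell (2 ^ (n + 1) * R), speedSq w (x, t)
      ≤ ∫ _ in t₀..t₁, ∫ x, ‖v₀ x‖ ^ 2 := by
        refine intervalIntegral.integral_mono_on h01 ?_ (by simp) hbound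
        exact (continuous_finsetSum _ fun n _ => hcont n).intervalIntegrable _ _
    _ = (t₁ - t₀) * ∫ x, ‖v₀ x‖ ^ 2 := by simp
    _ ≤ T * ∫ x, ‖v₀ x‖ ^ 2 := by gcongr; linarith

theorem ae_abs_circ_le {v₀ : E3 → E3}
    (hswirl : MemLp (fun x => rad x * compTheta v₀ x) ⊤ volume) :
    ∀ᵐ x, |circ v₀ x| ≤ swirlNorm v₀ := by
  have h := ae_le_eLpNormEssSup (f := fun x => rad x * compTheta v₀ x) (μ := (volume : Measure E3))
  filter_upwards [h] with x hx
  have e : rad x * compTheta v₀ x = circ v₀ x := rad_mul_compTheta v₀ x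
  rw [e, ← eLpNorm_exponent_top] at hx
  have := ENNReal.toReal_mono hswirl.2.ne hx
  rwa [toReal_enorm, Real.norm_eq_abs] at this

/-- Since `|Γ₀| ≤ m` almost everywhere, the excess is at most `|Γ - Γ₀| ≤ |x| |v - v₀|`. On the
support of the cutoff Hölder's inequality bounds its integral by the `L²` distance to the data,
which tends to zero. -/
theorem tendsto_locEx_zero {T : ℝ} (hT : 0 < T) {v₀ : E3 → E3} {v : E3 → ℝ → E3}
    {p : E3 → ℝ → ℝ} (hv₀ : MemLp v₀ 2 volume)
    (hswirl : MemLp (fun x => rad x * compTheta v₀ x) ⊤ volume)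
    (hv : IsSmoothNSSolution T v p) (hL : IsLerayHopf T v₀ v) {m R : ℝ} (hm : swirlNorm v₀ ≤ m)
    (hR : 0 < R) :
    Tendsto (fun t => locEx m R (fun x => v x t)) (𝓝[>] (-T)) (𝓝 0) := by
  have hm0 : 0 ≤ m := ENNReal.toReal_nonneg.trans hm
  set B : Set E3 := {x | sqn x ≤ 2 * R ^ 2} with hB
  have hBm : MeasurableSet B := (isCompact_sqn_le hR).isClosed.measurableSet
  have hBf : (volume : Measure E3) B < ⊤ := (isCompact_sqn_le hR).measure_lt_top
  set D : ENNReal := ENNReal.ofReal (2 * R) * volume B ^ (1 / (1 : ENNReal).toReal - 1 / (2 : ENNReal).toReal)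
  have hD : D ≠ ⊤ := by
    refine ENNReal.mul_ne_top ENNReal.ofReal_ne_top (ENNReal.rpow_ne_top_of_nonneg ?_ hBf.ne)
    norm_num
  have hlim : Tendsto (fun t => (D * eLpNorm (fun x => v x t - v₀ x) 2 volume).toReal)
      (𝓝[>] (-T)) (𝓝 0) := by
    have h1 : Tendsto (fun t => D * eLpNorm (fun x => v x t - v₀ x) 2 volume) (𝓝[>] (-T)) (𝓝 0) := by
      simpa using ENNReal.Tendsto.const_mul hL.initial (Or.inr hD)
    exact (ENNReal.tendsto_toReal ENNReal.zero_ne_top).comp h1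
  -- Only finiteness of the `L²` distance is used; without it `toReal` would return `0` and the
  -- upper bound would be void.
  have hfin : ∀ᶠ t in 𝓝[>] (-T), eLpNorm (fun x => v x t - v₀ x) 2 volume < 1 :=
    hL.initial.eventually (gt_mem_nhds (by norm_num))
  refine squeeze_zero' (Eventually.of_forall fun t => integral_nonneg fun x =>
    mul_nonneg (exc_nonneg _ _) (radCut_nonneg _ _)) ?_ hlim
  have hmem : ∀ᶠ t in 𝓝[>] (-T), t ∈ Ioo (-T) 0 := Ioo_mem_nhdsGT (by linarith)
  filter_upwards [hfin, hmem] with t htf ht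
  have hfc := continuous_exc_circ (continuous_velocity hv ht) m R
  unfold locEx
  rw [integral_eq_lintegral_of_nonneg_ae (ae_of_all _ fun x =>
    mul_nonneg (exc_nonneg _ _) (radCut_nonneg _ _)) hfc.aestronglyMeasurable]
  refine ENNReal.toReal_mono (ENNReal.mul_ne_top hD (htf.trans ENNReal.one_lt_top).ne) ?_
  have hsm : AEStronglyMeasurable (fun x => v x t - v₀ x) (volume.restrict B) :=
    ((continuous_velocity hv ht).aestronglyMeasurable.sub hv₀.1).restrict
  calc ∫⁻ x, ENNReal.ofReal (exc m (circ (fun x => v x t) x) * radCut R (x, 0))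
      ≤ ∫⁻ x, B.indicator (fun x => ENNReal.ofReal (2 * R) * ‖v x t - v₀ x‖ₑ) x := by
        refine lintegral_mono_ae ?_
        filter_upwards [ae_abs_circ_le hswirl] with x hx
        by_cases hxB : x ∈ B
        · rw [indicator_of_mem hxB, ← ofReal_norm,
            ← ENNReal.ofReal_mul (by positivity)]
          refine ENNReal.ofReal_le_ofReal ?_
          have h1 : exc m (circ (fun x => v x t) x) ≤ |circ (fun y => v y t - v₀ y) x| := by
            refine (exc_le_max hm0 _).trans (max_le ?_ (abs_nonneg _))
            rw [circ_sub]
            have := abs_sub_abs_le_abs_sub (circ (fun x => v x t) x) (circ v₀ x)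
            linarith
          have h2 := abs_circ_le (fun y => v y t - v₀ y) x
          have h3 : ‖x‖ ≤ 2 * R := by
            have hx' : sqn x ≤ 2 * R ^ 2 := hxB
            rw [sqn_eq] at hx'
            nlinarith [norm_nonneg x]
          calc exc m (circ (fun x => v x t) x) * radCut R (x, 0)
              ≤ exc m (circ (fun x => v x t) x) * 1 :=
                mul_le_mul_of_nonneg_left (radCut_le_one _ _) (exc_nonneg _ _)
            _ ≤ ‖x‖ * ‖v x t - v₀ x‖ := by rw [mul_one]; exact h1.trans h2
            _ ≤ _ := by gcongr
        · rw [indicator_of_notMem hxB, radCut_eq_zero hR (not_le.1 hxB).le]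
          simp
    _ = ENNReal.ofReal (2 * R) * eLpNorm (fun x => v x t - v₀ x) 1 (volume.restrict B) := by
        rw [lintegral_indicator hBm, lintegral_const_mul' _ _ ENNReal.ofReal_ne_top,
          eLpNorm_one_eq_lintegral_enorm]
    _ ≤ ENNReal.ofReal (2 * R) * (eLpNorm (fun x => v x t - v₀ x) 2 (volume.restrict B)
          * volume B ^ (1 / (1 : ENNReal).toReal - 1 / (2 : ENNReal).toReal)) := by
        gcongr
        have := eLpNorm_le_eLpNorm_mul_rpow_measure_univ (p := 1) (q := 2) (by norm_num) hsm
        rwa [Measure.restrict_apply_univ] at this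
    _ ≤ ENNReal.ofReal (2 * R) * (eLpNorm (fun x => v x t - v₀ x) 2 volume
          * volume B ^ (1 / (1 : ENNReal).toReal - 1 / (2 : ENNReal).toReal)) := by
        gcongr
        exact Measure.restrict_le_self
    _ = D * eLpNorm (fun x => v x t - v₀ x) 2 volume := by
        simp only [D]; ring

/-- The maximum principle for the swirl. -/
theorem abs_circ_le_swirlNorm {T : ℝ} (hT : 0 < T) {v₀ : E3 → E3} {v : E3 → ℝ → E3}
    {p : E3 → ℝ → ℝ} (hv₀ : MemLp v₀ 2 volume)
    (hswirl : MemLp (fun x => rad x * compTheta v₀ x) ⊤ volume)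
    (hv : IsSmoothNSSolution T v p) (hax : ∀ t ∈ Ioo (-T) 0, IsAxisymmetric fun x => v x t)
    (hL : IsLerayHopf T v₀ v) {t : ℝ} (ht : t ∈ Ioo (-T) 0) (x : E3) :
    |circ (fun y => v y t) x| ≤ swirlNorm v₀ := by
  by_contra! hcon
  obtain ⟨m, hm, hm'⟩ := exists_between hcon
  have hm0 : 0 < m := ENNReal.toReal_nonneg.trans_lt hm
  obtain ⟨c, hc0, hc⟩ := exists_prof_bound
  set R : ℝ := ‖x‖ + 1 with hRdef
  have hR : 0 < R := by positivity
  have hxR : sqn x ≤ R ^ 2 := by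
    rw [sqn_eq]; gcongr; linarith
  have hδ := locEx_pos (continuous_velocity hv ht) hR hxR hm'
  set δ := locEx m R (fun y => v y t)
  set S := 40 * c * (T * ∫ x, ‖v₀ x‖ ^ 2)
  -- For fixed `L` the initial time tends to `-T` first, which removes the finitely many initial
  -- excesses. The remaining bound `S` does not depend on `L`, so letting `L` grow contradicts `δ >
  -- 0`.
  have hall : ∀ L : ℕ, L * δ ≤ S := by
    intro L
    have hlim : Tendsto (fun s => (∑ n ∈ Finset.range L, locEx m (2 ^ (n + 1) * R) (fun x => v x s))
        + S) (𝓝[>] (-T)) (𝓝 (0 + S)) := by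
      refine Tendsto.add ?_ tendsto_const_nhds
      have h := tendsto_finsetSum (Finset.range L) fun n _ =>
        tendsto_locEx_zero hT hv₀ hswirl hv hL (R := 2 ^ (n + 1) * R) hm.le (by positivity)
      rwa [Finset.sum_const_zero] at h
    rw [zero_add] at hlim
    refine ge_of_tendsto hlim ?_
    filter_upwards [Ioo_mem_nhdsGT ht.1] with s hs
    exact card_mul_locEx_le hv₀ hv hax hL hc0 hc hm0 hR hs.1 hs.2.le ht.2 L
  obtain ⟨L, hL'⟩ := exists_nat_gt (S / δ)
  have := hall L
  rw [div_lt_iff₀ hδ] at hL'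
  linarith

/-! ### Comparison of meridional integrals with integrals over balls. -/

/-- Coordinates on three-space: height and horizontal position. -/
def splitEquiv : E3 ≃ᵐ ℝ × (ℝ × ℝ) :=
  ((MeasurableEquiv.toLp 2 (Fin 3 → ℝ)).symm.trans
    (MeasurableEquiv.piFinSuccAbove (fun _ : Fin 3 => ℝ) 2)).trans
      ((MeasurableEquiv.refl ℝ).prodCongr MeasurableEquiv.finTwoArrow)

theorem measurePreserving_splitEquiv : MeasurePreserving splitEquiv volume volume :=
  ((EuclideanSpace.volume_preserving_symm_measurableEquiv_toLp (Fin 3)).trans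
    (volume_preserving_piFinSuccAbove (fun _ : Fin 3 => ℝ) 2)).trans
      ((MeasurePreserving.id volume).prod (volume_preserving_finTwoArrow ℝ))

/-- Polar coordinates produce the Jacobian `2πρ`, which exceeds `1` for `ρ ≥ 1/2`; smaller radii do
not contribute. -/
theorem lintegral_polar_ge {f : ℝ → ENNReal} (hf : Measurable f) (h0 : ∀ ρ < 1 / 2, f ρ = 0) :
    ∫⁻ ρ, f ρ ≤ ∫⁻ p : ℝ × ℝ, f (Real.sqrt (p.1 ^ 2 + p.2 ^ 2)) := by
  rw [← lintegral_comp_polarCoord_symm]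
  have e : ∀ p ∈ polarCoord.target, ENNReal.ofReal p.1 •
      f (Real.sqrt ((polarCoord.symm p).1 ^ 2 + (polarCoord.symm p).2 ^ 2))
        = ENNReal.ofReal p.1 * f p.1 := by
    rintro ⟨ρ, θ⟩ hp
    have hρ : 0 < ρ := hp.1
    have : (ρ * Real.cos θ) ^ 2 + (ρ * Real.sin θ) ^ 2 = ρ ^ 2 := by
      linear_combination ρ ^ 2 * Real.cos_sq_add_sin_sq θ
    simp only [polarCoord_symm_apply, this, Real.sqrt_sq hρ.le, smul_eq_mul]
  rw [setLIntegral_congr_fun polarCoord.open_target.measurableSet e, polarCoord_target,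
    Measure.volume_eq_prod, ← Measure.prod_restrict, lintegral_prod _ (by fun_prop)]
  rw [← lintegral_indicator measurableSet_Ioi]
  refine lintegral_mono fun ρ => ?_
  by_cases hρ : ρ < 1 / 2
  · rw [h0 ρ hρ]; exact zero_le
  push Not at hρ
  have hρ0 : ρ ∈ Ioi (0 : ℝ) := by simp only [mem_Ioi]; linarith
  rw [indicator_of_mem hρ0]
  simp only [lintegral_const, Measure.restrict_apply_univ, Real.volume_Ioo]
  have h1 : 1 ≤ ENNReal.ofReal ρ * ENNReal.ofReal (Real.pi - -Real.pi) := by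
    rw [← ENNReal.ofReal_mul (by linarith), ← ENNReal.ofReal_one]
    refine ENNReal.ofReal_le_ofReal ?_
    nlinarith [Real.pi_gt_three]
  calc f ρ = 1 * f ρ := (one_mul _).symm
    _ ≤ (ENNReal.ofReal ρ * ENNReal.ofReal (Real.pi - -Real.pi)) * f ρ := by gcongr
    _ = _ := by ring

/-- An integral over the meridional box is controlled by an integral over three-space. -/
theorem integral_box_le {G : E3 → ℝ} (hG : Integrable G) (hG0 : ∀ y, 0 ≤ G y) {h : ℝ × ℝ → ℝ}
    (hh : Continuous h) (hh0 : ∀ q, 0 ≤ h q)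
    (hle : ∀ y, (rad y, y 2) ∈ box → h (rad y, y 2) ≤ G y) : ∫ q in box, h q ≤ ∫ y, G y := by
  have hbm : MeasurableSet box := isCompact_box.isClosed.measurableSet
  set F : ℝ × ℝ → ENNReal := box.indicator fun q => ENNReal.ofReal (h q)
  have hF : Measurable F := (hh.measurable.ennreal_ofReal).indicator hbm
  have hF0 : ∀ ζ ρ, ρ < 1 / 2 → F (ρ, ζ) = 0 := fun ζ ρ hρ =>
    indicator_of_notMem (fun hm => by linarith [half_le_of_mem_box hm]) _
  have key : ∫⁻ q, F q ≤ ∫⁻ y, ENNReal.ofReal (G y) := by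
    calc ∫⁻ q, F q = ∫⁻ ζ, ∫⁻ ρ, F (ρ, ζ) := by
          rw [Measure.volume_eq_prod, lintegral_prod_symm _ hF.aemeasurable]
      _ ≤ ∫⁻ ζ, ∫⁻ p : ℝ × ℝ, F (Real.sqrt (p.1 ^ 2 + p.2 ^ 2), ζ) :=
          lintegral_mono fun ζ => lintegral_polar_ge (f := fun ρ => F (ρ, ζ)) (by fun_prop) (hF0 ζ)
      _ = ∫⁻ z : ℝ × (ℝ × ℝ), F (Real.sqrt (z.2.1 ^ 2 + z.2.2 ^ 2), z.1) := by
          rw [Measure.volume_eq_prod ℝ (ℝ × ℝ), lintegral_prod]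
          exact (hF.comp (by fun_prop)).aemeasurable
      _ = ∫⁻ y : E3, F (rad y, y 2) := by
          have hm : Measurable fun z : ℝ × (ℝ × ℝ) => F (Real.sqrt (z.2.1 ^ 2 + z.2.2 ^ 2), z.1) :=
            hF.comp (by fun_prop)
          rw [← measurePreserving_splitEquiv.lintegral_comp hm]
          rfl
      _ ≤ ∫⁻ y, ENNReal.ofReal (G y) := by
          refine lintegral_mono fun y => ?_
          by_cases hy : (rad y, y 2) ∈ box
          · simp only [F, indicator_of_mem hy]
            exact ENNReal.ofReal_le_ofReal (hle y hy)
          · simp only [F, indicator_of_notMem hy]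
            exact zero_le
  have hi : IntegrableOn h box := hh.continuousOn.integrableOn_compact isCompact_box
  rw [lintegral_indicator hbm, ← ofReal_integral_eq_lintegral_ofReal hi (ae_of_all _ hh0),
    ← ofReal_integral_eq_lintegral_ofReal hG (ae_of_all _ hG0)] at key
  exact (ENNReal.ofReal_le_ofReal_iff (integral_nonneg hG0)).1 key

/-- The whole solid of revolution generated by the rescaled box fits into the ball of radius `4r`.
In the worst case, a point on the opposite side of the axis, the squared distance is `(5/2)² r² +
(1/2)² r²`, below `16 r²`. -/
theorem dist_lt_of_box {x y : E3} (hx : 0 < rad x) (hy : rad y ≤ 3 / 2 * rad x)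
    (hz : |y 2 - x 2| ≤ rad x / 2) : dist y x < 4 * rad x := by
  rw [dist_eq_norm]
  refine lt_of_pow_lt_pow_left₀ 2 (by positivity) ?_
  rw [← sqn_eq]
  have h1 : rad x ^ 2 = x 0 ^ 2 + x 1 ^ 2 := Real.sq_sqrt (by positivity)
  have h2 : rad y ^ 2 = y 0 ^ 2 + y 1 ^ 2 := Real.sq_sqrt (by positivity)
  have h3 : 0 ≤ rad y := Real.sqrt_nonneg _
  have h4 : (y 2 - x 2) ^ 2 ≤ (rad x / 2) ^ 2 := sq_le_sq' (abs_le.1 hz).1 (abs_le.1 hz).2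
  have h5 : rad y ^ 2 ≤ (3 / 2 * rad x) ^ 2 := by gcongr
  simp only [sqn, PiLp.sub_apply]
  nlinarith [sq_nonneg (y 0 + x 0), sq_nonneg (y 1 + x 1), sq_pos_of_pos hx]

theorem continuous_rad : Continuous rad := by unfold rad; fun_prop

/-- The axis lies in a plane, hence is null. Cylindrical components degenerate there, so identities
between them and functions of `(r, z)` hold only almost everywhere. -/
theorem ae_rad_pos : ∀ᵐ y : E3, 0 < rad y := by
  have h : (volume : Measure E3) {y | ¬ 0 < rad y} = 0 := by
    let p : Submodule ℝ E3 := LinearMap.ker (EuclideanSpace.proj (𝕜 := ℝ) (0 : Fin 3)).toLinearMap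
    refine measure_mono_null (fun y hy => ?_) (Measure.addHaar_submodule volume p ?_)
    · have h0 : rad y = 0 := le_antisymm (not_lt.1 hy) (Real.sqrt_nonneg _)
      exact (rad_eq_zero_iff.1 h0).1
    · intro htop
      have : EuclideanSpace.single (0 : Fin 3) (1 : ℝ) ∈ p := htop ▸ Submodule.mem_top
      simp [p] at this
  exact h

theorem ae_eq_of_meridional {g : E3 → ℝ} {h : ℝ × ℝ → ℝ}
    (hle : ∀ y, 0 < rad y → g y = h (rad y, y 2)) : g =ᵐ[volume] fun y => h (rad y, y 2) := by
  filter_upwards [ae_rad_pos] with y hy using hle y hy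

theorem continuous_integral_ball {h : (ℝ × ℝ) × ℝ → ℝ} (hh : Continuous h) (x : E3) (R : ℝ) :
    Continuous fun s => ∫ y in Metric.ball x R, h ((rad y, y 2), s) := by
  have e : (Metric.ball x R : Set E3) =ᵐ[volume] Metric.closedBall x R :=
    ae_eq_of_subset_of_measure_ge Metric.ball_subset_closedBall
      (Measure.addHaar_closedBall_eq_addHaar_ball volume x R).le
      Metric.isOpen_ball.measurableSet.nullMeasurableSet (isCompact_closedBall x R).measure_lt_top.ne
  simp only [Measure.restrict_congr_set e]
  refine continuous_parametric_integral_of_continuous (f := fun s (y : E3) => h ((rad y, y 2), s)) ?_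
    (isCompact_closedBall x R)
  have := continuous_rad
  exact hh.comp (by fun_prop)

/-- Comparison of the rescaled meridional integral with the integral over a ball. -/
theorem integral_box_scaled_le {x : E3} (hx : 0 < rad x) {g : E3 → ℝ}
    (hg0 : ∀ y, 0 ≤ g y) {h : ℝ × ℝ → ℝ}
    (hh : Continuous h) (hh0 : ∀ q, 0 ≤ h q) (hle : ∀ y, 0 < rad y → g y = h (rad y, y 2)) :
    rad x ^ 3 * ∫ q in box, h (rad x * q.1, x 2 + rad x * q.2)
      ≤ ∫ y in Metric.ball x (4 * rad x), g y := by
  set l := rad x with hl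
  set B := Metric.ball x (4 * l)
  set c : E3 := !₂[0, 0, x 2] with hc
  have hBm : MeasurableSet B := Metric.isOpen_ball.measurableSet
  have hg : IntegrableOn g B := by
    have hc' : Continuous fun y : E3 => h (rad y, y 2) := by
      have := continuous_rad
      exact hh.comp (by fun_prop)
    exact ((hc'.continuousOn.integrableOn_compact (isCompact_closedBall x (4 * l))).mono_set
      Metric.ball_subset_closedBall).congr (ae_eq_of_meridional hle).symm.restrict
  set G : E3 → ℝ := B.indicator g
  have hG0 : ∀ y, 0 ≤ G y := fun y => indicator_nonneg (fun _ _ => hg0 _) y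
  have hGi : Integrable G := hg.integrable_indicator hBm
  have hGi' : Integrable fun y => G (l • y + c) :=
    (hGi.comp_add_right c).comp_smul hx.ne'
  have hscale : ∫ y, G (l • y + c) = (l ^ 3)⁻¹ * ∫ y in B, g y := by
    rw [Measure.integral_comp_smul volume (fun y => G (y + c)) l, integral_add_right_eq_self G c,
      integral_indicator hBm]
    simp [abs_of_pos hx]
  have hcoord : ∀ y : E3, rad (l • y + c) = l * rad y ∧ (l • y + c) 2 = x 2 + l * y 2 := by
    intro y
    constructor
    · have : (l • y + c) 0 ^ 2 + (l • y + c) 1 ^ 2 = l ^ 2 * (y 0 ^ 2 + y 1 ^ 2) := by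
        simp [hc]; ring
      rw [rad, this, Real.sqrt_mul (by positivity), Real.sqrt_sq hx.le]; rfl
    · simp [hc]; ring
  have key := integral_box_le (h := fun q => h (l * q.1, x 2 + l * q.2)) hGi' (fun y => hG0 _)
    (hh.comp (by fun_prop)) (fun q => hh0 _) (fun y hy => by
      obtain ⟨e1, e2⟩ := hcoord y
      have hyb := mem_box.1 hy
      have hy1 : 1 / 2 ≤ rad y := half_le_of_mem_box hy
      have hmem : l • y + c ∈ B := by
        refine dist_lt_of_box hx ?_ ?_
        · rw [e1]
          have := (abs_le.1 hyb.1).2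
          simp only at this
          nlinarith
        · rw [e2, add_sub_cancel_left, abs_mul, abs_of_pos hx]
          have := hyb.2
          simp only at this
          nlinarith
      simp only [G, indicator_of_mem hmem]
      rw [hle _ (by rw [e1]; positivity), e1, e2])
  rw [hscale] at key
  have hl3 : 0 < l ^ 3 := by positivity
  calc l ^ 3 * ∫ q in box, h (l * q.1, x 2 + l * q.2)
      ≤ l ^ 3 * ((l ^ 3)⁻¹ * ∫ y in B, g y) := by gcongr
    _ = _ := by rw [mul_inv_cancel_left₀ hl3.ne']

/-! ### The angular vorticity and the meridional energy on the half-plane. -/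

theorem hasDerivAt_line {u : E3 → E3} {x : E3} (hu : DifferentiableAt ℝ u x) (e : E3) (i : Fin 3) :
    HasDerivAt (fun s : ℝ => u (x + s • e) i) (fderiv ℝ u x e i) 0 := by
  have h1 : HasDerivAt (fun s : ℝ => x + s • e) e 0 := by
    simpa using ((hasDerivAt_id (0 : ℝ)).smul_const e).const_add x
  have h2 : HasFDerivAt u (fderiv ℝ u x) (x + (0 : ℝ) • e) := by simpa using hu.hasFDerivAt
  have h3 := h2.comp_hasDerivAt (0 : ℝ) h1
  exact (EuclideanSpace.proj (𝕜 := ℝ) i).hasFDerivAt.comp_hasDerivAt (0 : ℝ) h3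

theorem pd_eq_dd {u : E3 → E3} {x : E3} (hu : DifferentiableAt ℝ u x) {f : E3 × ℝ → ℝ}
    (hf : Differentiable ℝ f) {t : ℝ} {i : Fin 3} (h : ∀ y, f (y, t) = u y i) (j : Fin 3) :
    pd j u x i = dd (sd j) f (x, t) := by
  rw [sd, dd_slice hf]
  have h2 : (fun y => f (y, t)) = fun y => u y i := funext h
  rw [h2]
  have h3 := ((EuclideanSpace.proj (𝕜 := ℝ) i).hasFDerivAt.comp x hu.hasFDerivAt).fderiv
  have h4 : (fun y => u y i) = ((EuclideanSpace.proj (𝕜 := ℝ) i : E3 →L[ℝ] ℝ) : E3 → ℝ) ∘ u := rfl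
  rw [h4, h3]
  rfl

/-- The projection of a point to the meridional half-plane. -/
def merid (ρ ζ : ℝ) : E3 := !₂[ρ, 0, ζ]

theorem rad_merid {ρ : ℝ} (hρ : 0 ≤ ρ) (ζ : ℝ) : rad (merid ρ ζ) = ρ :=
  rad_of_snd_eq_zero rfl hρ

/-- The angular vorticity of an axially symmetric field is determined on the half-plane. -/
theorem compTheta_curl_eq {u : E3 → E3} (hu : Differentiable ℝ u) (hax : IsAxisymmetric u) {x : E3}
    (hx : 0 < rad x) :
    compTheta (curl3 u) x = pd 2 u (merid (rad x) (x 2)) 0 - pd 0 u (merid (rad x) (x 2)) 2 := by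
  set y := merid (rad x) (x 2) with hy
  have hradial : ∀ a b : E3, rad a = rad b → a 2 = b 2 →
      a 0 * u a 0 + a 1 * u a 1 = b 0 * u b 0 + b 1 * u b 1 := by
    intro a b hab h2
    by_cases ha : rad a = 0
    · have hb : rad b = 0 := hab ▸ ha
      rw [rad_eq_zero_iff] at ha hb
      simp [ha, hb]
    · have hb : rad b ≠ 0 := hab ▸ ha
      rw [← compR_mul_rad u a ha, ← compR_mul_rad u b hb, hab, (hax a b hab h2).1]
  have hsq : x 0 ^ 2 + x 1 ^ 2 = rad x ^ 2 := (Real.sq_sqrt (by positivity)).symm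
  have hvert : x 0 * pd 2 u x 0 + x 1 * pd 2 u x 1 = rad x * pd 2 u y 0 := by
    have h1 := ((hasDerivAt_line (hu x) (EuclideanSpace.single 2 1) 0).const_mul (x 0)).add
      ((hasDerivAt_line (hu x) (EuclideanSpace.single 2 1) 1).const_mul (x 1))
    have h2 := (hasDerivAt_line (hu y) (EuclideanSpace.single 2 1) 0).const_mul (rad x)
    refine h1.unique (h2.congr_of_eventuallyEq (Eventually.of_forall fun s => ?_))
    have h := hradial (x + s • EuclideanSpace.single 2 1) (y + s • EuclideanSpace.single 2 1)
      (by simp [rad, hy, merid]) (by simp [hy, merid])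
    simpa [hy, merid] using h
  have hrad : x 0 * pd 0 u x 2 + x 1 * pd 1 u x 2 = rad x * pd 0 u y 2 := by
    -- Moving along the horizontal position vector multiplies the radius by `1 + s` both at `x` and
    -- at its meridional representative. The vertical components therefore agree along the two
    -- lines.
    have h1 := hasDerivAt_line (hu x) (x 0 • EuclideanSpace.single 0 1
      + x 1 • EuclideanSpace.single 1 1) 2
    have h2 := hasDerivAt_line (hu y) (rad x • EuclideanSpace.single 0 1) 2
    simp only [map_add, map_smul, PiLp.add_apply, PiLp.smul_apply, smul_eq_mul] at h1 h2
    refine h1.unique (h2.congr_of_eventuallyEq (Eventually.of_forall fun s => ?_))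
    refine (hax _ _ ?_ ?_).2.2
    · change Real.sqrt _ = Real.sqrt _
      congr 1
      simp [hy, merid]
      linear_combination (1 + s) ^ 2 * hsq
    · simp [hy, merid]
  have h1 := rad_mul_compTheta (curl3 u) x
  simp only [curl3] at h1
  simp only [Matrix.cons_val_zero, Matrix.cons_val_one] at h1
  refine mul_left_cancel₀ hx.ne' (h1.trans ?_)
  linear_combination hvert - hrad

theorem continuous_merid : Continuous fun q : (ℝ × ℝ) × ℝ => (merid q.1.1 q.1.2, q.2) := by
  unfold merid; fun_prop

/-- The meridional kinetic energy density on the half-plane. -/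
def meridEnergy (w : Fin 3 → E3 × ℝ → ℝ) (q : (ℝ × ℝ) × ℝ) : ℝ :=
  w 0 (merid q.1.1 q.1.2, q.2) ^ 2 + w 2 (merid q.1.1 q.1.2, q.2) ^ 2

/-- The angular vorticity on the half-plane. -/
def meridVort (w : Fin 3 → E3 × ℝ → ℝ) (q : (ℝ × ℝ) × ℝ) : ℝ :=
  dd (sd 2) (w 0) (merid q.1.1 q.1.2, q.2) - dd (sd 0) (w 2) (merid q.1.1 q.1.2, q.2)

theorem compR_compZ_eq_meridEnergy {u : E3 → E3} (hax : IsAxisymmetric u)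
    {w : Fin 3 → E3 × ℝ → ℝ} {t : ℝ} (hw : ∀ i x, w i (x, t) = u x i) {x : E3} (hx : 0 < rad x) :
    compR u x ^ 2 + compZ u x ^ 2 = meridEnergy w ((rad x, x 2), t) := by
  have hr := rad_merid hx.le (x 2)
  obtain ⟨h1, -, h3⟩ := hax x (merid (rad x) (x 2)) hr.symm rfl
  have h4 := compR_mul_rad u (merid (rad x) (x 2)) (by rw [hr]; exact hx.ne')
  have h5 : compR u (merid (rad x) (x 2)) = u (merid (rad x) (x 2)) 0 := by
    refine mul_right_cancel₀ hx.ne' ?_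
    rw [hr] at h4
    rw [mul_comm, h4]
    simp [merid, mul_comm]
  rw [h1, h3, h5, meridEnergy, hw, hw]
  rfl

theorem vortTheta_eq_meridVort {v : E3 → ℝ → E3} {t : ℝ}
    (hu : Differentiable ℝ fun x => v x t) (hax : IsAxisymmetric fun x => v x t)
    {w : Fin 3 → E3 × ℝ → ℝ} (hwd : ∀ i, Differentiable ℝ (w i))
    (hw : ∀ i x, w i (x, t) = v x t i) {x : E3} (hx : 0 < rad x) :
    vortTheta v x t = meridVort w ((rad x, x 2), t) := by
  rw [vortTheta, compTheta_curl_eq hu hax hx, pd_eq_dd (hu _) (hwd 0) (hw 0),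
    pd_eq_dd (hu _) (hwd 2) (hw 2)]
  rfl

theorem differentiable_velocity {T : ℝ} {v : E3 → ℝ → E3} {p : E3 → ℝ → ℝ}
    (hv : IsSmoothNSSolution T v p) {t : ℝ} (ht : t ∈ Ioo (-T) 0) :
    Differentiable ℝ fun x => v x t := by
  intro x
  have ho : IsOpen ((univ : Set E3) ×ˢ Ioo (-T) 0) := isOpen_univ.prod isOpen_Ioo
  have h := (hv.smooth_velocity.contDiffAt (ho.mem_nhds (x := (x, t)) ⟨mem_univ _, ht⟩)).differentiableAt
    (by simp)
  exact DifferentiableAt.comp x (f := fun y : E3 => (y, t)) h (by fun_prop)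

/-! ### Scaling back to the physical point. -/

/-- The pointwise bound for the angular vorticity in terms of local quantities, given a bound for
the swirl. -/
theorem exists_vortTheta_bound {M : ℝ} (hM : 0 ≤ M) : ∃ C : ℝ, 0 < C ∧
    ∀ (T : ℝ) (v : E3 → ℝ → E3) (p : E3 → ℝ → ℝ), IsSmoothNSSolution T v p →
      (∀ t ∈ Ioo (-T) 0, IsAxisymmetric fun x => v x t) →
      (∀ t ∈ Ioo (-T) 0, ∀ x, |circ (fun y => v y t) x| ≤ M) →
      ∀ (x : E3) (t σ : ℝ), 0 < σ → σ ^ 2 = rad x → -T < t - rad x ^ 2 → t < 0 →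
        σ ^ 7 * |vortTheta v x t| ≤
          C * (localVelocity v x t + σ * (M + 1)) ^ 2 * (localVorticity v x t + σ * (M + 1)) := by
  obtain ⟨C, hC, hbound⟩ := exists_local_bound (N := 16 * M ^ 2) (by positivity)
  obtain ⟨ι, hι, hι'⟩ := exists_smooth_inv
  refine ⟨2 * C, by positivity, ?_⟩
  intro T v p hv hax hsw x t σ hσ hσr hT ht0
  set l := rad x with hl
  have hl0 : 0 < l := by rw [← hσr]; positivity
  obtain ⟨a, ha, ha'⟩ := exists_between hT
  obtain ⟨b, hb, hb'⟩ := exists_between ht0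
  have hab : a < b := by nlinarith
  obtain ⟨w, π, F, hw⟩ := exists_smoothFlow hv hax ha hab hb'
  have hIcc : ∀ s ∈ Icc a b, s ∈ Ioo (-T) 0 := fun s hs => ⟨ha.trans_le hs.1, hs.2.trans_lt hb'⟩
  have htime : ∀ s ∈ Icc (t - l ^ 2) t, s ∈ Icc a b := fun s hs =>
    ⟨ha'.le.trans hs.1, hs.2.trans hb.le⟩
  have hwd : ∀ i, Differentiable ℝ (w i) := fun i => (F.smooth_w i).differentiable (by simp)
  have hEc : Continuous (meridEnergy w) :=
    (((F.smooth_w 0).continuous.comp continuous_merid).pow 2).add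
      (((F.smooth_w 2).continuous.comp continuous_merid).pow 2)
  have hVc : Continuous (meridVort w) :=
    (((smooth_dd _ (F.smooth_w 0)).continuous).comp continuous_merid).sub
      (((smooth_dd _ (F.smooth_w 2)).continuous).comp continuous_merid)
  have hE : ∀ s ∈ Icc a b, ∀ y, 0 < rad y →
      compR (fun z => v z s) y ^ 2 + compZ (fun z => v z s) y ^ 2
        = meridEnergy w ((rad y, y 2), s) := fun s hs y hy =>
    compR_compZ_eq_meridEnergy (hax s (hIcc s hs)) (fun i x => hw i x s hs) hy
  have hV : ∀ s ∈ Icc a b, ∀ y, 0 < rad y →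
      vortTheta v y s = meridVort w ((rad y, y 2), s) := fun s hs y hy =>
    vortTheta_eq_meridVort (differentiable_velocity hv (hIcc s hs)) (hax s (hIcc s hs)) hwd
      (fun i x => hw i x s hs) hy
  set LV := localVelocity v x t with hLV
  set LW := localVorticity v x t with hLW
  have hLV0 : 0 ≤ LV := Real.iSup_nonneg fun s => Real.sqrt_nonneg _
  have hLW0 : 0 ≤ LW := Real.sqrt_nonneg _
  have hEint : ∀ s ∈ Icc (t - l ^ 2) t,
      l ^ 3 * ∫ q in box, meridEnergy w ((l * q.1, x 2 + l * q.2), s) ≤ LV ^ 2 := by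
    intro s hs
    have h1 := integral_box_scaled_le (h := fun q => meridEnergy w (q, s)) hl0
      (fun y => by positivity) (hEc.comp (by fun_prop))
      (fun q => by unfold meridEnergy; positivity) (hE s (htime s hs))
    -- A real supremum over an unbounded family is `0` by convention, so boundedness must be shown
    -- before any member can be compared with `localVelocity`. It follows from continuity in time on
    -- a compact interval.
    have hbdd : BddAbove (range fun s : Icc (t - l ^ 2) t => Real.sqrt
        (∫ y in Metric.ball x (4 * l),
          (compR (fun z => v z s) y ^ 2 + compZ (fun z => v z s) y ^ 2))) := by
      have hc := (continuous_integral_ball hEc x (4 * l)).sqrt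
      obtain ⟨D, hD⟩ := (isCompact_Icc (a := t - l ^ 2) (b := t)).bddAbove_image hc.continuousOn
      refine ⟨D, ?_⟩
      rintro _ ⟨s, rfl⟩
      refine le_trans (le_of_eq ?_) (hD ⟨s.1, s.2, rfl⟩)
      simp only
      congr 1
      exact integral_congr_ae
        (ae_eq_of_meridional (h := fun q => meridEnergy w (q, s)) (hE s (htime s s.2))).restrict
    have h2 := le_ciSup hbdd ⟨s, hs⟩
    simp only at h2
    have h3 : (∫ y in Metric.ball x (4 * l),
        (compR (fun z => v z s) y ^ 2 + compZ (fun z => v z s) y ^ 2)) ≤ LV ^ 2 :=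
      (Real.sqrt_le_left hLV0).1 h2
    exact h1.trans h3
  have hVint : l ^ 3 * ∫ s in (t - l ^ 2)..t, ∫ q in box,
      meridVort w ((l * q.1, x 2 + l * q.2), s) ^ 2 ≤ LW ^ 2 := by
    have hle : t - l ^ 2 ≤ t := by linarith [sq_nonneg l]
    have hnn : 0 ≤ ∫ s in (t - l ^ 2)..t, ∫ y in Metric.ball x (4 * l), vortTheta v y s ^ 2 :=
      intervalIntegral.integral_nonneg hle fun s _ => integral_nonneg fun y => sq_nonneg _
    have hsqv : Continuous fun q => meridVort w q ^ 2 := hVc.pow 2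
    have hsq : ∀ s ∈ Icc (t - l ^ 2) t, ∀ y, 0 < rad y →
        vortTheta v y s ^ 2 = meridVort w ((rad y, y 2), s) ^ 2 := fun s hs y hy => by
      rw [hV s (htime s hs) y hy]
    rw [hLW, localVorticity, Real.sq_sqrt hnn, ← intervalIntegral.integral_const_mul]
    refine intervalIntegral.integral_mono_on hle ?_ ?_ ?_
    · refine (continuous_const.mul (continuous_parametric_integral_of_continuous
        (f := fun s (q : ℝ × ℝ) => meridVort w ((l * q.1, x 2 + l * q.2), s) ^ 2) ?_
        isCompact_box)).intervalIntegrable _ _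
      exact hsqv.comp (by fun_prop)
    · refine ((continuous_integral_ball hsqv x (4 * l)).intervalIntegrable _ _).congr ?_
      rw [uIoc_of_le hle]
      intro s hs
      exact (integral_congr_ae (ae_eq_of_meridional (h := fun q => meridVort w (q, s) ^ 2)
        (hsq s (Ioc_subset_Icc_self hs))).restrict).symm
    · intro s hs
      exact integral_box_scaled_le (h := fun q => meridVort w (q, s) ^ 2) hl0
        (fun y => sq_nonneg _) (hsqv.comp (by fun_prop)) (fun q => sq_nonneg _) (hsq s hs)
  set A := LV + σ * (M + 1) with hA
  set B := LW + σ * (M + 1) with hB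
  -- The additive term `σ (M + 1) ≥ σ` is what makes the normalized drift norm `A / σ` at least `1`,
  -- as the local problem demands.
  have hσA : σ ≤ A := by nlinarith
  have hσB : σ ≤ B := by nlinarith
  have hK : 1 ≤ A / σ := (one_le_div hσ).2 hσA
  have hswirl : ∀ y, ∀ s ∈ Ioo a b, |swirl w (y, s)| ≤ M := by
    intro y s hs
    have h := hsw s (hIcc s (Ioo_subset_Icc_self hs)) y
    simpa only [circ, swirl, hw 0 y s (Ioo_subset_Icc_self hs),
      hw 1 y s (Ioo_subset_Icc_self hs)] using h
  have hτ : ∀ τ ∈ Icc (-1 : ℝ) 0, t + l ^ 2 * τ ∈ Icc (t - l ^ 2) t := fun τ hτ =>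
    ⟨by nlinarith [hτ.1, sq_nonneg l], by nlinarith [hτ.2, sq_nonneg l]⟩
  have hen : ∀ τ ∈ Icc (-1 : ℝ) 0, ∫ q in box, (scaled l (x 2) t (w 0) (q, τ) ^ 2
      + scaled l (x 2) t (w 2) (q, τ) ^ 2) ≤ (A / σ) ^ 2 := by
    intro τ h
    have e : ∀ q : ℝ × ℝ, scaled l (x 2) t (w 0) (q, τ) ^ 2 + scaled l (x 2) t (w 2) (q, τ) ^ 2
        = l ^ 2 * meridEnergy w ((l * q.1, x 2 + l * q.2), t + l ^ 2 * τ) := by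
      intro q
      simp only [scaled, dil_eq, meridEnergy, merid]; ring
    simp only [e]
    -- The rescaled velocity contributes `l²` and the comparison with the ball `l⁻³`. The squared
    -- drift norm is therefore of order `1 / l = σ⁻²`.
    rw [integral_const_mul, div_pow, hσr, le_div_iff₀ hl0]
    calc _ = l ^ 3 * ∫ q in box, meridEnergy w ((l * q.1, x 2 + l * q.2), t + l ^ 2 * τ) := by ring
      _ ≤ LV ^ 2 := hEint _ (hτ τ h)
      _ ≤ A ^ 2 := by gcongr; rw [hA]; nlinarith
  have hdata := localData_of_smoothFlow F hl0 ha' hb hK hswirl hen hι hι'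
  have hvort : ∀ q : (ℝ × ℝ) × ℝ, scaledVort l (x 2) t w q
      = l ^ 2 * meridVort w ((l * q.1.1, x 2 + l * q.1.2), t + l ^ 2 * q.2) := by
    intro q
    have h0 := (dd_dil (hwd 0) l (x 2) t l).2.1
    have h2 := (dd_dil (hwd 2) l (x 2) t l).1
    change dd ez (fun q => l * w 0 (dil l (x 2) t q)) q
      - dd er (fun q => l * w 2 (dil l (x 2) t q)) q = _
    rw [h0, h2]
    simp only [dil_eq, meridVort, merid]; ring
  have hW : ∫ τ in (-1 : ℝ)..0, ∫ q in box, (scaledVort l (x 2) t w (q, τ) * ι q.1) ^ 2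
      ≤ (2 * LW / σ) ^ 2 := by
    have hsqv : Continuous fun q => meridVort w q ^ 2 := hVc.pow 2
    set Ψ : ℝ → ℝ := fun s => ∫ q in box, meridVort w ((l * q.1, x 2 + l * q.2), s) ^ 2 with hΨ
    have hΨc : Continuous Ψ := continuous_parametric_integral_of_continuous
        (f := fun s (q : ℝ × ℝ) => meridVort w ((l * q.1, x 2 + l * q.2), s) ^ 2)
        (hsqv.comp (by fun_prop)) isCompact_box
    have hcv : Continuous fun z : (ℝ × ℝ) × ℝ => (scaledVort l (x 2) t w z * ι z.1.1) ^ 2 := by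
      have : Continuous (scaledVort l (x 2) t w) := by
        rw [funext hvort]
        exact continuous_const.mul (hVc.comp (by fun_prop))
      exact (this.mul (hι.continuous.comp (by fun_prop))).pow 2
    calc ∫ τ in (-1 : ℝ)..0, ∫ q in box, (scaledVort l (x 2) t w (q, τ) * ι q.1) ^ 2
        ≤ ∫ τ in (-1 : ℝ)..0, 4 * l ^ 4 * Ψ (l ^ 2 * τ + t) := by
          refine intervalIntegral.integral_mono_on (by norm_num) ?_ ?_ ?_
          · exact (continuous_parametric_integral_of_continuous
              (f := fun τ (q : ℝ × ℝ) => (scaledVort l (x 2) t w (q, τ) * ι q.1) ^ 2)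
              (hcv.comp (by fun_prop : Continuous fun z : ℝ × (ℝ × ℝ) => (z.2, z.1)))
              isCompact_box).intervalIntegrable _ _
          · exact (continuous_const.mul (hΨc.comp (by fun_prop))).intervalIntegrable _ _
          · intro τ _
            rw [hΨ, ← integral_const_mul]
            refine setIntegral_mono_on ?_ ?_ isCompact_box.isClosed.measurableSet ?_
            · exact (hcv.comp (by fun_prop : Continuous fun q : ℝ × ℝ => (q, τ))).continuousOn.integrableOn_compact
                isCompact_box
            · exact (continuous_const.mul (hsqv.comp (by fun_prop :
                Continuous fun q : ℝ × ℝ => ((l * q.1, x 2 + l * q.2), l ^ 2 * τ + t)))).continuousOn.integrableOn_compact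
                isCompact_box
            · intro q hq
              have h1 := half_le_of_mem_box hq
              have h2 : ι q.1 ^ 2 ≤ 4 := by
                rw [hι' _ (by linarith), div_pow, one_pow, div_le_iff₀ (by positivity)]
                nlinarith
              rw [hvort, mul_pow, mul_pow, add_comm (l ^ 2 * τ) t]
              simp only
              have h3 : 0 ≤ (l ^ 2) ^ 2 * meridVort w ((l * q.1, x 2 + l * q.2), t + l ^ 2 * τ) ^ 2 := by
                positivity
              nlinarith
      _ = 4 * l ^ 2 * ∫ s in (t - l ^ 2)..t, Ψ s := by
          rw [intervalIntegral.integral_const_mul,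
            intervalIntegral.integral_comp_mul_add Ψ (by positivity) t, smul_eq_mul]
          have e1 : l ^ 2 * -1 + t = t - l ^ 2 := by ring
          have e2 : l ^ 2 * 0 + t = t := by ring
          rw [e1, e2]
          field_simp
      _ ≤ (2 * LW / σ) ^ 2 := by
          rw [div_pow, hσr, le_div_iff₀ hl0]
          calc _ = 4 * (l ^ 3 * ∫ s in (t - l ^ 2)..t, Ψ s) := by ring
            _ ≤ 4 * LW ^ 2 := by gcongr
            _ = _ := by ring
  have hfin := hbound _ (2 * LW / σ) _ _ _ _ hdata (by positivity) hW
  have hι1 : ι 1 = 1 := by rw [hι' 1 (by norm_num)]; norm_num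
  have hpt : scaledVort l (x 2) t w ((1, 0), 0) * ι 1 = l ^ 2 * vortTheta v x t := by
    rw [hvort, hι1, hV t (htime t ⟨by linarith [sq_nonneg l], le_rfl⟩) x hl0]
    simp [hl]
  simp only [hpt] at hfin
  rw [abs_mul, abs_of_nonneg (sq_nonneg l)] at hfin
  -- The additive `1` of the local estimate is absorbed by the term `σ (M + 1)` in `B`.
  have hWB : 2 * LW / σ + 1 ≤ 2 * B / σ := by
    rw [div_add_one hσ.ne']
    gcongr
    nlinarith
  -- The exponent `7` consists of `4` from the factor `l² = σ⁴` relating `Ω` to the vorticity, and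
  -- `3` from the three factors `1 / σ` in the drift and vorticity norms.
  calc σ ^ 7 * |vortTheta v x t| = σ ^ 3 * (l ^ 2 * |vortTheta v x t|) := by rw [← hσr]; ring
    _ ≤ σ ^ 3 * (C * (A / σ) ^ 2 * (2 * LW / σ + 1)) := by gcongr
    _ ≤ σ ^ 3 * (C * (A / σ) ^ 2 * (2 * B / σ)) := by gcongr
    _ = 2 * C * A ^ 2 * B := by field_simp

end AxisymNS

end

/-! ### The main estimate. -/

theorem theorem1p2 (v₀ : AxisymNS.E3 → AxisymNS.E3)
    (hv₀ : MemLp v₀ 2 volume)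
    (hswirl : MemLp (fun x => AxisymNS.rad x * AxisymNS.compTheta v₀ x) ⊤ volume) :
    ∃ C : ℝ, 0 < C ∧
      ∀ (T : ℝ) (v : AxisymNS.E3 → ℝ → AxisymNS.E3) (p : AxisymNS.E3 → ℝ → ℝ),
        0 < T →
        AxisymNS.IsSmoothNSSolution T v p →
        (∀ t ∈ Ioo (-T) 0, AxisymNS.IsAxisymmetric (fun x => v x t)) →
        AxisymNS.IsLerayHopf T v₀ v →
        ∀ (x : AxisymNS.E3) (t r R : ℝ),
          R = min 1 (Real.sqrt (T / 2)) →
          r = AxisymNS.rad x →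
          t ∈ Ioo (-(R ^ 2)) 0 →
          r ∈ Ioo 0 (min R (1 / 2)) →
          |AxisymNS.vortTheta v x t| ≤
            C * Real.log (1 / r) / r ^ (7 / 2 : ℝ)
              * (AxisymNS.localVelocity v x t
                  + r ^ (1 / 2 : ℝ) * (AxisymNS.swirlNorm v₀ + 1)) ^ 2
              * (AxisymNS.localVorticity v x t
                  + r ^ (1 / 2 : ℝ) * (AxisymNS.swirlNorm v₀ + 1)) := by
  obtain ⟨C, hC, hbound⟩ := AxisymNS.exists_vortTheta_bound (M := AxisymNS.swirlNorm v₀)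
    ENNReal.toReal_nonneg
  have hlog2 : 0 < Real.log 2 := Real.log_pos (by norm_num)
  -- Since `r < 1/2`, the ratio `log (1/r) / log 2` is at least `1`, so the logarithmic factor can
  -- be inserted at no cost.
  refine ⟨C / Real.log 2, by positivity, ?_⟩
  intro T v p hT hv hax hL x t r R hR hr ht hrR
  have hr0 : 0 < r := hrR.1
  have hrR' : r < R := hrR.2.trans_le (min_le_left _ _)
  have hr2 : r < 1 / 2 := hrR.2.trans_le (min_le_right _ _)
  have hR2 : R ^ 2 ≤ T / 2 := by
    have h1 : R ≤ Real.sqrt (T / 2) := hR ▸ min_le_right _ _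
    calc R ^ 2 ≤ Real.sqrt (T / 2) ^ 2 := by gcongr; linarith
      _ = T / 2 := Real.sq_sqrt (by positivity)
  have hrsq : r ^ 2 < R ^ 2 := by gcongr
  -- The bound `R² ≤ T/2` is used twice, once for `t > -R²` and once for `r² < R²`, so that the
  -- whole backward cylinder lies in the time interval.
  have hstart : -T < t - AxisymNS.rad x ^ 2 := by rw [← hr]; linarith [ht.1]
  set σ : ℝ := r ^ (1 / 2 : ℝ) with hσdef
  have hσ : 0 < σ := Real.rpow_pos_of_pos hr0 _
  have hσ2 : σ ^ 2 = r := by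
    rw [hσdef, ← Real.rpow_natCast, ← Real.rpow_mul hr0.le]; norm_num
  have hσ7 : r ^ (7 / 2 : ℝ) = σ ^ 7 := by
    rw [hσdef, ← Real.rpow_natCast, ← Real.rpow_mul hr0.le]; norm_num
  have key := hbound T v p hv hax
    (fun s hs y => AxisymNS.abs_circ_le_swirlNorm hT hv₀ hswirl hv hax hL hs y)
    x t σ hσ (hσ2.trans hr) hstart ht.2
  have hlog : Real.log 2 ≤ Real.log (1 / r) := by
    refine Real.log_le_log (by norm_num) ?_
    rw [le_div_iff₀ hr0]; linarith
  have hM : 0 ≤ AxisymNS.swirlNorm v₀ := ENNReal.toReal_nonneg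
  have hLW : 0 ≤ AxisymNS.localVorticity v x t := Real.sqrt_nonneg _
  rw [hσ7]
  generalize AxisymNS.localVelocity v x t + σ * (AxisymNS.swirlNorm v₀ + 1) = A at key ⊢
  have hB : 0 ≤ AxisymNS.localVorticity v x t + σ * (AxisymNS.swirlNorm v₀ + 1) := by positivity
  generalize AxisymNS.localVorticity v x t + σ * (AxisymNS.swirlNorm v₀ + 1) = B at key hB ⊢
  have hq : 1 ≤ Real.log (1 / r) / Real.log 2 := (one_le_div hlog2).2 hlog
  calc |AxisymNS.vortTheta v x t| ≤ C * A ^ 2 * B / σ ^ 7 := by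
        rw [le_div_iff₀ (by positivity)]; linarith
    _ ≤ (Real.log (1 / r) / Real.log 2) * (C * A ^ 2 * B / σ ^ 7) :=
        le_mul_of_one_le_left (by positivity) hq
    _ = C / Real.log 2 * Real.log (1 / r) / σ ^ 7 * A ^ 2 * B := by ring
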